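/- Let $0<q<1$, $\Delta>0$, $N\ge 1$, and write $N=2j+1$ or $N=2j$. Let $e_1+e_2\neq0$ and $\alpha=e_1/(e_1+e_2)$. Write $(x;q)_k=\prod_{i=0}^{k-1}(1-xq^i)$. For nonzero reals $a,b,c,d$ let $$A_n=\frac{(1-abq^n)(1-acq^n)(1-adq^n)(1-abcdq^{n-1})}{a(1-abcdq^{2n-1})(1-abcdq^{2n})},\qquad C_n=\frac{a(1-q^n)(1-bcq^{n-1})(1-bdq^{n-1})(1-cdq^{n-1})}{(1-abcdq^{2n-2})(1-abcdq^{2n-1})}$$ be the Askey-Wilson recurrence coefficients. Put $b=a^{-1}q^{-j+e_1t}$, and $d=c^{-1}q^{-j+e_2t}$ if $N=2j+1$, $d=c^{-1}q^{-j+1+e_2t}$ if $N=2j$. For $a,c\ne0$ the limits $b_n=\lim_{t\to0}\frac12(a+a^{-1}-A_n-C_n)$ $(0\le n\le N)$ and $u_n=\lim_{t\to0}\frac14A_{n-1}C_n$ $(1\le n\le N)$ exist. Let $R_0,\dots,R_{N+1}$ be the monic polynomials ($q$-para-Racah polynomials) with $R_{-1}=0$, $R_0=1$, $xR_n=R_{n+1}+b_nR_n+u_nR_{n-1}$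 for $0\le n\le N$, and let $x_{2s}=\frac12(a^{-1}q^{-s}+aq^s)$, $x_{2s+1}=\frac12(c^{-1}q^{-s}+cq^s)$. Let $a,c$ be real functions of $\theta$ with $ac=\theta$ and $a/c=\Delta$ for all large $\theta$, and let $\theta\to\infty$. Then for $0\le s\le N$ one has $\frac{2a}{\theta}x_s\to y_s$, where $y_{2s}=\Delta q^s$, $y_{2s+1}=q^s$; moreover $\frac{2a}{\theta}b_n\to\tilde b_n$ $(0\le n\le N)$, $\frac{4a^2}{\theta^2}u_n\to\tilde u_n$ $(1\le n\le N)$, and there are polynomials $Q_0,\dots,Q_{N+1}$ (the $q$-para-Krawtchouk polynomials, not depending on the choice of $a,c$) such that for every real $y$ $$\Big(\frac{\theta}{2a}\Big)^{-n}R_n\Big(\frac{\theta}{2a}y\Big)\to Q_n(y)\quad(0\le n\le N+1),$$ $$Q_{-1}=0,\quad Q_0=1,\quad yQ_n(y)=Q_{n+1}(y)+\tilde b_nQ_n(y)+\tilde u_nQ_{n-1}(y)\quad(0\le n\le N).$$ Here, for $N=2j+1$, $$\tilde b_n=\begin{cases}\frac{q^{n+j}(1+q^{j+1})(1+\Delta)}{(q^j+q^n)(q^{j+1}+q^n)}&n\ne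 j,j+1,\\ \Delta-\frac{\alpha(1-q^{j+1})(\Delta-1)}{1-q}+\frac{q(1-q^j)(\Delta q-1)}{1-q^2}&n=j,\\ \Delta-\frac{(1-\alpha)(1-q^{j+1})(\Delta-1)}{1-q}+\frac{q(1-q^j)(\Delta q-1)}{1-q^2}&n=j+1,\end{cases}$$ $$\tilde u_n=\begin{cases}\frac{q^{2j+1+n}(1-q^n)(q^{2j+2}-q^n)(q^n-\Delta q^{j+1})(q^{j+1}-\Delta q^n)}{(q^{j+1}+q^n)^2(q^{2j+1}-q^{2n})(q^{2j+3}-q^{2n})}&n\ne j+1,\\ \frac{\alpha(1-\alpha)(\Delta-1)^2(1-q^{j+1})^2}{(1-q)^2}&n=j+1,\end{cases}$$ and, for $N=2j$, $$\tilde b_n=\Delta-\frac{q^{2j}(q^n-1)(q^n-\Delta q^{j+1})}{(q^j+q^n)(q^{2j+1}-q^{2n})}+\frac{q^n(q^{2j}-q^n)(q^j-\Delta q^{n+1})}{(q^j+q^n)(q^{2j}-q^{2n+1})},$$ $$\tilde u_n=\begin{cases}\frac{q^{2j+n}(q^n-1)(q^{2j+1}-q^n)(q^n-\Delta q^{j+1})(\Delta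 q^n-q^j)}{(q^j+q^n)(q^{j+1}+q^n)(q^{2j+1}-q^{2n})^2}&n\ne j,j+1,\\ \frac{(1-\alpha)(1-q^j)(1-q^{j+1})(\Delta-1)(1-q\Delta)}{(1-q)^2(1+q)}&n=j,\\ \frac{\alpha(1-q^j)(1-q^{j+1})(\Delta-1)(1-q\Delta)}{(1-q)^2(1+q)}&n=j+1.\end{cases}$$ Finally, assume $\Delta\ne q^k$ for all integers $-j\le k\le j$ (if $N=2j+1$), respectively $-j-1\le k\le j$ (if $N=2j$). Then for $0\le n,m\le N$ $$\sum_{s=0}^Nw_sQ_n(y_s)Q_m(y_s)=\tilde u_1\tilde u_2\cdots\tilde u_n\,\delta_{nm},$$ where for $N=2j+1$ $$w_{2s}=K_N\frac{(1-\alpha)(1-\frac1\Delta)q^s(\Delta q^{-j};q)_j(\frac{q^{-j}}\Delta;q)_j(q^{-j};q)_s(\Delta q^{-j};q)_s}{(q;q)_s(\frac1\Delta;q)_{j+1}\Delta^j(\Delta q;q)_s},$$ $$w_{2s+1}=K_N\frac{\alpha(1-\Delta)\Delta^jq^s(\frac{q^{-j}}\Delta;q)_j(\Delta q^{-j};q)_j(q^{-j};q)_s(\frac{q^{-j}}\Delta;q)_s}{(q;q)_s(\Delta;q)_{j+1}(\frac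 q\Delta;q)_s},\qquad K_N=\frac{(-1)^jq^{j(j-1)}(1-q^{2j+1})}{(1-q)(-q;q)_j(q^{-2j-1};q^2)_j},$$ and for $N=2j$ $$w_{2s}=K_N\frac{(1-\alpha)q^s(q^{-j};q)_s(\Delta q^{1-j};q)_s}{\Delta^j(q;q)_s(\frac q\Delta;q)_j(\Delta q;q)_s},\qquad w_{2s+1}=K_N\frac{\alpha\Delta^{j-1}(1-q^j)q^s(q^{1-j};q)_s(\frac{q^{-j}}\Delta;q)_s}{(1-\frac{q^j}\Delta)(q;q)_s(\Delta q;q)_j(\frac q\Delta;q)_s},$$ $$K_N=\frac{(-1)^jq^{\frac32j(j-1)}(q^j+1)(1-q^{j+1})(1-q^{2j+1})(q^{-2j-1};q)_j(1-\Delta q)(\frac{q^{-j-1}}\Delta;q)_j(\Delta q^{-j};q)_j}{(1-\Delta q^{j+1})(1-q)^2(q^{-2j-1};q^2)_j^2(-q;q)_j^2}.$$ -/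

import Mathlib

open Filter Topology Polynomial

noncomputable section

namespace QPara

/-- The `q`-Pochhammer symbol `(x;q)_k = (1-x)(1-xq)⋯(1-xq^{k-1})`. -/
def qPoch (x q : ℝ) (k : ℕ) : ℝ := ∏ i ∈ Finset.range k, (1 - x * q ^ i)

/-! ### Askey-Wilson recurrence coefficients -/

/-- The Askey-Wilson coefficient `A_n`. -/
def awA (a b c d q : ℝ) (n : ℤ) : ℝ :=
  (1 - a * b * q ^ n) * (1 - a * c * q ^ n) * (1 - a * d * q ^ n)
      * (1 - a * b * c * d * q ^ (n - 1))
    / (a * (1 - a * b * c * d * q ^ (2 * n - 1)) * (1 - a * b * c * d * q ^ (2 * n)))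

/-- The Askey-Wilson coefficient `C_n`. -/
def awC (a b c d q : ℝ) (n : ℤ) : ℝ :=
  a * (1 - q ^ n) * (1 - b * c * q ^ (n - 1)) * (1 - b * d * q ^ (n - 1))
      * (1 - c * d * q ^ (n - 1))
    / ((1 - a * b * c * d * q ^ (2 * n - 2)) * (1 - a * b * c * d * q ^ (2 * n - 1)))

/-- Diagonal recurrence coefficient of the monic Askey-Wilson polynomials. -/
def awDiag (a b c d q : ℝ) (n : ℕ) : ℝ :=
  1 / 2 * (a + a⁻¹ - awA a b c d q n - awC a b c d q n)

/-- Off-diagonal recurrence coefficient of the monic Askey-Wilson polynomials (for `n ≥ 1`). -/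
def awOff (a b c d q : ℝ) (n : ℕ) : ℝ :=
  1 / 4 * (awA a b c d q ((n : ℤ) - 1) * awC a b c d q n)

/-! ### The singular truncation: `q`-para-Racah polynomials

`N = 2j+1` or `N = 2j`, so that `j = N / 2` (integer division) in both cases. -/

/-- `b = a⁻¹ q^{-j + e₁ t}`. -/
def truncB (N : ℕ) (q e₁ a t : ℝ) : ℝ := a⁻¹ * q ^ (-((N / 2 : ℕ) : ℝ) + e₁ * t)

/-- `d = c⁻¹ q^{-j + e₂ t}` for `N = 2j+1`, and `d = c⁻¹ q^{-j + 1 + e₂ t}` for `N = 2j`. -/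
def truncD (N : ℕ) (q e₂ c t : ℝ) : ℝ :=
  c⁻¹ * q ^ (-((N / 2 : ℕ) : ℝ) + (if Odd N then 0 else 1) + e₂ * t)

/-- The diagonal Askey-Wilson coefficient along the truncation, as a function of `t`. -/
def truncDiag (N : ℕ) (q e₁ e₂ a c : ℝ) (n : ℕ) (t : ℝ) : ℝ :=
  awDiag a (truncB N q e₁ a t) c (truncD N q e₂ c t) q n

/-- The off-diagonal Askey-Wilson coefficient along the truncation, as a function of `t`. -/
def truncOff (N : ℕ) (q e₁ e₂ a c : ℝ) (n : ℕ) (t : ℝ) : ℝ :=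
  awOff a (truncB N q e₁ a t) c (truncD N q e₂ c t) q n

/-- `b_n = lim_{t → 0} (a + a⁻¹ - A_n - C_n) / 2`. -/
def racahB (N : ℕ) (q e₁ e₂ a c : ℝ) (n : ℕ) : ℝ :=
  limUnder (𝓝[≠] (0 : ℝ)) (truncDiag N q e₁ e₂ a c n)

/-- `u_n = lim_{t → 0} A_{n-1} C_n / 4`. -/
def racahU (N : ℕ) (q e₁ e₂ a c : ℝ) (n : ℕ) : ℝ :=
  limUnder (𝓝[≠] (0 : ℝ)) (truncOff N q e₁ e₂ a c n)

/-- The monic polynomials `P_n` with `P_{-1} = 0`, `P_0 = 1` and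
`x P_n = P_{n+1} + b_n P_n + u_n P_{n-1}`. -/
def monicOP (b u : ℕ → ℝ) : ℕ → ℝ[X]
  | 0 => 1
  | 1 => X - C (b 0)
  | n + 2 => (X - C (b (n + 1))) * monicOP b u (n + 1) - C (u (n + 1)) * monicOP b u n

/-- The monic `q`-para-Racah polynomials `R_n(x; a, c, α | q)` with `α = e₁ / (e₁ + e₂)`,
`0 ≤ n ≤ N + 1` (with `R_{N+1}` the characteristic polynomial). -/
def racah (N : ℕ) (q e₁ e₂ a c : ℝ) : ℕ → ℝ[X] :=
  monicOP (racahB N q e₁ e₂ a c) (racahU N q e₁ e₂ a c)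

/-- The biexponential bi-lattice: `x_{2s} = (a⁻¹ q^{-s} + a q^s) / 2`,
`x_{2s+1} = (c⁻¹ q^{-s} + c q^s) / 2`. -/
def xLattice (q a c : ℝ) (i : ℕ) : ℝ :=
  if Even i then 1 / 2 * (a⁻¹ * q ^ (-((i / 2 : ℕ) : ℤ)) + a * q ^ (i / 2))
  else 1 / 2 * (c⁻¹ * q ^ (-((i / 2 : ℕ) : ℤ)) + c * q ^ (i / 2))

/-! ### Data of the `q`-para-Krawtchouk polynomials -/

/-- The exponential bi-lattice: `y_{2s} = Δ q^s`, `y_{2s+1} = q^s`. -/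
def yLattice (q Δ : ℝ) (i : ℕ) : ℝ :=
  if Even i then Δ * q ^ (i / 2) else q ^ (i / 2)

/-- `b̃_n` for `N = 2j+1`. -/
def krawBOdd (j : ℕ) (q Δ α : ℝ) (n : ℕ) : ℝ :=
  if n = j then
    Δ - α * (1 - q ^ (j + 1)) * (Δ - 1) / (1 - q) + q * (1 - q ^ j) * (Δ * q - 1) / (1 - q ^ 2)
  else if n = j + 1 then
    Δ - (1 - α) * (1 - q ^ (j + 1)) * (Δ - 1) / (1 - q)
      + q * (1 - q ^ j) * (Δ * q - 1) / (1 - q ^ 2)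
  else
    q ^ (n + j) * (1 + q ^ (j + 1)) * (1 + Δ) / ((q ^ j + q ^ n) * (q ^ (j + 1) + q ^ n))

/-- `ũ_n` for `N = 2j+1`. -/
def krawUOdd (j : ℕ) (q Δ α : ℝ) (n : ℕ) : ℝ :=
  if n = j + 1 then
    α * (1 - α) * (Δ - 1) ^ 2 * (1 - q ^ (j + 1)) ^ 2 / (1 - q) ^ 2
  else
    q ^ (2 * j + 1 + n) * (1 - q ^ n) * (q ^ (2 * j + 2) - q ^ n)
        * (q ^ n - Δ * q ^ (j + 1)) * (q ^ (j + 1) - Δ * q ^ n)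
      / ((q ^ (j + 1) + q ^ n) ^ 2 * (q ^ (2 * j + 1) - q ^ (2 * n))
        * (q ^ (2 * j + 3) - q ^ (2 * n)))

/-- `b̃_n` for `N = 2j`. -/
def krawBEven (j : ℕ) (q Δ : ℝ) (n : ℕ) : ℝ :=
  Δ - q ^ (2 * j) * (q ^ n - 1) * (q ^ n - Δ * q ^ (j + 1))
      / ((q ^ j + q ^ n) * (q ^ (2 * j + 1) - q ^ (2 * n)))
    + q ^ n * (q ^ (2 * j) - q ^ n) * (q ^ j - Δ * q ^ (n + 1))
      / ((q ^ j + q ^ n) * (q ^ (2 * j) - q ^ (2 * n + 1)))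

/-- `ũ_n` for `N = 2j`. -/
def krawUEven (j : ℕ) (q Δ α : ℝ) (n : ℕ) : ℝ :=
  if n = j then
    (1 - α) * (1 - q ^ j) * (1 - q ^ (j + 1)) * (Δ - 1) * (1 - q * Δ) / ((1 - q) ^ 2 * (1 + q))
  else if n = j + 1 then
    α * (1 - q ^ j) * (1 - q ^ (j + 1)) * (Δ - 1) * (1 - q * Δ) / ((1 - q) ^ 2 * (1 + q))
  else
    q ^ (2 * j + n) * (q ^ n - 1) * (q ^ (2 * j + 1) - q ^ n)
        * (q ^ n - Δ * q ^ (j + 1)) * (Δ * q ^ n - q ^ j)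
      / ((q ^ j + q ^ n) * (q ^ (j + 1) + q ^ n) * (q ^ (2 * j + 1) - q ^ (2 * n)) ^ 2)

/-- `K_N` for `N = 2j+1`. -/
def krawKOdd (j : ℕ) (q : ℝ) : ℝ :=
  (-1) ^ j * q ^ (j * (j - 1)) * (1 - q ^ (2 * j + 1))
    / ((1 - q) * qPoch (-q) q j * qPoch (q ^ (-2 * (j : ℤ) - 1)) (q ^ 2) j)

/-- `w_{2s}` for `N = 2j+1`. -/
def krawWOddEven (j : ℕ) (q Δ α : ℝ) (s : ℕ) : ℝ :=
  krawKOdd j q *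
    ((1 - α) * (1 - 1 / Δ) * q ^ s * qPoch (Δ * q ^ (-(j : ℤ))) q j
        * qPoch (q ^ (-(j : ℤ)) / Δ) q j * qPoch (q ^ (-(j : ℤ))) q s
        * qPoch (Δ * q ^ (-(j : ℤ))) q s
      / (qPoch q q s * qPoch (1 / Δ) q (j + 1) * Δ ^ j * qPoch (Δ * q) q s))

/-- `w_{2s+1}` for `N = 2j+1`. -/
def krawWOddOdd (j : ℕ) (q Δ α : ℝ) (s : ℕ) : ℝ :=
  krawKOdd j q *
    (α * (1 - Δ) * Δ ^ j * q ^ s * qPoch (q ^ (-(j : ℤ)) / Δ) q j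
        * qPoch (Δ * q ^ (-(j : ℤ))) q j * qPoch (q ^ (-(j : ℤ))) q s
        * qPoch (q ^ (-(j : ℤ)) / Δ) q s
      / (qPoch q q s * qPoch Δ q (j + 1) * qPoch (q / Δ) q s))

/-- `K_N` for `N = 2j`. The exponent `3 j (j - 1) / 2` is an integer. -/
def krawKEven (j : ℕ) (q Δ : ℝ) : ℝ :=
  (-1) ^ j * q ^ (3 * (j * (j - 1)) / 2) * (q ^ j + 1) * (1 - q ^ (j + 1))
      * (1 - q ^ (2 * j + 1)) * qPoch (q ^ (-2 * (j : ℤ) - 1)) q j * (1 - Δ * q)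
      * qPoch (q ^ (-(j : ℤ) - 1) / Δ) q j * qPoch (Δ * q ^ (-(j : ℤ))) q j
    / ((1 - Δ * q ^ (j + 1)) * (1 - q) ^ 2 * qPoch (q ^ (-2 * (j : ℤ) - 1)) (q ^ 2) j ^ 2
      * qPoch (-q) q j ^ 2)

/-- `w_{2s}` for `N = 2j`. -/
def krawWEvenEven (j : ℕ) (q Δ α : ℝ) (s : ℕ) : ℝ :=
  krawKEven j q Δ *
    ((1 - α) * q ^ s * qPoch (q ^ (-(j : ℤ))) q s * qPoch (Δ * q ^ (1 - (j : ℤ))) q s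
      / (Δ ^ j * qPoch q q s * qPoch (q / Δ) q j * qPoch (Δ * q) q s))

/-- `w_{2s+1}` for `N = 2j`. -/
def krawWEvenOdd (j : ℕ) (q Δ α : ℝ) (s : ℕ) : ℝ :=
  krawKEven j q Δ *
    (α * Δ ^ ((j : ℤ) - 1) * (1 - q ^ j) * q ^ s * qPoch (q ^ (1 - (j : ℤ))) q s
        * qPoch (q ^ (-(j : ℤ)) / Δ) q s
      / ((1 - q ^ j / Δ) * qPoch q q s * qPoch (Δ * q) q j * qPoch (q / Δ) q s))

/-- `b̃_n`, with `j = N / 2`. -/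
def krawB (N : ℕ) (q Δ α : ℝ) (n : ℕ) : ℝ :=
  if Odd N then krawBOdd (N / 2) q Δ α n else krawBEven (N / 2) q Δ n

/-- `ũ_n`, with `j = N / 2`. -/
def krawU (N : ℕ) (q Δ α : ℝ) (n : ℕ) : ℝ :=
  if Odd N then krawUOdd (N / 2) q Δ α n else krawUEven (N / 2) q Δ α n

/-- The weight `w_i` at `y_i`, with `j = N / 2` and `i = 2s` or `i = 2s+1`. -/
def krawW (N : ℕ) (q Δ α : ℝ) (i : ℕ) : ℝ :=
  if Odd N then
    if Even i then krawWOddEven (N / 2) q Δ α (i / 2) else krawWOddOdd (N / 2) q Δ α (i / 2)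
  else
    if Even i then krawWEvenEven (N / 2) q Δ α (i / 2) else krawWEvenOdd (N / 2) q Δ α (i / 2)

end QPara

end

noncomputable section

namespace QPara

/-! ### Finite families given by a three-term recurrence -/

/-! The limits. Put `a b = r E₁` and `c d = s E₂`, where `E₁, E₂ → 1` as `t → 0`. Every factor of
`A_n` and `C_n` is continuous in `(E₁, E₂)`, so the limit is harmless except at the one index for
each of them where a denominator vanishes at `(1, 1)`. There a numerator factor vanishes as well,
and the quotient `(1 - E₁)/(1 - E₁E₂)` or `(1 - E₂)/(1 - E₁E₂)` tends to `α` or `1 - α`. The limits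
are exact products: `c` times a factor tending to `1` as `θ = ac → ∞`, times a function of `q, Δ, α`
(`krawLimA`, `krawLimC`). Hence the second limit is immediate, and `krawB_eq`, `krawU_eq` identify
its value. Values of monic polynomials depend continuously on finitely many recurrence coefficients,
so the rescaled `R_n` converge to the polynomials built from the limiting coefficients, which are
taken as `Q_n`.

Orthogonality. The lattice is the union of the geometric lattices `Δ q^s` and `q^s`. Below the
middle index the coefficients of `Q_n` coincide with those of two different `q`-Hahn families, one
living on each lattice. The `q`-Hahn weight on either lattice, of total mass `1`, therefore
annihilates the low-degree `Q_n`, `n ≥ 1` (`hahn_moment`, `HahnParam.total_mass`,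
`HahnParam.sum_mul_hahnPoly`). The weight `w` is the mixture with coefficients `1 - α` and `α` of
these two.

Above the middle index the coefficients are a mirror image of those below. Near the middle, the last
step of each `q`-Hahn recurrence produces the polynomial vanishing on its lattice
(`HahnParam.eval_monicOP_last`), so at the points of one lattice a middle `Q_p` is a constant
multiple of an earlier `Q_r`. The mirror symmetry propagates this: `Q_{p+i}` is the same constant,
times a product of `u`'s, times `Q_{r-i}`, and `Q_{N+1}` vanishes (`eval_monicOP_reflect`). The
constants on the two lattices are `ακ` and `-(1-α)κ`, whose weighted sum is `0`, while both halves
assign the same number to `Q_{r-i}`. Thus `w` annihilates the high-degree `Q_n` too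
(`sum_monicOP_mul_of_glue`). A functional of mass `1` that annihilates `Q_1, …, Q_N` and is
supported on zeros of `Q_{N+1}` gives orthogonality with norms `u_1 ⋯ u_n` (`sum_monicOP_mul_eq`).
-/

theorem eval_monicOP_add_two (b u : ℕ → ℝ) (n : ℕ) (y : ℝ) :
    (monicOP b u (n + 2)).eval y
      = (y - b (n + 1)) * (monicOP b u (n + 1)).eval y - u (n + 1) * (monicOP b u n).eval y := by
  simp [monicOP]

theorem eval_monicOP_zero (b u : ℕ → ℝ) (y : ℝ) : (monicOP b u 0).eval y = 1 := by
  simp [monicOP]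

theorem eval_monicOP_one (b u : ℕ → ℝ) (y : ℝ) : (monicOP b u 1).eval y = y - b 0 := by
  simp [monicOP]

/-- A functional annihilating `P_1, …, P_N` and the multiples of `P_{N+1}` makes the `P_n`
orthogonal. -/
theorem sum_monicOP_mul_eq (b u : ℕ → ℝ) (N : ℕ) (w y : ℕ → ℝ)
    (hone : ∑ i ∈ Finset.range (N + 1), w i = 1)
    (hzero : ∀ n, 1 ≤ n → n ≤ N →
      ∑ i ∈ Finset.range (N + 1), w i * (monicOP b u n).eval (y i) = 0)
    (hchar : ∀ i ≤ N, (monicOP b u (N + 1)).eval (y i) = 0) :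
    ∀ n ≤ N, ∀ m ≤ N,
      ∑ i ∈ Finset.range (N + 1), w i * (monicOP b u n).eval (y i) * (monicOP b u m).eval (y i)
        = if n = m then ∏ k ∈ Finset.Icc 1 n, u k else 0 := by
  set v : ℕ → ℕ → ℝ := fun n i => (monicOP b u n).eval (y i) with hv
  set S : ℕ → ℕ → ℝ := fun m n => ∑ i ∈ Finset.range (N + 1), w i * v m i * v n i with hS
  have hrec : ∀ n i, y i * v (n + 1) i = v (n + 2) i + b (n + 1) * v (n + 1) i + u (n + 1) * v n i := by
    intro n i
    have := eval_monicOP_add_two b u n (y i)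
    simp only [hv]
    rw [this]; ring
  have hrec0 : ∀ i, y i * v 0 i = v 1 i + b 0 * v 0 i := by
    intro i
    simp only [hv, eval_monicOP_zero, eval_monicOP_one]
    ring
  have hlast : ∀ m, S m (N + 1) = 0 := by
    intro m
    apply Finset.sum_eq_zero
    intro i hi
    have : v (N + 1) i = 0 := hchar i (Nat.lt_succ_iff.mp (Finset.mem_range.mp hi))
    rw [this, mul_zero]
  have hS0 : ∀ n, 1 ≤ n → n ≤ N + 1 → S 0 n = 0 := by
    intro n h1 h2
    rcases Nat.lt_or_ge N n with h | h
    · obtain rfl : n = N + 1 := by omega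
      exact hlast 0
    · have := hzero n h1 h
      simpa [hS, hv, eval_monicOP_zero] using this
  have hstep0 : ∀ n, S 1 (n + 1)
      = S 0 (n + 2) + (b (n + 1) - b 0) * S 0 (n + 1) + u (n + 1) * S 0 n := by
    intro n
    simp only [hS, Finset.mul_sum, ← Finset.sum_add_distrib]
    refine Finset.sum_congr rfl fun i _ => ?_
    linear_combination (w i * v 0 i) * hrec n i - (w i * v (n + 1) i) * hrec0 i
  -- Multiplication by `y` is symmetric for the form `S`; expanding it by the recurrence on either
  -- index trades a step in `m` for a step in `n`.
  have hstep : ∀ m n, S (m + 2) (n + 1) = S (m + 1) (n + 2)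
      + (b (n + 1) - b (m + 1)) * S (m + 1) (n + 1) + u (n + 1) * S (m + 1) n
      - u (m + 1) * S m (n + 1) := by
    intro m n
    simp only [hS, Finset.mul_sum, ← Finset.sum_add_distrib, ← Finset.sum_sub_distrib]
    refine Finset.sum_congr rfl fun i _ => ?_
    linear_combination (w i * v (m + 1) i) * hrec n i - (w i * v (n + 1) i) * hrec m i
  have hh : ∀ k, ∏ l ∈ Finset.Icc 1 (k + 1), u l = u (k + 1) * ∏ l ∈ Finset.Icc 1 k, u l := by
    intro k
    rw [Finset.prod_Icc_succ_top (by omega), mul_comm]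
  have h00 : S 0 0 = 1 := by
    simpa [hS, hv, eval_monicOP_zero] using hone
  -- Lowering `m` raises `n` by one, so the claim must include `n = N + 1`, where it holds because
  -- `P_{N+1}` vanishes at every `y i`.
  have key : ∀ m, m ≤ N → ∀ n, m ≤ n → n ≤ N + 1 →
      S m n = if m = n then ∏ k ∈ Finset.Icc 1 m, u k else 0 := by
    intro m
    induction m using Nat.strong_induction_on with
    | _ m ih =>
      intro hm n hmn hn
      rcases Nat.eq_zero_or_pos n with rfl | hn0
      · obtain rfl : m = 0 := by omega
        simpa using h00
      by_cases hnN : n = N + 1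
      · rw [hnN, hlast, if_neg (by omega)]
      obtain ⟨n, rfl⟩ := Nat.exists_eq_add_of_le' hn0
      match m, ih, hm, hmn with
      | 0, _, _, _ => rw [hS0 _ (by omega) hn, if_neg (by omega)]
      | 1, ih, hm, hmn =>
        rw [hstep0, hS0 (n + 2) (by omega) (by omega), hS0 (n + 1) (by omega) hn,
          ih 0 (by omega) (by omega) n (by omega) (by omega)]
        by_cases h : n = 0
        · subst h; simp
        · rw [if_neg (by omega), if_neg (by omega)]; ring
      | m + 2, ih, hm, hmn =>
        rw [hstep, ih (m + 1) (by omega) (by omega) (n + 2) (by omega) (by omega),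
          ih (m + 1) (by omega) (by omega) (n + 1) (by omega) (by omega),
          ih (m + 1) (by omega) (by omega) n (by omega) (by omega),
          ih m (by omega) (by omega) (n + 1) (by omega) (by omega),
          if_neg (by omega), if_neg (by omega), if_neg (show m ≠ n + 1 by omega)]
        by_cases h : m + 1 = n
        · subst h
          rw [if_pos rfl, if_pos rfl, hh (m + 1)]; ring
        · rw [if_neg h, if_neg (by omega)]; ring
  intro n hn m hm
  rcases le_total n m with h | h
  · exact key n hn m h (by omega)
  · have hk := key m hm n h (by omega)
    have hsymm : S m n = S n m :=
      Finset.sum_congr rfl fun i _ => by ring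
    rw [hsymm] at hk
    change S n m = _
    rw [hk]
    by_cases e : n = m
    · rw [if_pos e, if_pos e.symm, e]
    · rw [if_neg e, if_neg (Ne.symm e)]

/-- Reflection: if the recurrence coefficients are mirror symmetric beyond the index `p`, then the
values at `y` beyond `p` are proportional to those below `r`. -/
theorem eval_monicOP_reflect (b u : ℕ → ℝ) (y κ : ℝ) (p r : ℕ)
    (hb : ∀ i, 1 ≤ i → i ≤ r → b (p + i) = b (r - i))
    (hu : ∀ i, 1 ≤ i → i ≤ r → u (p + i) = u (r + 1 - i))
    (h₀ : (monicOP b u p).eval y = κ * (monicOP b u r).eval y)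
    (h₁ : (monicOP b u (p + 1)).eval y
      = κ * ((y - b r) * (monicOP b u r).eval y - (monicOP b u (r + 1)).eval y)) :
    (∀ i ≤ r, (monicOP b u (p + i)).eval y
        = κ * (∏ l ∈ Finset.range i, u (r - l)) * (monicOP b u (r - i)).eval y) ∧
      (monicOP b u (p + r + 1)).eval y = 0 := by
  -- Two consecutive values determine the next. The second one is left as `(y - b) P_{r-i} -
  -- P_{r-i+1}` instead of `u P_{r-i-1}`, so that it still makes sense at `i = r`.
  have key : ∀ i ≤ r, (monicOP b u (p + i)).eval y
        = κ * (∏ l ∈ Finset.range i, u (r - l)) * (monicOP b u (r - i)).eval y ∧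
      (monicOP b u (p + i + 1)).eval y = κ * (∏ l ∈ Finset.range i, u (r - l)) *
        ((y - b (r - i)) * (monicOP b u (r - i)).eval y
          - (monicOP b u (r - i + 1)).eval y) := by
    intro i
    induction i with
    | zero => intro _; simpa using ⟨h₀, h₁⟩
    | succ i ih =>
      intro hi
      obtain ⟨ih₀, ih₁⟩ := ih (by omega)
      obtain ⟨k, hk⟩ : ∃ k, r - i = k + 1 := ⟨r - i - 1, by omega⟩
      have e1 : r - (i + 1) = k := by omega
      have hrec := eval_monicOP_add_two b u k y
      have hA : (monicOP b u (p + (i + 1))).eval y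
          = κ * (∏ l ∈ Finset.range (i + 1), u (r - l)) * (monicOP b u (r - (i + 1))).eval y := by
        rw [← add_assoc, ih₁, Finset.prod_range_succ, hk, e1, hrec]
        ring
      refine ⟨hA, ?_⟩
      have hrec' := eval_monicOP_add_two b u (p + i) y
      have e2 : p + (i + 1) + 1 = p + i + 2 := by ring
      rw [e2, hrec', add_assoc p i 1, hA, hb (i + 1) (by omega) hi, hu (i + 1) (by omega) hi, ih₀,
        Finset.prod_range_succ, e1, hk, show r + 1 - (i + 1) = k + 1 by omega]
      ring
  refine ⟨fun i hi => (key i hi).1, ?_⟩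
  -- At `i = r` the bracket is `(y - b 0) P_0 - P_1 = 0`.
  have h := (key r le_rfl).2
  rw [h, Nat.sub_self, eval_monicOP_zero, zero_add, eval_monicOP_one]
  ring

/-! ### The `q`-Hahn family -/

/-- The basis polynomial `∏_{i<k} (y - D q^i)`. -/
def hahnBasis (D q : ℝ) (k : ℕ) (y : ℝ) : ℝ := ∏ i ∈ Finset.range k, (y - D * q ^ i)

/-- Coefficients of the `q`-Hahn polynomials in `hahnBasis`, normalized to be `1` at `k = 0`. -/
def hahnCoef (q G r₁ r₂ p : ℝ) (n k : ℕ) : ℝ :=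
  (∏ i ∈ Finset.range k, (1 - q ^ i / q ^ n)) * (∏ i ∈ Finset.range k, (1 - p * q ^ (n + i)))
    * ∏ i ∈ Finset.range k, (q / ((1 - r₁ * q ^ i) * (1 - r₂ * q ^ i) * (1 - q ^ (i + 1)) * G))

/-- The `q`-Hahn polynomials normalized to be `1` at `y = D`. -/
def hahnPoly (D q G r₁ r₂ p : ℝ) (n : ℕ) (y : ℝ) : ℝ :=
  ∑ k ∈ Finset.range (n + 1), hahnCoef q G r₁ r₂ p n k * hahnBasis D q k y

/-- Raising coefficient of the recurrence of `hahnPoly`. -/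
def hahnA (q G r₁ r₂ p : ℝ) (n : ℕ) : ℝ :=
  -G * q ^ n * (1 - r₁ * q ^ n) * (1 - r₂ * q ^ n) * (1 - p * q ^ n)
    / ((1 - p * q ^ (2 * n)) * (1 - p * q ^ (2 * n + 1)))

/-- Lowering coefficient of the recurrence of `hahnPoly`. -/
def hahnC (q G r₁ r₂ p : ℝ) (n : ℕ) : ℝ :=
  G * (1 - q ^ n) * (r₁ - p * q ^ n) * (r₂ - p * q ^ n)
    / (p * (q - p * q ^ (2 * n)) * (1 - p * q ^ (2 * n)))

/-- The lowering coefficient at the last index `M`, where `r₁ q^M = 1`. -/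
def hahnCLast (q G r₁ r₂ p : ℝ) (M : ℕ) : ℝ :=
  G * (1 - q ^ M) * r₁ * (r₂ - p * q ^ M) / (p * (q - p * q ^ (2 * M)))

theorem hahnCoef_zero (q G r₁ r₂ p : ℝ) (n : ℕ) : hahnCoef q G r₁ r₂ p n 0 = 1 := by
  simp [hahnCoef]

theorem hahnCoef_eq_zero {q : ℝ} (hq : q ≠ 0) (G r₁ r₂ p : ℝ) {n k : ℕ} (h : n < k) :
    hahnCoef q G r₁ r₂ p n k = 0 := by
  have : ∏ i ∈ Finset.range k, (1 - q ^ i / q ^ n) = 0 :=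
    Finset.prod_eq_zero (Finset.mem_range.mpr h) (by rw [div_self (pow_ne_zero _ hq), sub_self])
  rw [hahnCoef, this, zero_mul, zero_mul]

theorem hahnPoly_eq_sum {q : ℝ} (hq : q ≠ 0) (D G r₁ r₂ p : ℝ) {n m : ℕ} (h : n ≤ m) (y : ℝ) :
    hahnPoly D q G r₁ r₂ p n y
      = ∑ k ∈ Finset.range (m + 1), hahnCoef q G r₁ r₂ p n k * hahnBasis D q k y := by
  refine Finset.sum_subset (fun k hk => ?_) (fun k _ hk => ?_)
  · simp only [Finset.mem_range] at *; omega
  · rw [hahnCoef_eq_zero hq _ _ _ _ (by simpa using hk), zero_mul]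

theorem mul_hahnBasis (D q : ℝ) (k : ℕ) (y : ℝ) :
    (y - D) * hahnBasis D q k y
      = hahnBasis D q (k + 1) y + D * (q ^ k - 1) * hahnBasis D q k y := by
  rw [hahnBasis, hahnBasis, Finset.prod_range_succ]; ring

/-! ### The `q`-Hahn three-term recurrence, coefficient by coefficient. -/

theorem prod_shift_up {q : ℝ} (hq : q ≠ 0) (n k : ℕ) :
    ∏ i ∈ Finset.range (k + 1), (1 - q ^ i / q ^ (n + 1))
      = (1 - 1 / (q * q ^ n)) * ∏ i ∈ Finset.range k, (1 - q ^ i / q ^ n) := by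
  rw [Finset.prod_range_succ', mul_comm, pow_zero, pow_succ' q n]
  congr 1
  refine Finset.prod_congr rfl fun i _ => ?_
  rw [pow_succ' q i, mul_div_mul_left _ _ hq]

theorem prod_shift_p (p q : ℝ) (n k : ℕ) :
    ∏ i ∈ Finset.range (k + 1), (1 - p * q ^ (n + i))
      = (1 - p * q ^ n) * ∏ i ∈ Finset.range k, (1 - p * q ^ (n + 1 + i)) := by
  rw [Finset.prod_range_succ', mul_comm, add_zero]
  congr 1
  refine Finset.prod_congr rfl fun i _ => ?_
  rw [add_right_comm, add_assoc]

/-- The rational identity behind the recurrence, with `x = q^n` and `z = q^k`. The letters `F`, `g`,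
`S` stand for the three products over `i < k` in `hahnCoef`; the products belonging to `n ± 1` and
`k + 1` differ from them by single factors. The relation `hD` is what makes the two sides agree. -/
theorem hahn_identity {q D G r₁ r₂ p x z F g S : ℝ} (hq : q ≠ 0) (hx : x ≠ 0) (hp : p ≠ 0)
    (hG : G ≠ 0) (h1 : 1 - r₁ * z ≠ 0) (h2 : 1 - r₂ * z ≠ 0) (h3 : 1 - q * z ≠ 0)
    (h4 : x - 1 ≠ 0) (h5 : 1 - p * x ≠ 0) (h6 : 1 - p * x ^ 2 ≠ 0) (h7 : 1 - p * q * x ^ 2 ≠ 0)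
    (h8 : q - p * x ^ 2 ≠ 0) (hD : D * p * q = G * r₁ * r₂) :
    F * g * S + D * (q * z - 1) * (F * (1 - z / x) * (g * (1 - p * x * z))
          * (S * (q / ((1 - r₁ * z) * (1 - r₂ * z) * (1 - q * z) * G))))
      = (-G * x * (1 - r₁ * x) * (1 - r₂ * x) * (1 - p * x)
            / ((1 - p * x ^ 2) * (1 - p * q * x ^ 2)))
          * ((1 - 1 / (q * x)) * F * (g * (1 - p * x * z) * (1 - p * q * x * z) / (1 - p * x))
              * (S * (q / ((1 - r₁ * z) * (1 - r₂ * z) * (1 - q * z) * G)))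
            - F * (1 - z / x) * (g * (1 - p * x * z))
              * (S * (q / ((1 - r₁ * z) * (1 - r₂ * z) * (1 - q * z) * G))))
        + (G * (1 - x) * (r₁ - p * x) * (r₂ - p * x) / (p * (q - p * x ^ 2) * (1 - p * x ^ 2)))
          * (F * (1 - z / x) / (1 - 1 / x) * (1 - q * z / x) * ((1 - p * x / q) * g)
              * (S * (q / ((1 - r₁ * z) * (1 - r₂ * z) * (1 - q * z) * G)))
            - F * (1 - z / x) * (g * (1 - p * x * z))
              * (S * (q / ((1 - r₁ * z) * (1 - r₂ * z) * (1 - q * z) * G)))) := by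
  obtain rfl : D = G * r₁ * r₂ / (p * q) := by
    rw [eq_div_iff (mul_ne_zero hp hq), ← hD]; ring
  have h9 : (1 - 1 / x) ≠ 0 := by
    rw [one_sub_div hx]; exact div_ne_zero h4 hx
  field_simp
  ring

/-- When `r₁ x = 1` the raising coefficient drops out, and `r₁ - p x = r₁ (1 - p x²)` cancels a
factor of the denominator of the lowering one. After the cancellation neither `1 - p x²` nor `1 - p
q x²` needs to be nonzero, which matters because one of them can be zero at the singular index. -/
theorem hahn_identity_last {q D G r₁ r₂ p x z F g S : ℝ} (hq : q ≠ 0) (hx : x ≠ 0) (hp : p ≠ 0)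
    (hG : G ≠ 0) (h1 : 1 - r₁ * z ≠ 0) (h2 : 1 - r₂ * z ≠ 0) (h3 : 1 - q * z ≠ 0)
    (h4 : x - 1 ≠ 0) (h8 : q - p * x ^ 2 ≠ 0) (hD : D * p * q = G * r₁ * r₂) (hr : r₁ * x = 1) :
    F * g * S + D * (q * z - 1) * (F * (1 - z / x) * (g * (1 - p * x * z))
          * (S * (q / ((1 - r₁ * z) * (1 - r₂ * z) * (1 - q * z) * G))))
      = (G * (1 - x) * r₁ * (r₂ - p * x) / (p * (q - p * x ^ 2)))
          * (F * (1 - z / x) / (1 - 1 / x) * (1 - q * z / x) * ((1 - p * x / q) * g)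
              * (S * (q / ((1 - r₁ * z) * (1 - r₂ * z) * (1 - q * z) * G)))
            - F * (1 - z / x) * (g * (1 - p * x * z))
              * (S * (q / ((1 - r₁ * z) * (1 - r₂ * z) * (1 - q * z) * G)))) := by
  obtain rfl : r₁ = 1 / x := by rw [eq_div_iff hx, hr]
  obtain rfl : D = G * (1 / x) * r₂ / (p * q) := by
    rw [eq_div_iff (mul_ne_zero hp hq), ← hD]; ring
  have h9 : (1 - 1 / x) ≠ 0 := by
    rw [one_sub_div hx]; exact div_ne_zero h4 hx
  have h10 : 1 - 1 / x * z = (x - z) / x := by field_simp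
  have h11 : x - z ≠ 0 := by
    intro h; rw [h10, h, zero_div] at h1; exact h1 rfl
  have h12 : q - x ^ 2 * p ≠ 0 := by rwa [mul_comm]
  rw [h10]
  field_simp
  ring


/-- This compares the coefficients of `hahnBasis D q (k + 1)` in the recurrence. The case `n = 0` is
separate: there `1 - 1 / q ^ n = 0`, by which the general identity divides, but the lowering
coefficient vanishes. -/
theorem hahnPoly_rec_coef {q D G r₁ r₂ p : ℝ} {M : ℕ} (hq : q ≠ 0) (hq' : ∀ i, q ^ (i + 1) ≠ 1)
    (hp : p ≠ 0) (hG : G ≠ 0) (hD : D * p * q = G * r₁ * r₂)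
    (h1 : ∀ i < M, 1 - r₁ * q ^ i ≠ 0) (h2 : ∀ i < M, 1 - r₂ * q ^ i ≠ 0)
    (hP : ∀ i < 2 * M, 1 - p * q ^ i ≠ 0) {n k : ℕ} (hn : n < M) (hk : k ≤ n) :
    hahnCoef q G r₁ r₂ p n k + D * (q ^ (k + 1) - 1) * hahnCoef q G r₁ r₂ p n (k + 1)
      = hahnA q G r₁ r₂ p n
          * (hahnCoef q G r₁ r₂ p (n + 1) (k + 1) - hahnCoef q G r₁ r₂ p n (k + 1))
        + hahnC q G r₁ r₂ p n
          * (hahnCoef q G r₁ r₂ p (n - 1) (k + 1) - hahnCoef q G r₁ r₂ p n (k + 1)) := by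
  have e3 : ∀ i : ℕ, 1 - q ^ (i + 1) ≠ 0 := fun i => sub_ne_zero.mpr (hq' i).symm
  rcases n with _ | n
  · obtain rfl : k = 0 := by omega
    have a1 := h1 0 hn
    have a2 := h2 0 hn
    have a3 := e3 0
    have a4 := hP 0 (by omega)
    have a5 := hP 1 (by omega)
    have a6 : q - 1 ≠ 0 := by
      intro h; apply a3; rw [zero_add, pow_one]; linarith
    simp only [hahnCoef, hahnA, hahnC] at *
    simp at *
    field_simp
    ring
  · have hx : q ^ (n + 1) ≠ 0 := pow_ne_zero _ hq
    have a6 : 1 - p * (q ^ (n + 1)) ^ 2 ≠ 0 := by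
      have := hP (2 * (n + 1)) (by omega)
      rwa [mul_comm 2, pow_mul] at this
    have a7 : 1 - p * q * (q ^ (n + 1)) ^ 2 ≠ 0 := by
      have := hP (2 * (n + 1) + 1) (by omega)
      rwa [pow_succ', mul_comm 2, pow_mul, ← mul_assoc] at this
    have a8 : q - p * (q ^ (n + 1)) ^ 2 ≠ 0 := by
      have := mul_ne_zero hq (hP (2 * n + 1) (by omega))
      intro h; apply this; rw [← h]; ring
    have a4 : q ^ (n + 1) - 1 ≠ 0 := sub_ne_zero.mpr (hq' n)
    have a5 := hP (n + 1) (by omega)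
    have a9 : (1 - 1 / q ^ (n + 1)) ≠ 0 := by
      rw [one_sub_div hx]; exact div_ne_zero a4 hx
    have key := hahn_identity (F := ∏ i ∈ Finset.range k, (1 - q ^ i / q ^ (n + 1)))
      (g := ∏ i ∈ Finset.range k, (1 - p * q ^ (n + 1 + i)))
      (S := ∏ i ∈ Finset.range k,
        (q / ((1 - r₁ * q ^ i) * (1 - r₂ * q ^ i) * (1 - q ^ (i + 1)) * G)))
      hq hx hp hG (h1 k (by omega)) (h2 k (by omega)) (by rw [← pow_succ']; exact e3 k)
      a4 a5 a6 a7 a8 hD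
    have b1 := prod_shift_up hq (n + 1) k
    have b2 := prod_shift_p p q (n + 1) (k + 1)
    have b3 : ∏ i ∈ Finset.range k, (1 - q ^ i / q ^ n)
        = (∏ i ∈ Finset.range k, (1 - q ^ i / q ^ (n + 1))) * (1 - q ^ k / q ^ (n + 1))
          / (1 - 1 / q ^ (n + 1)) := by
      rw [eq_div_iff a9, ← Finset.prod_range_succ, prod_shift_up hq n k, pow_succ' q n]; ring
    have b4 := prod_shift_p p q n k
    have b5 : ∏ i ∈ Finset.range (k + 1), (1 - p * q ^ (n + 1 + 1 + i))
        = (∏ i ∈ Finset.range k, (1 - p * q ^ (n + 1 + i))) * (1 - p * q ^ (n + 1) * q ^ k)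
          * (1 - p * q * q ^ (n + 1) * q ^ k) / (1 - p * q ^ (n + 1)) := by
      rw [eq_div_iff a5, mul_comm, ← b2, Finset.prod_range_succ, Finset.prod_range_succ]
      ring
    have b6 : (1 - q ^ k / q ^ n) = (1 - q * q ^ k / q ^ (n + 1)) := by
      rw [pow_succ' q n, mul_div_mul_left _ _ hq]
    have b7 : 1 - p * q ^ n = 1 - p * q ^ (n + 1) / q := by
      field_simp
      ring
    simp only [hahnCoef, hahnA, hahnC, Nat.add_sub_cancel]
    rw [b1, b4, b5, b7, Finset.prod_range_succ (fun i => 1 - q ^ i / q ^ n), b3, b6]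
    simp only [Finset.prod_range_succ]
    rw [show 2 * (n + 1) + 1 = (n + 1) * 2 + 1 by ring, pow_succ' q ((n + 1) * 2),
      show 2 * (n + 1) = (n + 1) * 2 by ring, pow_mul q (n + 1) 2, pow_succ' q k, pow_add q (n + 1) k]
    simp only [← mul_assoc] at key ⊢
    exact key

theorem hahnPoly_rec_coef_last {q D G r₁ r₂ p : ℝ} {M : ℕ} (hq : q ≠ 0)
    (hq' : ∀ i, q ^ (i + 1) ≠ 1)
    (hp : p ≠ 0) (hG : G ≠ 0) (hD : D * p * q = G * r₁ * r₂)
    (h1 : ∀ i < M, 1 - r₁ * q ^ i ≠ 0) (h2 : ∀ i < M, 1 - r₂ * q ^ i ≠ 0)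
    (hP : ∀ i < 2 * M, 1 - p * q ^ i ≠ 0) (hr : r₁ * q ^ M = 1) {k : ℕ} (hk : k < M) :
    hahnCoef q G r₁ r₂ p M k + D * (q ^ (k + 1) - 1) * hahnCoef q G r₁ r₂ p M (k + 1)
      = hahnCLast q G r₁ r₂ p M
          * (hahnCoef q G r₁ r₂ p (M - 1) (k + 1) - hahnCoef q G r₁ r₂ p M (k + 1)) := by
  have e3 : ∀ i : ℕ, 1 - q ^ (i + 1) ≠ 0 := fun i => sub_ne_zero.mpr (hq' i).symm
  obtain ⟨n, rfl⟩ := Nat.exists_eq_add_of_le' (show 1 ≤ M by omega)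
  have hx : q ^ (n + 1) ≠ 0 := pow_ne_zero _ hq
  have a8 : q - p * (q ^ (n + 1)) ^ 2 ≠ 0 := by
    have := mul_ne_zero hq (hP (2 * n + 1) (by omega))
    intro h; apply this; rw [← h]; ring
  have a4 : q ^ (n + 1) - 1 ≠ 0 := sub_ne_zero.mpr (hq' n)
  have a9 : (1 - 1 / q ^ (n + 1)) ≠ 0 := by
    rw [one_sub_div hx]; exact div_ne_zero a4 hx
  have key := hahn_identity_last (F := ∏ i ∈ Finset.range k, (1 - q ^ i / q ^ (n + 1)))
    (g := ∏ i ∈ Finset.range k, (1 - p * q ^ (n + 1 + i)))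
    (S := ∏ i ∈ Finset.range k,
      (q / ((1 - r₁ * q ^ i) * (1 - r₂ * q ^ i) * (1 - q ^ (i + 1)) * G)))
    hq hx hp hG (h1 k (by omega)) (h2 k (by omega)) (by rw [← pow_succ']; exact e3 k)
    a4 a8 hD hr
  have b3 : ∏ i ∈ Finset.range k, (1 - q ^ i / q ^ n)
      = (∏ i ∈ Finset.range k, (1 - q ^ i / q ^ (n + 1))) * (1 - q ^ k / q ^ (n + 1))
        / (1 - 1 / q ^ (n + 1)) := by
    rw [eq_div_iff a9, ← Finset.prod_range_succ, prod_shift_up hq n k, pow_succ' q n]; ring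
  have b4 := prod_shift_p p q n k
  have b6 : (1 - q ^ k / q ^ n) = (1 - q * q ^ k / q ^ (n + 1)) := by
    rw [pow_succ' q n, mul_div_mul_left _ _ hq]
  have b7 : 1 - p * q ^ n = 1 - p * q ^ (n + 1) / q := by
    field_simp
    ring
  simp only [hahnCoef, hahnCLast, Nat.add_sub_cancel]
  rw [b4, b7, Finset.prod_range_succ (fun i => 1 - q ^ i / q ^ n), b3, b6]
  simp only [Finset.prod_range_succ]
  rw [show 2 * (n + 1) = (n + 1) * 2 by ring, pow_mul q (n + 1) 2, pow_succ' q k,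
    pow_add q (n + 1) k]
  simp only [← mul_assoc] at key ⊢
  exact key

/-! ### `q`-Hahn polynomials: recurrence, monic form, annihilating functionals. -/

section

/-- Multiplication by `y - D` is bidiagonal in the basis. The diagonal term carries `q ^ k - 1`,
which kills `k = 0`, so the sum can be reindexed to involve only basis elements of positive degree.
-/
theorem sub_mul_hahnPoly {q : ℝ} (hq : q ≠ 0) (D G r₁ r₂ p : ℝ) (n : ℕ) (y : ℝ) :
    (y - D) * hahnPoly D q G r₁ r₂ p n y
      = ∑ k ∈ Finset.range (n + 1), (hahnCoef q G r₁ r₂ p n k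
          + D * (q ^ (k + 1) - 1) * hahnCoef q G r₁ r₂ p n (k + 1)) * hahnBasis D q (k + 1) y := by
  have h0 : ∑ k ∈ Finset.range (n + 1), hahnCoef q G r₁ r₂ p n k * (D * (q ^ k - 1))
        * hahnBasis D q k y
      = ∑ k ∈ Finset.range (n + 1), D * (q ^ (k + 1) - 1) * hahnCoef q G r₁ r₂ p n (k + 1)
        * hahnBasis D q (k + 1) y := by
    rw [Finset.sum_range_succ', Finset.sum_range_succ _ n,
      hahnCoef_eq_zero hq G r₁ r₂ p (Nat.lt_succ_self n)]
    simp only [pow_zero, sub_self, mul_zero, zero_mul, add_zero]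
    exact Finset.sum_congr rfl fun i _ => by ring
  simp only [add_mul, Finset.sum_add_distrib]
  rw [← h0, hahnPoly, Finset.mul_sum, ← Finset.sum_add_distrib]
  refine Finset.sum_congr rfl fun k _ => ?_
  linear_combination hahnCoef q G r₁ r₂ p n k * mul_hahnBasis D q k y

/-- The constant terms cancel by the normalization at `y = D`, so differences are supported on the
same basis elements as `(y - D)` times a polynomial. -/
theorem hahnPoly_sub {q : ℝ} (hq : q ≠ 0) (D G r₁ r₂ p : ℝ) {n n' m : ℕ} (h : n ≤ m + 1)
    (h' : n' ≤ m + 1) (y : ℝ) :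
    hahnPoly D q G r₁ r₂ p n y - hahnPoly D q G r₁ r₂ p n' y
      = ∑ k ∈ Finset.range (m + 1), (hahnCoef q G r₁ r₂ p n (k + 1)
          - hahnCoef q G r₁ r₂ p n' (k + 1)) * hahnBasis D q (k + 1) y := by
  rw [hahnPoly_eq_sum hq D G r₁ r₂ p h, hahnPoly_eq_sum hq D G r₁ r₂ p h',
    Finset.sum_range_succ', Finset.sum_range_succ' _ (m + 1), hahnCoef_zero, hahnCoef_zero,
    add_sub_add_right_eq_sub, ← Finset.sum_sub_distrib]
  exact Finset.sum_congr rfl fun i _ => by ring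

/-- Admissible parameters of a `q`-Hahn family on `M + 1` points. -/
structure HahnParam (D q G r₁ r₂ p : ℝ) (M : ℕ) : Prop where
  q_ne : q ≠ 0
  q_pow : ∀ i, q ^ (i + 1) ≠ 1
  p_ne : p ≠ 0
  G_ne : G ≠ 0
  rel : D * p * q = G * r₁ * r₂
  r₁_pow : r₁ * q ^ M = 1
  r₂_pow : ∀ i < M, 1 - r₂ * q ^ i ≠ 0
  p_pow : ∀ i < 2 * M, 1 - p * q ^ i ≠ 0

variable {D q G r₁ r₂ p : ℝ} {M : ℕ}

theorem HahnParam.r₁_ne (h : HahnParam D q G r₁ r₂ p M) : ∀ i < M, 1 - r₁ * q ^ i ≠ 0 := by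
  intro i hi h0
  apply h.q_pow (M - i - 1)
  have h1 := h.r₁_pow
  rw [show M = i + (M - i - 1 + 1) by omega, pow_add, ← mul_assoc, ← sub_eq_zero.mp h0,
    one_mul] at h1
  exact h1

theorem HahnParam.recurrence (h : HahnParam D q G r₁ r₂ p M) {n : ℕ} (hn : n < M) (y : ℝ) :
    (y - D) * hahnPoly D q G r₁ r₂ p n y
      = hahnA q G r₁ r₂ p n
          * (hahnPoly D q G r₁ r₂ p (n + 1) y - hahnPoly D q G r₁ r₂ p n y)
        + hahnC q G r₁ r₂ p n
          * (hahnPoly D q G r₁ r₂ p (n - 1) y - hahnPoly D q G r₁ r₂ p n y) := by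
  rw [sub_mul_hahnPoly h.q_ne, hahnPoly_sub h.q_ne D G r₁ r₂ p (m := n) le_rfl (by omega),
    hahnPoly_sub h.q_ne D G r₁ r₂ p (m := n) (by omega) (by omega), Finset.mul_sum, Finset.mul_sum,
    ← Finset.sum_add_distrib]
  refine Finset.sum_congr rfl fun k hk => ?_
  rw [hahnPoly_rec_coef h.q_ne h.q_pow h.p_ne h.G_ne h.rel h.r₁_ne h.r₂_pow h.p_pow hn
    (Nat.lt_succ_iff.mp (Finset.mem_range.mp hk))]
  ring

/-- At `n = M` there is no raising term to absorb the top degree, so the product `hahnBasis D q (M +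
1)` over all lattice points remains. -/
theorem HahnParam.recurrence_last (h : HahnParam D q G r₁ r₂ p M) (y : ℝ) :
    (y - D) * hahnPoly D q G r₁ r₂ p M y
      = hahnCLast q G r₁ r₂ p M
          * (hahnPoly D q G r₁ r₂ p (M - 1) y - hahnPoly D q G r₁ r₂ p M y)
        + hahnCoef q G r₁ r₂ p M M * hahnBasis D q (M + 1) y := by
  rw [sub_mul_hahnPoly h.q_ne, hahnPoly_sub h.q_ne D G r₁ r₂ p (m := M) (by omega) (by omega),
    Finset.sum_range_succ, Finset.sum_range_succ _ M,
    hahnCoef_eq_zero h.q_ne G r₁ r₂ p (Nat.lt_succ_self M),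
    hahnCoef_eq_zero h.q_ne G r₁ r₂ p (show M - 1 < M + 1 by omega)]
  simp only [mul_zero, add_zero, sub_zero, zero_mul]
  congr 1
  rw [Finset.mul_sum]
  refine Finset.sum_congr rfl fun k hk => ?_
  rw [hahnPoly_rec_coef_last h.q_ne h.q_pow h.p_ne h.G_ne h.rel h.r₁_ne h.r₂_pow h.p_pow h.r₁_pow
    (Finset.mem_range.mp hk)]
  ring

/-- The top coefficient of the recurrence says that passing from `n` to `n + 1` divides the leading
coefficient by `A_n`. Hence the product of the `A_i` is the factor that makes `hahnPoly` monic. -/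
theorem HahnParam.prod_A_mul_coef (h : HahnParam D q G r₁ r₂ p M) {n : ℕ} (hn : n ≤ M) :
    (∏ i ∈ Finset.range n, hahnA q G r₁ r₂ p i) * hahnCoef q G r₁ r₂ p n n = 1 := by
  induction n with
  | zero => simp [hahnCoef_zero]
  | succ n ih =>
    have := hahnPoly_rec_coef h.q_ne h.q_pow h.p_ne h.G_ne h.rel h.r₁_ne h.r₂_pow h.p_pow
      (show n < M by omega) le_rfl
    rw [hahnCoef_eq_zero h.q_ne G r₁ r₂ p (Nat.lt_succ_self n),
      hahnCoef_eq_zero h.q_ne G r₁ r₂ p (show n - 1 < n + 1 by omega)] at this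
    rw [Finset.prod_range_succ, ← ih (by omega)]
    linear_combination (-∏ i ∈ Finset.range n, hahnA q G r₁ r₂ p i) * this

theorem hahnC_zero (q G r₁ r₂ p : ℝ) : hahnC q G r₁ r₂ p 0 = 0 := by simp [hahnC]

theorem hahnCLast_zero (q G r₁ r₂ p : ℝ) : hahnCLast q G r₁ r₂ p 0 = 0 := by simp [hahnCLast]

/-- Monic form of the `q`-Hahn polynomials. -/
theorem HahnParam.eval_monicOP (h : HahnParam D q G r₁ r₂ p M) (b u : ℕ → ℝ)
    (hb : ∀ n < M, b n = D - hahnA q G r₁ r₂ p n - hahnC q G r₁ r₂ p n)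
    (hu : ∀ n, n + 1 < M → u (n + 1) = hahnA q G r₁ r₂ p n * hahnC q G r₁ r₂ p (n + 1))
    (y : ℝ) : ∀ n ≤ M, (monicOP b u n).eval y
      = (∏ i ∈ Finset.range n, hahnA q G r₁ r₂ p i) * hahnPoly D q G r₁ r₂ p n y := by
  intro n
  induction n using Nat.strong_induction_on with
  | _ n ih =>
    intro hn
    match n, ih, hn with
    | 0, _, _ => simp [eval_monicOP_zero, hahnPoly, hahnCoef_zero, hahnBasis]
    | 1, _, hn =>
      have hr := h.recurrence (show 0 < M by omega) y
      have h0 : hahnPoly D q G r₁ r₂ p 0 y = 1 := by simp [hahnPoly, hahnCoef_zero, hahnBasis]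
      rw [hahnC_zero, h0] at hr
      rw [eval_monicOP_one, hb 0 (by omega), hahnC_zero, Finset.prod_range_one]
      linear_combination hr
    | n + 2, ih, hn =>
      have hr := h.recurrence (show n + 1 < M by omega) y
      rw [eval_monicOP_add_two, ih (n + 1) (by omega) (by omega), ih n (by omega) (by omega),
        hb (n + 1) (by omega), hu n (by omega), Finset.prod_range_succ _ (n + 1),
        Finset.prod_range_succ _ n]
      rw [Nat.add_sub_cancel] at hr
      linear_combination (∏ i ∈ Finset.range n, hahnA q G r₁ r₂ p i) * hahnA q G r₁ r₂ p n * hr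

/-- The last step of the recurrence produces the polynomial vanishing on the lattice. -/
theorem HahnParam.eval_monicOP_last (h : HahnParam D q G r₁ r₂ p M) (b u : ℕ → ℝ)
    (hb : ∀ n < M, b n = D - hahnA q G r₁ r₂ p n - hahnC q G r₁ r₂ p n)
    (hu : ∀ n, n + 1 < M → u (n + 1) = hahnA q G r₁ r₂ p n * hahnC q G r₁ r₂ p (n + 1))
    (y : ℝ) :
    (y - D + hahnCLast q G r₁ r₂ p M) * (monicOP b u M).eval y
        - hahnA q G r₁ r₂ p (M - 1) * hahnCLast q G r₁ r₂ p M * (monicOP b u (M - 1)).eval y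
      = hahnBasis D q (M + 1) y := by
  have e := h.eval_monicOP b u hb hu y
  have hr := h.recurrence_last y
  have hc := h.prod_A_mul_coef le_rfl
  rcases M with _ | M
  · simp [hahnCLast_zero, eval_monicOP_zero, hahnBasis]
  · rw [e _ le_rfl, e (M + 1 - 1) (by omega), Nat.add_sub_cancel]
    rw [Nat.add_sub_cancel] at hr
    rw [Finset.prod_range_succ] at hc ⊢
    linear_combination (∏ i ∈ Finset.range M, hahnA q G r₁ r₂ p i) * hahnA q G r₁ r₂ p M * hr
      + hahnBasis D q (M + 1 + 1) y * hc

/-- Summation of the terminating balanced series `₂φ₁(q⁻ⁿ, p qⁿ; pq; q, q)`, by its partial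
sums. -/
theorem sum_hahnSeries (q p : ℝ) (n : ℕ) (hq : q ≠ 0) (hq' : ∀ i, q ^ (i + 1) ≠ 1)
    (K : ℕ) (hP : ∀ i < K, 1 - p * q ^ (i + 1) ≠ 0) :
    ∑ k ∈ Finset.range (K + 1), (∏ i ∈ Finset.range k,
        ((1 - q ^ i / q ^ n) * (1 - p * q ^ (n + i)) * q
          / ((1 - q ^ (i + 1)) * (1 - p * q ^ (i + 1)))))
      = ∏ i ∈ Finset.range K, ((1 - q ^ (i + 1) / q ^ n) * (1 - p * q ^ (n + (i + 1)))
          / ((1 - q ^ (i + 1)) * (1 - p * q ^ (i + 1)))) := by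
  induction K with
  | zero => simp
  | succ K ih =>
    have e3 : ∀ i : ℕ, 1 - q ^ (i + 1) ≠ 0 := fun i => sub_ne_zero.mpr (hq' i).symm
    have hK : ∀ i ≤ K, 1 - p * q ^ (i + 1) ≠ 0 := fun i hi => hP i (by omega)
    rw [Finset.sum_range_succ, ih fun i hi => hP i (by omega)]
    have hprod : ∏ i ∈ Finset.range (K + 1), ((1 - q ^ i / q ^ n) * (1 - p * q ^ (n + i)) * q
          / ((1 - q ^ (i + 1)) * (1 - p * q ^ (i + 1))))
        = (∏ i ∈ Finset.range K, ((1 - q ^ (i + 1) / q ^ n) * (1 - p * q ^ (n + (i + 1)))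
          / ((1 - q ^ (i + 1)) * (1 - p * q ^ (i + 1)))))
          * ((1 - 1 / q ^ n) * (1 - p * q ^ n) * q ^ (K + 1)
            / ((1 - q ^ (K + 1)) * (1 - p * q ^ (K + 1)))) := by
      rw [Finset.prod_div_distrib, Finset.prod_mul_distrib, Finset.prod_const, Finset.card_range,
        Finset.prod_range_succ', pow_zero, add_zero, Finset.prod_range_succ, Finset.prod_div_distrib]
      field_simp
    rw [hprod, Finset.prod_range_succ]
    have e1 := e3 K
    have e2 := hK K le_rfl
    have e4 : q ^ n ≠ 0 := pow_ne_zero _ hq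
    rw [← mul_one_add, pow_add q n (K + 1)]
    congr 1
    field_simp
    ring

/-- A functional with the moments of the `q`-Hahn weight annihilates the `q`-Hahn polynomials. -/
theorem HahnParam.sum_mul_hahnPoly (h : HahnParam D q G r₁ r₂ p M) {ι : Type*} (s : Finset ι)
    (w y : ι → ℝ)
    (hm : ∀ k < M, (1 - p * q ^ (k + 1)) * ∑ i ∈ s, w i * hahnBasis D q (k + 1) (y i)
      = G * (1 - r₁ * q ^ k) * (1 - r₂ * q ^ k) * ∑ i ∈ s, w i * hahnBasis D q k (y i))
    {n : ℕ} (hn : 1 ≤ n) (hnM : n ≤ M) :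
    ∑ i ∈ s, w i * hahnPoly D q G r₁ r₂ p n (y i) = 0 := by
  have e3 : ∀ i : ℕ, 1 - q ^ (i + 1) ≠ 0 := fun i => sub_ne_zero.mpr (h.q_pow i).symm
  have hP : ∀ i < M, 1 - p * q ^ (i + 1) ≠ 0 := fun i hi => h.p_pow _ (by omega)
  set m : ℕ → ℝ := fun k => ∑ i ∈ s, w i * hahnBasis D q k (y i) with hmdef
  have hmk : ∀ k ≤ M, m k = m 0 * ∏ i ∈ Finset.range k,
      (G * (1 - r₁ * q ^ i) * (1 - r₂ * q ^ i) / (1 - p * q ^ (i + 1))) := by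
    intro k
    induction k with
    | zero => simp
    | succ k ih =>
      intro hk
      have := hm k hk
      rw [Finset.prod_range_succ, ← mul_assoc, ← ih (by omega), mul_div_assoc',
        eq_div_iff (hP k hk), mul_comm, this]
      ring
  -- The moments supply exactly the factors `(1 - r₁ q^i)(1 - r₂ q^i) G` in the denominator of
  -- `hahnCoef`, leaving the series summed in `sum_hahnSeries`.
  have hterm : ∀ k ≤ n, hahnCoef q G r₁ r₂ p n k * m k
      = m 0 * ∏ i ∈ Finset.range k, ((1 - q ^ i / q ^ n) * (1 - p * q ^ (n + i)) * q
          / ((1 - q ^ (i + 1)) * (1 - p * q ^ (i + 1)))) := by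
    intro k hk
    rw [hmk k (by omega), hahnCoef, mul_left_comm]
    congr 1
    rw [← Finset.prod_mul_distrib, ← Finset.prod_mul_distrib, ← Finset.prod_mul_distrib]
    refine Finset.prod_congr rfl fun i hi => ?_
    have hi' : i < M := by have := Finset.mem_range.mp hi; omega
    have a1 : 1 - q ^ i * r₁ ≠ 0 := by rw [mul_comm]; exact h.r₁_ne i hi'
    have a2 : 1 - q ^ i * r₂ ≠ 0 := by rw [mul_comm]; exact h.r₂_pow i hi'
    have a3 := e3 i
    have a4 := hP i hi'
    have a5 := h.G_ne
    field_simp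
  have hswap : ∑ i ∈ s, w i * hahnPoly D q G r₁ r₂ p n (y i)
      = ∑ k ∈ Finset.range (n + 1), hahnCoef q G r₁ r₂ p n k * m k := by
    simp only [hahnPoly, hmdef, Finset.mul_sum]
    rw [Finset.sum_comm]
    exact Finset.sum_congr rfl fun k _ => Finset.sum_congr rfl fun i _ => by ring
  -- The closed form of the series contains the factor `1 - q ^ n / q ^ n`, at index `n - 1`.
  rw [hswap, Finset.sum_congr rfl fun k hk => hterm k (Nat.lt_succ_iff.mp (Finset.mem_range.mp hk)),
    ← Finset.mul_sum, sum_hahnSeries q p n h.q_ne h.q_pow n fun i hi => hP i (by omega),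
    Finset.prod_eq_zero (Finset.mem_range.mpr (show n - 1 < n by omega)), mul_zero]
  rw [show n - 1 + 1 = n by omega, div_self (pow_ne_zero _ h.q_ne), sub_self, zero_mul, zero_div]

end

section

/-! ### The `q`-Hahn weight -/

variable {D q G r₁ r₂ p : ℝ} {M : ℕ}

/-- Both sides are `hahnBasis D q (k + 1)` at `D q^(s+1)`, with the last factor split off on the
left and the first one on the right. -/
theorem hahnBasis_shift (D q : ℝ) (k s : ℕ) :
    hahnBasis D q k (D * q ^ (s + 1)) * (D * q ^ (s + 1) - D * q ^ k)
      = D * (q ^ (s + 1) - 1) * q ^ k * hahnBasis D q k (D * q ^ s) := by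
  have h : hahnBasis D q (k + 1) (D * q ^ (s + 1))
      = D * (q ^ (s + 1) - 1) * (q ^ k * hahnBasis D q k (D * q ^ s)) := by
    rw [hahnBasis, Finset.prod_range_succ', hahnBasis, mul_comm]
    congr 1
    · ring
    · rw [← Finset.card_range k, ← Finset.prod_const, Finset.card_range,
        ← Finset.prod_mul_distrib]
      exact Finset.prod_congr rfl fun i _ => by ring
  rw [mul_assoc (D * (q ^ (s + 1) - 1)), ← h, hahnBasis, hahnBasis, Finset.prod_range_succ]

theorem hahnBasis_eq_zero (D q : ℝ) {k s : ℕ} (h : s < k) : hahnBasis D q k (D * q ^ s) = 0 :=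
  Finset.prod_eq_zero (Finset.mem_range.mpr h) (sub_self _)

/-- Summation by parts. The first-order difference equation `hW` for the weight is a discrete
Pearson equation; paired with a basis element it telescopes, and the relations on `p Y` and `G Y`
turn the telescoped summand into the two-term moment recursion. -/
theorem hahn_moment {W : ℕ → ℝ} {Y : ℝ} (hq : q ≠ 0) (hD : D ≠ 0) (hY : Y ≠ 0)
    (hr : r₁ * q ^ M = 1) (hp : p * Y = r₁ * r₂) (hG : G * Y = q * D)
    (hW : ∀ s < M, W (s + 1) * ((1 - q ^ (s + 1)) * (1 - Y * q ^ s))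
      = q * (1 - r₁ * q ^ s) * (1 - r₂ * q ^ s) * W s) (k : ℕ) :
    (1 - p * q ^ (k + 1)) * ∑ s ∈ Finset.range (M + 1), W s * hahnBasis D q (k + 1) (D * q ^ s)
      = G * (1 - r₁ * q ^ k) * (1 - r₂ * q ^ k)
        * ∑ s ∈ Finset.range (M + 1), W s * hahnBasis D q k (D * q ^ s) := by
  set e : ℕ → ℝ := fun s => hahnBasis D q k (D * q ^ s) with he
  -- The term at `s` below equals `F (s + 1) - F s` for `s < M`. The upper boundary vanishes because
  -- `r₁ q^M = 1`; the lower one because `F 0 = 0`, through `q^k - q^0` if `k = 0` and through the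
  -- basis element otherwise.
  set F : ℕ → ℝ := fun s =>
    W s * q / (q ^ s * q ^ k) * (q ^ k - q ^ s) * (1 - Y * q ^ s / q) * e s with hF
  have hsplit : ∑ s ∈ Finset.range (M + 1),
      (q / q ^ s * (1 - r₁ * q ^ s) * (1 - r₂ * q ^ s) * W s * e s - F s) = 0 := by
    have h1 : ∑ s ∈ Finset.range (M + 1),
        q / q ^ s * (1 - r₁ * q ^ s) * (1 - r₂ * q ^ s) * W s * e s
        = ∑ s ∈ Finset.range M, F (s + 1) := by
      rw [Finset.sum_range_succ, hr]
      simp only [sub_self, mul_zero, zero_mul, add_zero]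
      refine Finset.sum_congr rfl fun s hs => ?_
      have h2 := hW s (Finset.mem_range.mp hs)
      have h3 := hahnBasis_shift D q k s
      have h4 : e (s + 1) * (q ^ k - q ^ (s + 1)) = (1 - q ^ (s + 1)) * q ^ k * e s := by
        apply mul_left_cancel₀ hD
        linear_combination -h3
      have h5 : F (s + 1) = W (s + 1) * (1 - Y * q ^ s) / (q ^ s * q ^ k)
          * (e (s + 1) * (q ^ k - q ^ (s + 1))) := by
        simp only [hF, pow_succ]
        field_simp
      rw [h5, h4]
      field_simp
      linear_combination (-e s) * h2
    have h0 : F 0 = 0 := by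
      rcases k with _ | k
      · simp [hF]
      · simp only [hF, he]
        rw [hahnBasis_eq_zero D q (Nat.succ_pos k), mul_zero]
    rw [Finset.sum_sub_distrib, h1, Finset.sum_range_succ' F, h0]
    ring
  have hterm : ∀ s, (1 - p * q ^ (k + 1)) * (W s * hahnBasis D q (k + 1) (D * q ^ s))
      - G * (1 - r₁ * q ^ k) * (1 - r₂ * q ^ k) * (W s * e s)
      = -(D * q ^ k / Y) * (q / q ^ s * (1 - r₁ * q ^ s) * (1 - r₂ * q ^ s) * W s * e s - F s) := by
    intro s
    have h1 : hahnBasis D q (k + 1) (D * q ^ s) = e s * (D * q ^ s - D * q ^ k) := by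
      simp only [hahnBasis, Finset.prod_range_succ, he]
    obtain rfl : p = r₁ * r₂ / Y := by rw [eq_div_iff hY, hp]
    obtain rfl : G = q * D / Y := by rw [eq_div_iff hY, hG]
    rw [h1, hF]
    simp only
    field_simp
    ring
  rw [← sub_eq_zero, Finset.mul_sum, Finset.mul_sum, ← Finset.sum_sub_distrib,
    Finset.sum_congr rfl fun s _ => hterm s, ← Finset.mul_sum, hsplit, mul_zero]

theorem prod_pow_sub_pow (q : ℝ) (M : ℕ) :
    ∏ i ∈ Finset.range M, (q ^ M - q ^ i) = ∏ i ∈ Finset.range M, (-q ^ i * (1 - q ^ (i + 1))) := by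
  rw [Finset.prod_mul_distrib, ← Finset.prod_range_reflect (fun i => 1 - q ^ (i + 1)),
    ← Finset.prod_mul_distrib]
  refine Finset.prod_congr rfl fun i hi => ?_
  have hi' := Finset.mem_range.mp hi
  rw [show M - 1 - i + 1 = M - i by omega]
  have : q ^ i * q ^ (M - i) = q ^ M := by rw [← pow_add]; congr 1; omega
  linear_combination -this

/-- Total mass of the `q`-Hahn weight. -/
theorem HahnParam.total_mass (h : HahnParam D q G r₁ r₂ p M) {W : ℕ → ℝ} {Y : ℝ} (hD : D ≠ 0)
    (hY : Y ≠ 0) (hp : p * Y = r₁ * r₂) (hG : G * Y = q * D)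
    (hW : ∀ s < M, W (s + 1) * ((1 - q ^ (s + 1)) * (1 - Y * q ^ s))
      = q * (1 - r₁ * q ^ s) * (1 - r₂ * q ^ s) * W s) :
    (∑ s ∈ Finset.range (M + 1), W s) * ∏ i ∈ Finset.range M, (1 - Y * q ^ i)
      = W 0 * ∏ i ∈ Finset.range M, (-Y * q ^ i * (1 - p * q ^ (i + 1))) := by
  have hmom := hahn_moment h.q_ne hD hY h.r₁_pow hp hG hW
  set m : ℕ → ℝ := fun k => ∑ s ∈ Finset.range (M + 1), W s * hahnBasis D q k (D * q ^ s) with hm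
  have e3 : ∀ i : ℕ, 1 - q ^ (i + 1) ≠ 0 := fun i => sub_ne_zero.mpr (h.q_pow i).symm
  -- The moment of order `M` is computed twice. The moment recursion links it to the total mass. It
  -- also has a single term, since `hahnBasis D q M` vanishes at all lattice points but the last
  -- (`c3`), and that term is linked to `W 0` by the weight recursion (`c2`).
  have c1 : ∀ k, m k * ∏ i ∈ Finset.range k, (1 - p * q ^ (i + 1))
      = m 0 * ∏ i ∈ Finset.range k, (G * ((1 - r₁ * q ^ i) * (1 - r₂ * q ^ i))) := by
    intro k
    induction k with
    | zero => simp
    | succ k ih =>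
      rw [Finset.prod_range_succ, Finset.prod_range_succ, ← mul_assoc (m 0), ← ih]
      linear_combination (∏ i ∈ Finset.range k, (1 - p * q ^ (i + 1))) * hmom k
  have c2 : ∀ s ≤ M, W s * ((∏ i ∈ Finset.range s, (1 - q ^ (i + 1)))
        * ∏ i ∈ Finset.range s, (1 - Y * q ^ i))
      = W 0 * ∏ i ∈ Finset.range s, (q * ((1 - r₁ * q ^ i) * (1 - r₂ * q ^ i))) := by
    intro s
    induction s with
    | zero => simp
    | succ s ih =>
      intro hs
      rw [Finset.prod_range_succ, Finset.prod_range_succ, Finset.prod_range_succ,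
        ← mul_assoc (W 0), ← ih (by omega)]
      linear_combination ((∏ i ∈ Finset.range s, (1 - q ^ (i + 1)))
        * ∏ i ∈ Finset.range s, (1 - Y * q ^ i)) * hW s hs
  have c3 : m M = W M * (D ^ M * ∏ i ∈ Finset.range M, (q ^ M - q ^ i)) := by
    have : hahnBasis D q M (D * q ^ M) = D ^ M * ∏ i ∈ Finset.range M, (q ^ M - q ^ i) := by
      rw [hahnBasis, Finset.prod_congr rfl fun i _ => (mul_sub D (q ^ M) (q ^ i)).symm,
        Finset.prod_mul_distrib, Finset.prod_const, Finset.card_range]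
    rw [hm]
    simp only
    rw [Finset.sum_range_succ, this, Finset.sum_eq_zero, zero_add]
    intro s hs
    rw [hahnBasis_eq_zero D q (Finset.mem_range.mp hs), mul_zero]
  have c4 : m 0 = ∑ s ∈ Finset.range (M + 1), W s := by simp [hm, hahnBasis]
  have hR : ∏ i ∈ Finset.range M, ((1 - r₁ * q ^ i) * (1 - r₂ * q ^ i)) ≠ 0 :=
    Finset.prod_ne_zero_iff.mpr fun i hi => mul_ne_zero (h.r₁_ne i (Finset.mem_range.mp hi))
      (h.r₂_pow i (Finset.mem_range.mp hi))
  have hQ : ∏ i ∈ Finset.range M, (1 - q ^ (i + 1)) ≠ 0 :=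
    Finset.prod_ne_zero_iff.mpr fun i _ => e3 i
  have d1 := c1 M
  have d2 := c2 M le_rfl
  rw [c3, prod_pow_sub_pow, Finset.prod_mul_distrib, Finset.prod_mul_distrib, Finset.prod_const,
    Finset.card_range, c4] at d1
  rw [Finset.prod_mul_distrib, Finset.prod_const, Finset.card_range] at d2
  have hGY : G ^ M * Y ^ M = q ^ M * D ^ M := by rw [← mul_pow, hG, mul_pow]
  have hYprod : ∏ i ∈ Finset.range M, (-Y * q ^ i * (1 - p * q ^ (i + 1)))
      = Y ^ M * (∏ i ∈ Finset.range M, (-q ^ i))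
        * ∏ i ∈ Finset.range M, (1 - p * q ^ (i + 1)) := by
    rw [Finset.prod_mul_distrib]
    congr 1
    rw [← Finset.card_range M, ← Finset.prod_const, Finset.card_range, ← Finset.prod_mul_distrib]
    exact Finset.prod_congr rfl fun i _ => by ring
  rw [hYprod]
  have hqM : q ^ M * D ^ M ≠ 0 := mul_ne_zero (pow_ne_zero _ h.q_ne) (pow_ne_zero _ hD)
  generalize (∏ i ∈ Finset.range M, ((1 - r₁ * q ^ i) * (1 - r₂ * q ^ i))) = R at *
  generalize (∏ i ∈ Finset.range M, (1 - q ^ (i + 1))) = Q at *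
  generalize (∏ i ∈ Finset.range M, (1 - p * q ^ (i + 1))) = P at *
  generalize (∏ i ∈ Finset.range M, (-q ^ i)) = N at *
  generalize (∏ i ∈ Finset.range M, (1 - Y * q ^ i)) = Z at *
  apply mul_left_cancel₀ (mul_ne_zero hqM (mul_ne_zero hR hQ))
  rw [← c4] at *
  linear_combination (-(Y ^ M * Z * Q)) * d1 + (Y ^ M * D ^ M * N * Q * P) * d2
    - m 0 * R * Z * Q * hGY

end

/-! ### Symmetry of the `q`-para-Krawtchouk coefficients -/

theorem pow_ne_pow {q : ℝ} (hq₀ : 0 < q) (hq₁ : q < 1) {m n : ℕ} (h : m ≠ n) : q ^ m - q ^ n ≠ 0 :=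
  sub_ne_zero.mpr fun e => h (pow_right_injective₀ hq₀ hq₁.ne e)

/-- The symmetry `n ↦ N - n`. The middle pair `b_j`, `b_{j+1}` is excluded, since there the symmetry
exchanges `α` and `1 - α`. -/
theorem krawBOdd_reflect {q : ℝ} (hq₀ : 0 < q) (Δ α : ℝ) {j i : ℕ} (hi : 1 ≤ i)
    (hij : i ≤ j) : krawBOdd j q Δ α (j + 1 + i) = krawBOdd j q Δ α (j - i) := by
  obtain ⟨m, rfl⟩ : ∃ m, j = m + i := ⟨j - i, by omega⟩
  simp only [krawBOdd]
  rw [if_neg (by omega), if_neg (by omega), if_neg (by omega), if_neg (by omega),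
    Nat.add_sub_cancel]
  have hx : 0 < q ^ m := pow_pos hq₀ m
  have hy : 0 < q ^ i := pow_pos hq₀ i
  simp only [pow_add, pow_one]
  generalize q ^ m = x at *
  generalize q ^ i = y at *
  rw [div_eq_div_iff (by positivity) (by positivity)]
  ring

theorem krawUOdd_reflect {q : ℝ} (hq₀ : 0 < q) (hq₁ : q < 1) (Δ α : ℝ) {j i : ℕ} (hi : 1 ≤ i)
    (hij : i ≤ j) : krawUOdd j q Δ α (j + 1 + i) = krawUOdd j q Δ α (j + 1 - i) := by
  obtain ⟨m, rfl⟩ : ∃ m, j = m + i := ⟨j - i, by omega⟩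
  simp only [krawUOdd]
  rw [if_neg (by omega), if_neg (by omega), show m + i + 1 - i = m + 1 by omega]
  have h1 := pow_ne_pow hq₀ hq₁ (show 2 * (m + i) + 1 ≠ 2 * (m + i + 1 + i) by omega)
  have h2 := pow_ne_pow hq₀ hq₁ (show 2 * (m + i) + 3 ≠ 2 * (m + i + 1 + i) by omega)
  have h3 := pow_ne_pow hq₀ hq₁ (show 2 * (m + i) + 1 ≠ 2 * (m + 1) by omega)
  have h4 := pow_ne_pow hq₀ hq₁ (show 2 * (m + i) + 3 ≠ 2 * (m + 1) by omega)
  have h5 : (q ^ (m + i + 1) + q ^ (m + i + 1 + i)) ≠ 0 := by positivity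
  have h6 : (q ^ (m + i + 1) + q ^ (m + 1)) ≠ 0 := by positivity
  rw [div_eq_div_iff (mul_ne_zero (mul_ne_zero (pow_ne_zero 2 h5) h1) h2)
    (mul_ne_zero (mul_ne_zero (pow_ne_zero 2 h6) h3) h4)]
  ring

theorem krawBEven_reflect {q : ℝ} (hq₀ : 0 < q) (hq₁ : q < 1) (Δ : ℝ) {j i : ℕ}
    (hij : i ≤ j) : krawBEven j q Δ (j + i) = krawBEven j q Δ (j - i) := by
  obtain ⟨m, rfl⟩ : ∃ m, j = m + i := ⟨j - i, by omega⟩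
  simp only [krawBEven]
  rw [Nat.add_sub_cancel]
  have h1 := pow_ne_pow hq₀ hq₁ (show 2 * (m + i) + 1 ≠ 2 * (m + i + i) by omega)
  have h2 := pow_ne_pow hq₀ hq₁ (show 2 * (m + i) ≠ 2 * (m + i + i) + 1 by omega)
  have h3 := pow_ne_pow hq₀ hq₁ (show 2 * (m + i) + 1 ≠ 2 * m by omega)
  have h4 := pow_ne_pow hq₀ hq₁ (show 2 * (m + i) ≠ 2 * m + 1 by omega)
  have h5 : (q ^ (m + i) + q ^ (m + i + i)) ≠ 0 := by positivity
  have h6 : (q ^ (m + i) + q ^ m) ≠ 0 := by positivity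
  have e1 : q ^ (2 * (m + i)) * (q ^ (m + i + i) - 1) * (q ^ (m + i + i) - Δ * q ^ (m + i + 1))
      / ((q ^ (m + i) + q ^ (m + i + i)) * (q ^ (2 * (m + i) + 1) - q ^ (2 * (m + i + i))))
      = - (q ^ m * (q ^ (2 * (m + i)) - q ^ m) * (q ^ (m + i) - Δ * q ^ (m + 1))
      / ((q ^ (m + i) + q ^ m) * (q ^ (2 * (m + i)) - q ^ (2 * m + 1)))) := by
    rw [← neg_div, div_eq_div_iff (mul_ne_zero h5 h1) (mul_ne_zero h6 h4)]
    ring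
  have e2 : q ^ (2 * (m + i)) * (q ^ m - 1) * (q ^ m - Δ * q ^ (m + i + 1))
      / ((q ^ (m + i) + q ^ m) * (q ^ (2 * (m + i) + 1) - q ^ (2 * m)))
      = - (q ^ (m + i + i) * (q ^ (2 * (m + i)) - q ^ (m + i + i))
        * (q ^ (m + i) - Δ * q ^ (m + i + i + 1))
      / ((q ^ (m + i) + q ^ (m + i + i)) * (q ^ (2 * (m + i)) - q ^ (2 * (m + i + i) + 1)))) := by
    rw [← neg_div, div_eq_div_iff (mul_ne_zero h6 h3) (mul_ne_zero h5 h2)]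
    ring
  rw [e1, e2]
  ring

/-- For `N = 2j` all `b_n` are symmetric, and `α` enters only through the middle pair `u_j`,
`u_{j+1}`, which is excluded here. -/
theorem krawUEven_reflect {q : ℝ} (hq₀ : 0 < q) (hq₁ : q < 1) (Δ α : ℝ) {j i : ℕ} (hi : 1 ≤ i)
    (hij : i < j) : krawUEven j q Δ α (j + 1 + i) = krawUEven j q Δ α (j - i) := by
  obtain ⟨m, rfl⟩ : ∃ m, j = m + i := ⟨j - i, by omega⟩
  simp only [krawUEven]
  rw [if_neg (by omega), if_neg (by omega), if_neg (by omega), if_neg (by omega),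
    Nat.add_sub_cancel]
  have h1 := pow_ne_pow hq₀ hq₁ (show 2 * (m + i) + 1 ≠ 2 * (m + i + 1 + i) by omega)
  have h3 := pow_ne_pow hq₀ hq₁ (show 2 * (m + i) + 1 ≠ 2 * m by omega)
  have h5 : (q ^ (m + i) + q ^ (m + i + 1 + i)) * (q ^ (m + i + 1) + q ^ (m + i + 1 + i)) ≠ 0 := by
    positivity
  have h6 : (q ^ (m + i) + q ^ m) * (q ^ (m + i + 1) + q ^ m) ≠ 0 := by positivity
  rw [div_eq_div_iff (mul_ne_zero h5 (pow_ne_zero 2 h1)) (mul_ne_zero h6 (pow_ne_zero 2 h3))]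
  ring

/-! ### The `q`-para-Krawtchouk coefficients as `q`-Hahn coefficients -/

theorem sq_pow_sub {q : ℝ} (hq₀ : 0 < q) (hq₁ : q < 1) {j n k l : ℕ} (h : 2 * j + k ≠ 2 * n + l) :
    (q ^ j) ^ 2 * q ^ k - (q ^ n) ^ 2 * q ^ l ≠ 0 := by
  rw [← pow_mul, ← pow_mul, ← pow_add, ← pow_add]
  exact pow_ne_pow hq₀ hq₁ (by omega)

/-- The `q`-Hahn family on the points `Δ q^s`. Its parameters are the truncated Askey-Wilson ones:
`r₁ = ab = q^{-j}`, `r₂ = ad = Δ q^{-j}`, `p = abcd/q`. -/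
theorem krawBOdd_eq_left {q : ℝ} (hq₀ : 0 < q) (hq₁ : q < 1) {Δ : ℝ} (α : ℝ) {j n : ℕ}
    (h : n ≠ j) (h' : n ≠ j + 1) :
    krawBOdd j q Δ α n = Δ - hahnA q 1 (1 / q ^ j) (Δ / q ^ j) (1 / ((q ^ j) ^ 2 * q)) n
      - hahnC q 1 (1 / q ^ j) (Δ / q ^ j) (1 / ((q ^ j) ^ 2 * q)) n := by
  have h1 := sq_pow_sub hq₀ hq₁ (show 2 * j + 0 ≠ 2 * n + 0 by omega)
  have h2 := sq_pow_sub hq₀ hq₁ (show 2 * j + 1 ≠ 2 * n + 0 by omega)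
  have h3 := sq_pow_sub hq₀ hq₁ (show 2 * j + 2 ≠ 2 * n + 0 by omega)
  simp only [krawBOdd, hahnA, hahnC]
  rw [if_neg h, if_neg h']
  have hw : 0 < q ^ j := pow_pos hq₀ j
  have hx : 0 < q ^ n := pow_pos hq₀ n
  simp only [pow_add, pow_mul', pow_one, pow_zero, mul_one] at *
  generalize q ^ j = w at *
  generalize q ^ n = x at *
  have e1 : 1 - 1 / (w ^ 2 * q) * x ^ 2 = (w ^ 2 * q - x ^ 2) / (w ^ 2 * q) := by field_simp
  have e2 : 1 - 1 / (w ^ 2 * q) * (x ^ 2 * q) = (w ^ 2 - x ^ 2) / w ^ 2 := by field_simp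
  have e3 : q - 1 / (w ^ 2 * q) * x ^ 2 = (w ^ 2 * q ^ 2 - x ^ 2) / (w ^ 2 * q) := by field_simp
  have e4 : (w + x) * (w * q + x) ≠ 0 := by positivity
  rw [e1, e2, e3]
  field_simp
  ring

theorem krawUOdd_eq_left {q : ℝ} (hq₀ : 0 < q) (hq₁ : q < 1) {Δ : ℝ} (α : ℝ) {j n : ℕ}
    (h : n ≠ j) :
    krawUOdd j q Δ α (n + 1) = hahnA q 1 (1 / q ^ j) (Δ / q ^ j) (1 / ((q ^ j) ^ 2 * q)) n
      * hahnC q 1 (1 / q ^ j) (Δ / q ^ j) (1 / ((q ^ j) ^ 2 * q)) (n + 1) := by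
  have h1 := sq_pow_sub hq₀ hq₁ (show 2 * j + 0 ≠ 2 * n + 0 by omega)
  have h2 := sq_pow_sub hq₀ hq₁ (show 2 * j + 1 ≠ 2 * n + 0 by omega)
  have h3 := sq_pow_sub hq₀ hq₁ (show 2 * j + 1 ≠ 2 * n + 2 by omega)
  simp only [krawUOdd, hahnA, hahnC]
  rw [if_neg (by omega)]
  have hw : 0 < q ^ j := pow_pos hq₀ j
  have hx : 0 < q ^ n := pow_pos hq₀ n
  simp only [pow_add, pow_mul', pow_one, pow_zero, mul_one, mul_pow] at *
  generalize q ^ j = w at *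
  generalize q ^ n = x at *
  have e1 : 1 - 1 / (w ^ 2 * q) * x ^ 2 = (w ^ 2 * q - x ^ 2) / (w ^ 2 * q) := by field_simp
  have e2 : 1 - 1 / (w ^ 2 * q) * (x ^ 2 * q) = (w ^ 2 - x ^ 2) / w ^ 2 := by field_simp
  have e3 : q - 1 / (w ^ 2 * q) * (x ^ 2 * q ^ 2) = (w ^ 2 - x ^ 2) * q / w ^ 2 := by field_simp
  have e4 : 1 - 1 / (w ^ 2 * q) * (x ^ 2 * q ^ 2) = (w ^ 2 * q - x ^ 2 * q ^ 2) / (w ^ 2 * q) := by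
    field_simp
  have e5 : w + x ≠ 0 := by positivity
  have e6 : w * q + x * q = (w + x) * q := by ring
  have e7 : w ^ 2 * q ^ 3 - x ^ 2 * q ^ 2 = q ^ 2 * (w ^ 2 * q - x ^ 2) := by ring
  rw [e1, e2, e3, e4, e6, e7]
  field_simp
  ring

/-- The same coefficients seen from the points `q^s`: the left parameters with `Δ` replaced by
`1/Δ`, rescaled by `Δ`. -/
theorem krawBOdd_eq_right {q : ℝ} (hq₀ : 0 < q) (hq₁ : q < 1) {Δ : ℝ} (hΔ : 0 < Δ) (α : ℝ) {j n : ℕ}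
    (h : n ≠ j) (h' : n ≠ j + 1) :
    krawBOdd j q Δ α n = 1 - hahnA q Δ (1 / q ^ j) (1 / (Δ * q ^ j)) (1 / ((q ^ j) ^ 2 * q)) n
      - hahnC q Δ (1 / q ^ j) (1 / (Δ * q ^ j)) (1 / ((q ^ j) ^ 2 * q)) n := by
  have h1 := sq_pow_sub hq₀ hq₁ (show 2 * j + 0 ≠ 2 * n + 0 by omega)
  have h2 := sq_pow_sub hq₀ hq₁ (show 2 * j + 1 ≠ 2 * n + 0 by omega)
  have h3 := sq_pow_sub hq₀ hq₁ (show 2 * j + 2 ≠ 2 * n + 0 by omega)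
  simp only [krawBOdd, hahnA, hahnC]
  rw [if_neg h, if_neg h']
  have hw : 0 < q ^ j := pow_pos hq₀ j
  have hx : 0 < q ^ n := pow_pos hq₀ n
  simp only [pow_add, pow_mul', pow_one, pow_zero, mul_one] at *
  generalize q ^ j = w at *
  generalize q ^ n = x at *
  have e1 : 1 - 1 / (w ^ 2 * q) * x ^ 2 = (w ^ 2 * q - x ^ 2) / (w ^ 2 * q) := by field_simp
  have e2 : 1 - 1 / (w ^ 2 * q) * (x ^ 2 * q) = (w ^ 2 - x ^ 2) / w ^ 2 := by field_simp
  have e3 : q - 1 / (w ^ 2 * q) * x ^ 2 = (w ^ 2 * q ^ 2 - x ^ 2) / (w ^ 2 * q) := by field_simp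
  have e4 : (w + x) * (w * q + x) ≠ 0 := by positivity
  rw [e1, e2, e3]
  field_simp
  ring

theorem krawUOdd_eq_right {q : ℝ} (hq₀ : 0 < q) (hq₁ : q < 1) {Δ : ℝ} (hΔ : 0 < Δ) (α : ℝ) {j n : ℕ}
    (h : n ≠ j) :
    krawUOdd j q Δ α (n + 1) = hahnA q Δ (1 / q ^ j) (1 / (Δ * q ^ j)) (1 / ((q ^ j) ^ 2 * q)) n
      * hahnC q Δ (1 / q ^ j) (1 / (Δ * q ^ j)) (1 / ((q ^ j) ^ 2 * q)) (n + 1) := by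
  have h1 := sq_pow_sub hq₀ hq₁ (show 2 * j + 0 ≠ 2 * n + 0 by omega)
  have h2 := sq_pow_sub hq₀ hq₁ (show 2 * j + 1 ≠ 2 * n + 0 by omega)
  have h3 := sq_pow_sub hq₀ hq₁ (show 2 * j + 1 ≠ 2 * n + 2 by omega)
  simp only [krawUOdd, hahnA, hahnC]
  rw [if_neg (by omega)]
  have hw : 0 < q ^ j := pow_pos hq₀ j
  have hx : 0 < q ^ n := pow_pos hq₀ n
  simp only [pow_add, pow_mul', pow_one, pow_zero, mul_one, mul_pow] at *
  generalize q ^ j = w at *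
  generalize q ^ n = x at *
  have e1 : 1 - 1 / (w ^ 2 * q) * x ^ 2 = (w ^ 2 * q - x ^ 2) / (w ^ 2 * q) := by field_simp
  have e2 : 1 - 1 / (w ^ 2 * q) * (x ^ 2 * q) = (w ^ 2 - x ^ 2) / w ^ 2 := by field_simp
  have e3 : q - 1 / (w ^ 2 * q) * (x ^ 2 * q ^ 2) = (w ^ 2 - x ^ 2) * q / w ^ 2 := by field_simp
  have e4 : 1 - 1 / (w ^ 2 * q) * (x ^ 2 * q ^ 2) = (w ^ 2 * q - x ^ 2 * q ^ 2) / (w ^ 2 * q) := by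
    field_simp
  have e5 : w + x ≠ 0 := by positivity
  have e6 : w * q + x * q = (w + x) * q := by ring
  have e7 : w ^ 2 * q ^ 3 - x ^ 2 * q ^ 2 = q ^ 2 * (w ^ 2 * q - x ^ 2) := by ring
  rw [e1, e2, e3, e4, e6, e7]
  field_simp
  ring

/-- At `α = 0` the singular coefficient `b_j` closes the `q`-Hahn recurrence on the lattice `Δ q^s`;
at `α = 1` it closes the one on `q^s`. This is how the mixing parameter meets the two halves. -/
theorem krawBOdd_last_left {q : ℝ} (hq₀ : 0 < q) (hq₁ : q < 1) {Δ : ℝ} (j : ℕ) :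
    krawBOdd j q Δ 0 j = Δ - hahnCLast q 1 (1 / q ^ j) (Δ / q ^ j) (1 / ((q ^ j) ^ 2 * q)) j := by
  simp only [krawBOdd, hahnCLast, if_true]
  have hw : 0 < q ^ j := pow_pos hq₀ j
  have h1 : 1 - q ≠ 0 := by linarith
  have h2 : 1 - q ^ 2 ≠ 0 := by nlinarith
  simp only [pow_add, pow_mul', pow_one]
  generalize q ^ j = w at *
  have e3 : q - 1 / (w ^ 2 * q) * w ^ 2 = -(1 - q ^ 2) / q := by
    field_simp
    ring
  rw [e3]
  field_simp
  ring

theorem krawUOdd_last_left {q : ℝ} (hq₀ : 0 < q) (hq₁ : q < 1) {Δ : ℝ} (α : ℝ) {j : ℕ}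
    (hj : 1 ≤ j) :
    krawUOdd j q Δ α j = hahnA q 1 (1 / q ^ j) (Δ / q ^ j) (1 / ((q ^ j) ^ 2 * q)) (j - 1)
      * hahnCLast q 1 (1 / q ^ j) (Δ / q ^ j) (1 / ((q ^ j) ^ 2 * q)) j := by
  obtain ⟨n, rfl⟩ := Nat.exists_eq_add_of_le' hj
  simp only [krawUOdd, hahnA, hahnCLast, Nat.add_sub_cancel]
  rw [if_neg (by omega)]
  have hx : 0 < q ^ n := pow_pos hq₀ n
  have h1 : 1 - q ≠ 0 := by linarith
  have h2 : 1 + q ≠ 0 := by linarith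
  have h3 : 1 - q ^ 3 ≠ 0 := by
    have : q ^ 3 < 1 := pow_lt_one₀ hq₀.le hq₁ (by norm_num)
    linarith
  simp only [pow_add, pow_mul', pow_one, mul_pow]
  generalize q ^ n = x at *
  have e1 : 1 - 1 / (x ^ 2 * q ^ 2 * q) * x ^ 2 = -(1 - q ^ 3) / q ^ 3 := by
    field_simp
    ring
  have e2 : 1 - 1 / (x ^ 2 * q ^ 2 * q) * (x ^ 2 * q) = -((1 - q) * (1 + q)) / q ^ 2 := by
    field_simp
    ring
  have e3 : q - 1 / (x ^ 2 * q ^ 2 * q) * (x ^ 2 * q ^ 2) = -((1 - q) * (1 + q)) / q := by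
    field_simp
    ring
  have e4 : (x * q * q + x * q) ^ 2 * (x ^ 2 * q ^ 2 * q - x ^ 2 * q ^ 2)
      * (x ^ 2 * q ^ 2 * q ^ 3 - x ^ 2 * q ^ 2)
      = (x * q) ^ 6 * (1 + q) ^ 2 * (1 - q) * (1 - q ^ 3) := by ring
  rw [e1, e2, e3, ← mul_assoc, e4]
  field_simp
  ring

theorem krawBOdd_last_right {q : ℝ} (hq₀ : 0 < q) (hq₁ : q < 1) {Δ : ℝ} (hΔ : 0 < Δ) (j : ℕ) :
    krawBOdd j q Δ 1 j = 1 - hahnCLast q Δ (1 / q ^ j) (1 / (Δ * q ^ j)) (1 / ((q ^ j) ^ 2 * q)) j := by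
  simp only [krawBOdd, hahnCLast, if_true]
  have hw : 0 < q ^ j := pow_pos hq₀ j
  have h1 : 1 - q ≠ 0 := by linarith
  have h2 : 1 - q ^ 2 ≠ 0 := by nlinarith
  simp only [pow_add, pow_mul', pow_one]
  generalize q ^ j = w at *
  have e3 : q - 1 / (w ^ 2 * q) * w ^ 2 = -(1 - q ^ 2) / q := by
    field_simp
    ring
  rw [e3]
  field_simp
  ring

theorem krawUOdd_last_right {q : ℝ} (hq₀ : 0 < q) (hq₁ : q < 1) {Δ : ℝ} (hΔ : 0 < Δ) (α : ℝ) {j : ℕ}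
    (hj : 1 ≤ j) :
    krawUOdd j q Δ α j = hahnA q Δ (1 / q ^ j) (1 / (Δ * q ^ j)) (1 / ((q ^ j) ^ 2 * q)) (j - 1)
      * hahnCLast q Δ (1 / q ^ j) (1 / (Δ * q ^ j)) (1 / ((q ^ j) ^ 2 * q)) j := by
  obtain ⟨n, rfl⟩ := Nat.exists_eq_add_of_le' hj
  simp only [krawUOdd, hahnA, hahnCLast, Nat.add_sub_cancel]
  rw [if_neg (by omega)]
  have hx : 0 < q ^ n := pow_pos hq₀ n
  have h1 : 1 - q ≠ 0 := by linarith
  have h2 : 1 + q ≠ 0 := by linarith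
  have h3 : 1 - q ^ 3 ≠ 0 := by
    have : q ^ 3 < 1 := pow_lt_one₀ hq₀.le hq₁ (by norm_num)
    linarith
  simp only [pow_add, pow_mul', pow_one, mul_pow]
  generalize q ^ n = x at *
  have e1 : 1 - 1 / (x ^ 2 * q ^ 2 * q) * x ^ 2 = -(1 - q ^ 3) / q ^ 3 := by
    field_simp
    ring
  have e2 : 1 - 1 / (x ^ 2 * q ^ 2 * q) * (x ^ 2 * q) = -((1 - q) * (1 + q)) / q ^ 2 := by
    field_simp
    ring
  have e3 : q - 1 / (x ^ 2 * q ^ 2 * q) * (x ^ 2 * q ^ 2) = -((1 - q) * (1 + q)) / q := by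
    field_simp
    ring
  have e4 : (x * q * q + x * q) ^ 2 * (x ^ 2 * q ^ 2 * q - x ^ 2 * q ^ 2)
      * (x ^ 2 * q ^ 2 * q ^ 3 - x ^ 2 * q ^ 2)
      = (x * q) ^ 6 * (1 + q) ^ 2 * (1 - q) * (1 - q ^ 3) := by ring
  rw [e1, e2, e3, ← mul_assoc, e4]
  field_simp
  ring

/-- For `N = 2j` the truncated values are `ab = q^{-j}`, `ad = Δ q^{1-j}` and `p = abcd/q =
q^{-2j}`. -/
theorem krawBEven_eq_left {q : ℝ} (hq₀ : 0 < q) (hq₁ : q < 1) {Δ : ℝ} {j n : ℕ}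
    (h : n ≠ j) :
    krawBEven j q Δ n = Δ - hahnA q 1 (1 / q ^ j) (Δ * q / q ^ j) (1 / (q ^ j) ^ 2) n
      - hahnC q 1 (1 / q ^ j) (Δ * q / q ^ j) (1 / (q ^ j) ^ 2) n := by
  have h1 := sq_pow_sub hq₀ hq₁ (show 2 * j + 0 ≠ 2 * n + 0 by omega)
  have h2 := sq_pow_sub hq₀ hq₁ (show 2 * j + 1 ≠ 2 * n + 0 by omega)
  have h3 := sq_pow_sub hq₀ hq₁ (show 2 * j + 0 ≠ 2 * n + 1 by omega)
  simp only [krawBEven, hahnA, hahnC]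
  have hw : 0 < q ^ j := pow_pos hq₀ j
  have hx : 0 < q ^ n := pow_pos hq₀ n
  simp only [pow_add, pow_mul', pow_one, pow_zero, mul_one] at *
  generalize q ^ j = w at *
  generalize q ^ n = x at *
  have e1 : 1 - 1 / w ^ 2 * x ^ 2 = (w + x) * (w - x) / w ^ 2 := by
    field_simp
    ring
  have e2 : 1 - 1 / w ^ 2 * (x ^ 2 * q) = (w ^ 2 - x ^ 2 * q) / w ^ 2 := by field_simp
  have e3 : q - 1 / w ^ 2 * x ^ 2 = (w ^ 2 * q - x ^ 2) / w ^ 2 := by field_simp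
  have e4 : w + x ≠ 0 := by positivity
  have e5 : w - x ≠ 0 := fun h => h1 (by rw [sub_eq_zero.mp h, sub_self])
  rw [e1, e2, e3]
  field_simp
  ring

theorem krawUEven_eq_left {q : ℝ} (hq₀ : 0 < q) (hq₁ : q < 1) {Δ : ℝ} (α : ℝ) {j n : ℕ}
    (h : n ≠ j) (h' : n + 1 ≠ j) :
    krawUEven j q Δ α (n + 1) = hahnA q 1 (1 / q ^ j) (Δ * q / q ^ j) (1 / (q ^ j) ^ 2) n
      * hahnC q 1 (1 / q ^ j) (Δ * q / q ^ j) (1 / (q ^ j) ^ 2) (n + 1) := by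
  have h1 := sq_pow_sub hq₀ hq₁ (show 2 * j + 0 ≠ 2 * n + 0 by omega)
  have h2 := sq_pow_sub hq₀ hq₁ (show 2 * j + 0 ≠ 2 * n + 2 by omega)
  have h3 := sq_pow_sub hq₀ hq₁ (show 2 * j + 0 ≠ 2 * n + 1 by omega)
  simp only [krawUEven, hahnA, hahnC]
  rw [if_neg h', if_neg (by omega)]
  have hw : 0 < q ^ j := pow_pos hq₀ j
  have hx : 0 < q ^ n := pow_pos hq₀ n
  simp only [pow_add, pow_mul', pow_one, pow_zero, mul_one, mul_pow] at *
  generalize q ^ j = w at *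
  generalize q ^ n = x at *
  have e1 : 1 - 1 / w ^ 2 * x ^ 2 = (w + x) * (w - x) / w ^ 2 := by
    field_simp
    ring
  have e2 : 1 - 1 / w ^ 2 * (x ^ 2 * q) = (w ^ 2 - x ^ 2 * q) / w ^ 2 := by field_simp
  have e3 : q - 1 / w ^ 2 * (x ^ 2 * q ^ 2) = q * (w ^ 2 - x ^ 2 * q) / w ^ 2 := by
    field_simp
  have e4 : 1 - 1 / w ^ 2 * (x ^ 2 * q ^ 2) = (w + x * q) * (w - x * q) / w ^ 2 := by
    field_simp
    ring
  have e5 : w + x ≠ 0 := by positivity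
  have e6 : w - x ≠ 0 := fun h => h1 (by rw [sub_eq_zero.mp h, sub_self])
  have e7 : w + x * q ≠ 0 := by positivity
  have e8 : w - x * q ≠ 0 := fun h => h2 (by rw [sub_eq_zero.mp h]; ring)
  have e9 : (w + x * q) * (w * q + x * q) * (w ^ 2 * q - x ^ 2 * q ^ 2) ^ 2
      = (w + x * q) * (w + x) * (w ^ 2 - x ^ 2 * q) ^ 2 * q ^ 3 := by ring
  rw [e1, e2, e3, e4, e9]
  field_simp
  ring

/-- Here `r₁ = q^{1-j}`, since for `N = 2j` the lattice `q^s` has only `j` points, one fewer than `Δ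
q^s`. -/
theorem krawBEven_eq_right {q : ℝ} (hq₀ : 0 < q) (hq₁ : q < 1) {Δ : ℝ} (hΔ : 0 < Δ) {j n : ℕ}
    (h : n ≠ j) :
    krawBEven j q Δ n = 1 - hahnA q Δ (q / q ^ j) (1 / (Δ * q ^ j)) (1 / (q ^ j) ^ 2) n
      - hahnC q Δ (q / q ^ j) (1 / (Δ * q ^ j)) (1 / (q ^ j) ^ 2) n := by
  have h1 := sq_pow_sub hq₀ hq₁ (show 2 * j + 0 ≠ 2 * n + 0 by omega)
  have h2 := sq_pow_sub hq₀ hq₁ (show 2 * j + 1 ≠ 2 * n + 0 by omega)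
  have h3 := sq_pow_sub hq₀ hq₁ (show 2 * j + 0 ≠ 2 * n + 1 by omega)
  simp only [krawBEven, hahnA, hahnC]
  have hw : 0 < q ^ j := pow_pos hq₀ j
  have hx : 0 < q ^ n := pow_pos hq₀ n
  simp only [pow_add, pow_mul', pow_one, pow_zero, mul_one] at *
  generalize q ^ j = w at *
  generalize q ^ n = x at *
  have e1 : 1 - 1 / w ^ 2 * x ^ 2 = (w + x) * (w - x) / w ^ 2 := by
    field_simp
    ring
  have e2 : 1 - 1 / w ^ 2 * (x ^ 2 * q) = (w ^ 2 - x ^ 2 * q) / w ^ 2 := by field_simp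
  have e3 : q - 1 / w ^ 2 * x ^ 2 = (w ^ 2 * q - x ^ 2) / w ^ 2 := by field_simp
  have e4 : w + x ≠ 0 := by positivity
  have e5 : w - x ≠ 0 := fun h => h1 (by rw [sub_eq_zero.mp h, sub_self])
  rw [e1, e2, e3]
  field_simp
  ring

theorem krawUEven_eq_right {q : ℝ} (hq₀ : 0 < q) (hq₁ : q < 1) {Δ : ℝ} (hΔ : 0 < Δ) (α : ℝ) {j n : ℕ}
    (h : n ≠ j) (h' : n + 1 ≠ j) :
    krawUEven j q Δ α (n + 1) = hahnA q Δ (q / q ^ j) (1 / (Δ * q ^ j)) (1 / (q ^ j) ^ 2) n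
      * hahnC q Δ (q / q ^ j) (1 / (Δ * q ^ j)) (1 / (q ^ j) ^ 2) (n + 1) := by
  have h1 := sq_pow_sub hq₀ hq₁ (show 2 * j + 0 ≠ 2 * n + 0 by omega)
  have h2 := sq_pow_sub hq₀ hq₁ (show 2 * j + 0 ≠ 2 * n + 2 by omega)
  have h3 := sq_pow_sub hq₀ hq₁ (show 2 * j + 0 ≠ 2 * n + 1 by omega)
  simp only [krawUEven, hahnA, hahnC]
  rw [if_neg h', if_neg (by omega)]
  have hw : 0 < q ^ j := pow_pos hq₀ j
  have hx : 0 < q ^ n := pow_pos hq₀ n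
  simp only [pow_add, pow_mul', pow_one, pow_zero, mul_one, mul_pow] at *
  generalize q ^ j = w at *
  generalize q ^ n = x at *
  have e1 : 1 - 1 / w ^ 2 * x ^ 2 = (w + x) * (w - x) / w ^ 2 := by
    field_simp
    ring
  have e2 : 1 - 1 / w ^ 2 * (x ^ 2 * q) = (w ^ 2 - x ^ 2 * q) / w ^ 2 := by field_simp
  have e3 : q - 1 / w ^ 2 * (x ^ 2 * q ^ 2) = q * (w ^ 2 - x ^ 2 * q) / w ^ 2 := by
    field_simp
  have e4 : 1 - 1 / w ^ 2 * (x ^ 2 * q ^ 2) = (w + x * q) * (w - x * q) / w ^ 2 := by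
    field_simp
    ring
  have e5 : w + x ≠ 0 := by positivity
  have e6 : w - x ≠ 0 := fun h => h1 (by rw [sub_eq_zero.mp h, sub_self])
  have e7 : w + x * q ≠ 0 := by positivity
  have e8 : w - x * q ≠ 0 := fun h => h2 (by rw [sub_eq_zero.mp h]; ring)
  have e9 : (w + x * q) * (w * q + x * q) * (w ^ 2 * q - x ^ 2 * q ^ 2) ^ 2
      = (w + x * q) * (w + x) * (w ^ 2 - x ^ 2 * q) ^ 2 * q ^ 3 := by ring
  rw [e1, e2, e3, e4, e9]
  field_simp
  ring

theorem krawBEven_last_left {q : ℝ} (hq₀ : 0 < q) (hq₁ : q < 1) {Δ : ℝ} (j : ℕ) :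
    krawBEven j q Δ j = Δ - hahnCLast q 1 (1 / q ^ j) (Δ * q / q ^ j) (1 / (q ^ j) ^ 2) j := by
  simp only [krawBEven, hahnCLast]
  have hw : 0 < q ^ j := pow_pos hq₀ j
  have h1 : 1 - q ≠ 0 := by linarith
  simp only [pow_add, pow_mul', pow_one]
  generalize q ^ j = w at *
  have e3 : q - 1 / w ^ 2 * w ^ 2 = -(1 - q) := by
    field_simp
    ring
  have e4 : w ^ 2 * q - w ^ 2 = -w ^ 2 * (1 - q) := by ring
  have e5 : w ^ 2 - w ^ 2 * q = w ^ 2 * (1 - q) := by ring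
  have e6 : w + w = 2 * w := by ring
  rw [e3, e4, e5, e6]
  field_simp
  ring

/-- The `j + 1` points `Δ q^s` close their recurrence at the singular index `j`, which requires `α =
0`. -/
theorem krawUEven_last_left {q : ℝ} (hq₀ : 0 < q) (hq₁ : q < 1) {Δ : ℝ} {j : ℕ}
    (hj : 1 ≤ j) :
    krawUEven j q Δ 0 j = hahnA q 1 (1 / q ^ j) (Δ * q / q ^ j) (1 / (q ^ j) ^ 2) (j - 1)
      * hahnCLast q 1 (1 / q ^ j) (Δ * q / q ^ j) (1 / (q ^ j) ^ 2) j := by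
  obtain ⟨n, rfl⟩ := Nat.exists_eq_add_of_le' hj
  simp only [krawUEven, hahnA, hahnCLast, Nat.add_sub_cancel, if_true]
  have hx : 0 < q ^ n := pow_pos hq₀ n
  have h1 : 1 - q ≠ 0 := by linarith
  have h2 : 1 + q ≠ 0 := by linarith
  simp only [pow_add, pow_mul', pow_one, mul_pow]
  generalize q ^ n = x at *
  have e1 : 1 - 1 / (x ^ 2 * q ^ 2) * x ^ 2 = -((1 - q) * (1 + q)) / q ^ 2 := by
    field_simp
    ring
  have e2 : 1 - 1 / (x ^ 2 * q ^ 2) * (x ^ 2 * q) = -(1 - q) / q := by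
    field_simp
    ring
  have e3 : q - 1 / (x ^ 2 * q ^ 2) * (x ^ 2 * q ^ 2) = -(1 - q) := by
    field_simp
    ring
  rw [e1, e2, e3]
  field_simp
  ring

/-- The `j = m + 1` points `q^s` close their recurrence at index `j - 1`, below the singular one, so
`α` plays no part. -/
theorem krawBEven_last_right {q : ℝ} (hq₀ : 0 < q) (hq₁ : q < 1) {Δ : ℝ} (hΔ : 0 < Δ) (m : ℕ) :
    krawBEven (m + 1) q Δ m = 1 - hahnCLast q Δ (q / q ^ (m + 1)) (1 / (Δ * q ^ (m + 1))) (1 / (q ^ (m + 1)) ^ 2) m := by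
  simp only [krawBEven, hahnCLast]
  have hx : 0 < q ^ m := pow_pos hq₀ m
  have h1 : 1 - q ≠ 0 := by linarith
  have h2 : 1 + q ≠ 0 := by linarith
  have h3 : 1 - q ^ 3 ≠ 0 := by
    have : q ^ 3 < 1 := pow_lt_one₀ hq₀.le hq₁ (by norm_num)
    linarith
  simp only [pow_add, pow_mul', pow_one, mul_pow]
  generalize q ^ m = x at *
  have e1 : q - 1 / (x ^ 2 * q ^ 2) * x ^ 2 = -(1 - q ^ 3) / q ^ 2 := by
    field_simp
    ring
  have e2 : (x * q + x) * (x ^ 2 * q ^ 2 * q - x ^ 2) = -x ^ 3 * (1 + q) * (1 - q ^ 3) := by ring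
  have e3 : (x * q + x) * (x ^ 2 * q ^ 2 - x ^ 2 * q) = -x ^ 3 * q * (1 + q) * (1 - q) := by ring
  rw [e1, e2, e3]
  field_simp
  ring

theorem krawUEven_last_right {q : ℝ} (hq₀ : 0 < q) (hq₁ : q < 1) {Δ : ℝ} (hΔ : 0 < Δ) (α : ℝ) {m : ℕ}
    (hm : 1 ≤ m) :
    krawUEven (m + 1) q Δ α m = hahnA q Δ (q / q ^ (m + 1)) (1 / (Δ * q ^ (m + 1))) (1 / (q ^ (m + 1)) ^ 2) (m - 1)
      * hahnCLast q Δ (q / q ^ (m + 1)) (1 / (Δ * q ^ (m + 1))) (1 / (q ^ (m + 1)) ^ 2) m := by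
  obtain ⟨n, rfl⟩ := Nat.exists_eq_add_of_le' hm
  simp only [krawUEven, hahnA, hahnCLast, Nat.add_sub_cancel]
  rw [if_neg (by omega), if_neg (by omega)]
  have hx : 0 < q ^ n := pow_pos hq₀ n
  have h1 : 1 - q ≠ 0 := by linarith
  have h2 : 1 + q ≠ 0 := by linarith
  have h3 : 1 - q ^ 3 ≠ 0 := by
    have : q ^ 3 < 1 := pow_lt_one₀ hq₀.le hq₁ (by norm_num)
    linarith
  have h4 : 1 + q ^ 2 ≠ 0 := by positivity
  simp only [pow_add, pow_mul', pow_one, mul_pow]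
  generalize q ^ n = x at *
  have e1 : 1 - 1 / (x ^ 2 * q ^ 2 * q ^ 2) * x ^ 2
      = -((1 - q) * (1 + q) * (1 + q ^ 2)) / q ^ 4 := by
    field_simp
    ring
  have e2 : 1 - 1 / (x ^ 2 * q ^ 2 * q ^ 2) * (x ^ 2 * q) = -(1 - q ^ 3) / q ^ 3 := by
    field_simp
    ring
  have e3 : q - 1 / (x ^ 2 * q ^ 2 * q ^ 2) * (x ^ 2 * q ^ 2) = -(1 - q ^ 3) / q ^ 2 := by
    field_simp
    ring
  have e4 : (x * q * q + x * q) * (x * q * q * q + x * q)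
      * (x ^ 2 * q ^ 2 * q ^ 2 * q - x ^ 2 * q ^ 2) ^ 2
      = (x * q) ^ 6 * (1 + q) * (1 + q ^ 2) * (1 - q ^ 3) ^ 2 := by ring
  rw [e1, e2, e3, e4]
  field_simp
  ring

/-! ### Normalization of the weights -/

theorem qPoch_succ (x q : ℝ) (k : ℕ) : qPoch x q (k + 1) = qPoch x q k * (1 - x * q ^ k) :=
  Finset.prod_range_succ _ _

theorem qPoch_succ' (x q : ℝ) (k : ℕ) : qPoch x q (k + 1) = (1 - x) * qPoch (x * q) q k := by
  rw [qPoch, Finset.prod_range_succ', pow_zero, mul_one, mul_comm, qPoch]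
  congr 1
  exact Finset.prod_congr rfl fun i _ => by ring

theorem qPoch_ne_zero {x q : ℝ} {k : ℕ} (h : ∀ i < k, 1 - x * q ^ i ≠ 0) : qPoch x q k ≠ 0 :=
  Finset.prod_ne_zero_iff.mpr fun i hi => h i (Finset.mem_range.mp hi)

theorem qPoch_reverse {q x z : ℝ} (hq : q ≠ 0) {j : ℕ} (h : x * q ^ j = z) :
    qPoch x q j = ∏ i ∈ Finset.range j, (1 - z / q ^ (i + 1)) := by
  rw [qPoch, ← Finset.prod_range_reflect]
  refine Finset.prod_congr rfl fun i hi => ?_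
  have hi' := Finset.mem_range.mp hi
  rw [← h, show q ^ j = q ^ (j - 1 - i) * q ^ (i + 1) by rw [← pow_add]; congr 1; omega,
    ← mul_assoc, mul_div_cancel_right₀ _ (pow_ne_zero _ hq)]

/-- Reversing the product and pulling `-z / q^(i+1)` out of each factor turns Pochhammer symbols
with negative powers of `q` into ones with positive powers. -/
theorem qPoch_reflect {q x z : ℝ} (hq : q ≠ 0) (hz : z ≠ 0) {j : ℕ} (h : x * q ^ j = z) :
    qPoch x q j = (∏ i ∈ Finset.range j, (-z / q ^ (i + 1))) * qPoch (q / z) q j := by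
  rw [qPoch_reverse hq h, qPoch, ← Finset.prod_mul_distrib]
  refine Finset.prod_congr rfl fun i _ => ?_
  field_simp
  ring

/-- The product `∏_{i<n} (1 - q^{-(a+i)})`. -/
def invPoch (q : ℝ) (a n : ℕ) : ℝ := ∏ i ∈ Finset.range n, (1 - 1 / q ^ (a + i))

theorem invPoch_shift (q : ℝ) (a n : ℕ) :
    (1 - 1 / q ^ a) * invPoch q (a + 1) n = invPoch q a n * (1 - 1 / q ^ (a + n)) := by
  rw [invPoch, invPoch, ← Finset.prod_range_succ, Finset.prod_range_succ', mul_comm, add_zero]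
  congr 1
  exact Finset.prod_congr rfl fun i _ => by rw [add_right_comm, add_assoc]

theorem invPoch_succ (q : ℝ) (a n : ℕ) :
    invPoch q a (n + 1) = invPoch q a n * (1 - 1 / q ^ (a + n)) :=
  Finset.prod_range_succ _ _

/-- The product `(q^{-2j-1};q²)_j`. -/
def oddPoch (q : ℝ) (j : ℕ) : ℝ := ∏ i ∈ Finset.range j, (1 - 1 / q ^ (2 * i + 3))

theorem qPoch_odd {q : ℝ} (hq : q ≠ 0) (j : ℕ) :
    qPoch (q ^ (-2 * (j : ℤ) - 1)) (q ^ 2) j = oddPoch q j := by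
  have h : q ^ (-2 * (j : ℤ) - 1) * (q ^ 2) ^ j = 1 / q := by
    rw [← pow_mul, ← zpow_natCast, ← zpow_add₀ hq, one_div, ← zpow_neg_one]
    congr 1
    push_cast
    ring
  rw [qPoch_reverse (pow_ne_zero 2 hq) h, oddPoch]
  refine Finset.prod_congr rfl fun i _ => ?_
  rw [div_div, ← pow_mul, ← pow_succ']
  ring_nf

theorem qPoch_inv {q : ℝ} (hq : q ≠ 0) (j : ℕ) :
    qPoch (q ^ (-2 * (j : ℤ) - 1)) q j = invPoch q (j + 2) j := by
  have h : q ^ (-2 * (j : ℤ) - 1) * q ^ j = 1 / q ^ (j + 1) := by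
    rw [← zpow_natCast, ← zpow_add₀ hq, one_div, ← zpow_natCast, ← zpow_neg]
    congr 1
    push_cast
    ring
  rw [qPoch_reverse hq h, invPoch]
  refine Finset.prod_congr rfl fun i _ => ?_
  rw [div_div, ← pow_add]
  ring_nf

theorem one_sub_inv_pow_ne {q : ℝ} (hq₀ : 0 < q) (hq₁ : q < 1) {n : ℕ} (hn : n ≠ 0) :
    1 - 1 / q ^ n ≠ 0 := by
  have h1 : q ^ n < 1 := pow_lt_one₀ hq₀.le hq₁ hn
  have h2 := pow_pos hq₀ n
  rw [one_sub_div h2.ne']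
  exact div_ne_zero (by linarith) h2.ne'

/-- Up to powers of `q` this is `(q;q)_{2j+1} / (q;q)_j = (q;q²)_{j+1} (-q;q)_j`, the `q`-analogue
of splitting a factorial into its even and odd parts. -/
theorem invPoch_eq_oddPoch {q : ℝ} (hq₀ : 0 < q) (hq₁ : q < 1) (j : ℕ) :
    q ^ (j * (j - 1)) * (1 - q ^ (2 * j + 1)) * (∏ i ∈ Finset.range j, (1 / q ^ (i + 1)))
      * invPoch q (j + 1) j = (1 - q) * qPoch (-q) q j * oddPoch q j := by
  induction j with
  | zero => simp [invPoch, oddPoch, qPoch]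
  | succ j ih =>
    have h1 := invPoch_shift q (j + 1) (j + 1)
    rw [invPoch_succ q (j + 1)] at h1
    have h0 := one_sub_inv_pow_ne hq₀ hq₁ (show j + 1 ≠ 0 by omega)
    have h2 : q ^ ((j + 1) * (j + 1 - 1)) = q ^ (j * (j - 1)) * q ^ (2 * j) := by
      rw [← pow_add]
      congr 1
      rcases j with _ | j
      · simp
      · simp only [Nat.add_sub_cancel]; ring
    have h3 : (1 - q ^ (2 * j + 1)) ≠ 0 := by
      have := pow_lt_one₀ hq₀.le hq₁ (show 2 * j + 1 ≠ 0 by omega)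
      linarith
    rw [h2, Finset.prod_range_succ, qPoch_succ, oddPoch, Finset.prod_range_succ, ← oddPoch]
    apply mul_left_cancel₀ (mul_ne_zero h0 h3)
    have e : (1 - 1 / q ^ (j + 1)) * (1 - q ^ (2 * j + 1)) *
        ((1 - q) * (qPoch (-q) q j * (1 - -q * q ^ j)) *
          (oddPoch q j * (1 - 1 / q ^ (2 * j + 3))))
        = (1 - 1 / q ^ (j + 1)) * (1 - q ^ (2 * j + 1)) * (1 - -q * q ^ j)
          * (1 - 1 / q ^ (2 * j + 3)) * ((1 - q) * qPoch (-q) q j * oddPoch q j) := by ring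
    have e' : (1 - 1 / q ^ (j + 1)) * (1 - q ^ (2 * j + 1)) *
        (q ^ (j * (j - 1)) * q ^ (2 * j) * (1 - q ^ (2 * (j + 1) + 1)) *
          ((∏ i ∈ Finset.range j, (1 / q ^ (i + 1))) * (1 / q ^ (j + 1)))
          * invPoch q (j + 1 + 1) (j + 1))
        = (1 - q ^ (2 * j + 1)) * (q ^ (j * (j - 1)) * q ^ (2 * j) * (1 - q ^ (2 * (j + 1) + 1)) *
          ((∏ i ∈ Finset.range j, (1 / q ^ (i + 1))) * (1 / q ^ (j + 1))))
          * ((1 - 1 / q ^ (j + 1)) * invPoch q (j + 1 + 1) (j + 1)) := by ring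
    rw [e, e', h1, ← ih]
    have hx : 0 < q ^ j := pow_pos hq₀ j
    generalize (∏ i ∈ Finset.range j, (1 / q ^ (i + 1))) = Pr
    generalize invPoch q (j + 1) j = I
    generalize q ^ (j * (j - 1)) = T
    simp only [pow_add, pow_mul', pow_one, mul_add, mul_one]
    generalize q ^ j = x at *
    field_simp
    ring

theorem prod_eq_invPoch {q p : ℝ} (hq : q ≠ 0) {a M : ℕ} (h : p * q ^ (a + M) = 1) :
    ∏ i ∈ Finset.range M, (1 - p * q ^ (i + 1)) = invPoch q a M := by
  rw [invPoch, ← Finset.prod_range_reflect]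
  refine Finset.prod_congr rfl fun i hi => ?_
  have hi' := Finset.mem_range.mp hi
  rw [show M - 1 - i + 1 = M - i by omega]
  rw [show a + M = (M - i) + (a + i) by omega, pow_add, ← mul_assoc] at h
  rw [eq_div_of_mul_eq (pow_ne_zero _ hq) h]

theorem qPoch_neg_ne_zero {q : ℝ} (hq₀ : 0 < q) (j : ℕ) : qPoch (-q) q j ≠ 0 :=
  qPoch_ne_zero fun i _ => by
    have := pow_pos hq₀ i
    nlinarith [mul_pos hq₀ this]

theorem oddPoch_ne_zero {q : ℝ} (hq₀ : 0 < q) (hq₁ : q < 1) (j : ℕ) : oddPoch q j ≠ 0 :=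
  Finset.prod_ne_zero_iff.mpr fun _ _ => one_sub_inv_pow_ne hq₀ hq₁ (by omega)

/-- `K_N` is the reciprocal of the `Δ`-free factor that the `q`-Hahn total mass contributes. -/
theorem krawKOdd_mul {q : ℝ} (hq₀ : 0 < q) (hq₁ : q < 1) (j : ℕ) :
    krawKOdd j q * ((-1) ^ j * (∏ i ∈ Finset.range j, (1 / q ^ (i + 1))) * invPoch q (j + 1) j)
      = 1 := by
  have h := invPoch_eq_oddPoch hq₀ hq₁ j
  have h1 : (1 - q) ≠ 0 := by linarith
  have h2 := qPoch_neg_ne_zero hq₀ j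
  have h3 := oddPoch_ne_zero hq₀ hq₁ j
  have h4 : ((-1 : ℝ) ^ j) * (-1) ^ j = 1 := by rw [← mul_pow]; norm_num
  rw [krawKOdd, qPoch_odd hq₀.ne', div_mul_eq_mul_div,
    div_eq_one_iff_eq (mul_ne_zero (mul_ne_zero h1 h2) h3), ← h]
  linear_combination (q ^ (j * (j - 1)) * (1 - q ^ (2 * j + 1))
    * (∏ i ∈ Finset.range j, (1 / q ^ (i + 1))) * invPoch q (j + 1) j) * h4

/-- Bookkeeping of the exponent `3j(j-1)/2` without its closed form: increasing `j` adds exactly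
`3j` to it, even under truncated division. -/
theorem pow_three_half (q : ℝ) (j : ℕ) :
    q ^ (3 * (j * (j - 1)) / 2) * ∏ i ∈ Finset.range j, q ^ (i + 1)
      = q ^ (j * (j - 1)) * q ^ (j * (j - 1)) * q ^ j := by
  induction j with
  | zero => simp
  | succ j ih =>
    have h : (j + 1) * (j + 1 - 1) = j * (j - 1) + 2 * j := by
      rcases j with _ | j
      · simp
      · simp only [Nat.add_sub_cancel]; ring
    rw [h, show 3 * (j * (j - 1) + 2 * j) / 2 = 3 * (j * (j - 1)) / 2 + 3 * j by omega,
      Finset.prod_range_succ]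
    generalize (∏ i ∈ Finset.range j, q ^ (i + 1)) = Pr at *
    simp only [pow_add _ (3 * _ / 2), pow_add _ (j * _), pow_add _ j, pow_mul' q 3 j,
      pow_mul' q 2 j, pow_one]
    generalize q ^ (3 * (j * (j - 1)) / 2) = T at *
    generalize q ^ (j * (j - 1)) = T' at *
    linear_combination (q ^ j) ^ 4 * q * ih

/-- The `Δ`-free part of `krawKEven`. -/
def krawREven (j : ℕ) (q : ℝ) : ℝ :=
  (-1) ^ j * q ^ (3 * (j * (j - 1)) / 2) * (q ^ j + 1) * (1 - q ^ (j + 1)) * (1 - q ^ (2 * j + 1))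
      * invPoch q (j + 2) j * (∏ i ∈ Finset.range j, (1 / q ^ (2 * i + 3)))
    / ((1 - q) ^ 2 * oddPoch q j ^ 2 * qPoch (-q) q j ^ 2)

theorem krawREven_mul {q : ℝ} (hq₀ : 0 < q) (hq₁ : q < 1) {j : ℕ} (hj : 1 ≤ j) :
    krawREven j q * ((∏ i ∈ Finset.range j, (-q ^ (i + 1))) * invPoch q j j) = 1 := by
  have h := invPoch_eq_oddPoch hq₀ hq₁ j
  have h1 : (1 - q) ≠ 0 := by linarith
  have h2 := qPoch_neg_ne_zero hq₀ j
  have h3 := oddPoch_ne_zero hq₀ hq₁ j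
  have h4 : ((-1 : ℝ) ^ j) * (-1) ^ j = 1 := by rw [← mul_pow]; norm_num
  have h5 : ∏ i ∈ Finset.range j, (-q ^ (i + 1)) = (-1) ^ j * ∏ i ∈ Finset.range j, q ^ (i + 1) := by
    rw [Finset.prod_neg, Finset.card_range]
  have h6 : ∏ i ∈ Finset.range j, (1 / q ^ (2 * i + 3))
      = (∏ i ∈ Finset.range j, (1 / q ^ (i + 1))) ^ 2 * (1 / q) ^ j := by
    rw [← Finset.prod_pow, ← Finset.card_range j, ← Finset.prod_const, Finset.card_range,
      ← Finset.prod_mul_distrib]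
    refine Finset.prod_congr rfl fun i _ => ?_
    rw [div_pow, one_pow, div_mul_div_comm, one_mul]
    congr 1
    ring
  have h7 := pow_three_half q j
  have hx : 0 < q ^ j := pow_pos hq₀ j
  -- The windows of exponents starting at `j` and `j + 2` are both compared with the one starting at
  -- `j + 1`, which is the window occurring in `invPoch_eq_oddPoch`.
  have h8 : (q ^ j + 1) * (1 - q ^ (j + 1)) * invPoch q (j + 2) j * invPoch q j j
      = (1 - q ^ (2 * j + 1)) * invPoch q (j + 1) j ^ 2 := by
    have s1 := invPoch_shift q (j + 1) j
    have s2 := invPoch_shift q j j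
    have n1 := one_sub_inv_pow_ne hq₀ hq₁ (show j ≠ 0 by omega)
    have e1 : 1 - 1 / q ^ (j + 1) = -(1 - q ^ (j + 1)) / q ^ (j + 1) := by
      field_simp
      ring
    have e2 : 1 - 1 / q ^ (j + 1 + j) = -(1 - q ^ (2 * j + 1)) / q ^ (j + 1 + j) := by
      rw [show 2 * j + 1 = j + 1 + j by ring]
      field_simp
      ring
    have e3 : 1 - 1 / q ^ (j + j) = (1 - 1 / q ^ j) * ((q ^ j + 1) / q ^ j) := by
      rw [pow_add]
      field_simp
      ring
    have s3 : invPoch q (j + 1) j = invPoch q j j * ((q ^ j + 1) / q ^ j) := by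
      apply mul_left_cancel₀ n1
      rw [s2, e3]
      ring
    have s4 : (1 - q ^ (j + 1)) * invPoch q (j + 2) j
        = invPoch q (j + 1) j * ((1 - q ^ (2 * j + 1)) / q ^ j) := by
      rw [e1, e2] at s1
      rw [pow_add q (j + 1) j] at s1
      field_simp at s1 ⊢
      linear_combination -s1
    rw [show (q ^ j + 1) * (1 - q ^ (j + 1)) * invPoch q (j + 2) j * invPoch q j j
      = (1 - q ^ (j + 1)) * invPoch q (j + 2) j * ((q ^ j + 1) * invPoch q j j) by ring, s4, s3]
    field_simp
  rw [krawREven, div_mul_eq_mul_div, div_eq_one_iff_eq (mul_ne_zero (mul_ne_zero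
    (pow_ne_zero 2 h1) (pow_ne_zero 2 h3)) (pow_ne_zero 2 h2)), h5, h6]
  have h9 : (1 - q) ^ 2 * oddPoch q j ^ 2 * qPoch (-q) q j ^ 2
      = ((1 - q) * qPoch (-q) q j * oddPoch q j) ^ 2 := by ring
  have h10 : q ^ j * (1 / q) ^ j = 1 := by
    rw [← mul_pow, mul_one_div_cancel hq₀.ne', one_pow]
  rw [h9, ← h]
  generalize (∏ i ∈ Finset.range j, (1 / q ^ (i + 1))) = P1 at *
  generalize (∏ i ∈ Finset.range j, q ^ (i + 1)) = P2 at *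
  generalize q ^ (3 * (j * (j - 1)) / 2) = T at *
  generalize q ^ (j * (j - 1)) = T' at *
  generalize invPoch q j j = X' at *
  generalize invPoch q (j + 1) j = X at *
  generalize invPoch q (j + 2) j = U at *
  generalize (-1 : ℝ) ^ j = σ at *
  generalize (1 / q) ^ j = ι at *
  generalize (1 - q ^ (2 * j + 1)) = c at *
  have : σ * T * (q ^ j + 1) * (1 - q ^ (j + 1)) * c * U * (P1 ^ 2 * ι) * (σ * P2 * X')
      = (σ * σ) * (T * P2) * ((q ^ j + 1) * (1 - q ^ (j + 1)) * U * X') * c * P1 ^ 2 * ι := by ring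
  rw [this, h4, h7, h8]
  linear_combination (T' ^ 2 * c ^ 2 * X ^ 2 * P1 ^ 2) * h10

/-- Reflecting the two `Δ`-dependent symbols isolates the dependence on `Δ` as `(Δq;q)_j (q/Δ;q)_j`.
The factors `1 - Δq` and `1 - Δq^(j+1)` only shift one of the windows. -/
theorem krawKEven_eq {q Δ : ℝ} (hq₀ : 0 < q) (hΔ : Δ ≠ 0) {j : ℕ}
    (h : 1 - Δ * q ^ (j + 1) ≠ 0) :
    krawKEven j q Δ = krawREven j q * (qPoch (Δ * q) q j * qPoch (q / Δ) q j) := by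
  have hq : q ≠ 0 := hq₀.ne'
  have e1 : qPoch (Δ * q ^ (-(j : ℤ))) q j
      = (∏ i ∈ Finset.range j, (-Δ / q ^ (i + 1))) * qPoch (q / Δ) q j :=
    qPoch_reflect hq hΔ (by rw [zpow_neg, zpow_natCast, inv_mul_cancel_right₀ (pow_ne_zero _ hq)])
  have e2 : qPoch (q ^ (-(j : ℤ) - 1) / Δ) q j
      = (∏ i ∈ Finset.range j, (-(1 / (Δ * q)) / q ^ (i + 1))) * qPoch (q / (1 / (Δ * q))) q j := by
    refine qPoch_reflect hq (by positivity) ?_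
    rw [zpow_sub₀ hq, zpow_neg, zpow_natCast, zpow_one]
    field_simp
  have e3 : (1 - Δ * q) * qPoch (q / (1 / (Δ * q))) q j
      = qPoch (Δ * q) q j * (1 - Δ * q ^ (j + 1)) := by
    rw [show q / (1 / (Δ * q)) = Δ * q * q by field_simp, ← qPoch_succ', qPoch_succ]
    ring
  have e4 : (∏ i ∈ Finset.range j, (-Δ / q ^ (i + 1)))
      * (∏ i ∈ Finset.range j, (-(1 / (Δ * q)) / q ^ (i + 1)))
      = ∏ i ∈ Finset.range j, (1 / q ^ (2 * i + 3)) := by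
    rw [← Finset.prod_mul_distrib]
    refine Finset.prod_congr rfl fun i _ => ?_
    field_simp
    ring
  rw [krawKEven, krawREven, qPoch_odd hq, qPoch_inv hq, e1, e2, ← e4]
  generalize (∏ i ∈ Finset.range j, (-Δ / q ^ (i + 1))) = P1 at *
  generalize (∏ i ∈ Finset.range j, (-(1 / (Δ * q)) / q ^ (i + 1))) = P2 at *
  rw [div_mul_eq_mul_div, mul_assoc (1 - Δ * q ^ (j + 1)), mul_assoc (1 - Δ * q ^ (j + 1)),
    ← div_div]
  congr 1
  rw [div_eq_iff h]
  linear_combination ((-1) ^ j * q ^ (3 * (j * (j - 1)) / 2) * (q ^ j + 1) * (1 - q ^ (j + 1))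
    * (1 - q ^ (2 * j + 1)) * invPoch q (j + 2) j * P1 * P2 * qPoch (q / Δ) q j) * e3

/-! ### The two halves of the weight -/

theorem qPoch_zero (x q : ℝ) : qPoch x q 0 = 1 := rfl

theorem one_sub_div_pow_mul {q z : ℝ} (hq₀ : 0 < q) {i j : ℕ} (hi : i ≤ j)
    (h : z ≠ q ^ (j - i)) : 1 - z / q ^ j * q ^ i ≠ 0 := by
  have e : q ^ j = q ^ (j - i) * q ^ i := by rw [← pow_add]; congr 1; omega
  have hx := pow_pos hq₀ i
  have hy := pow_pos hq₀ (j - i)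
  rw [e, div_mul_eq_mul_div, mul_div_mul_right _ _ hx.ne', one_sub_div hy.ne']
  exact div_ne_zero (sub_ne_zero.mpr h.symm) hy.ne'

theorem pow_succ_ne_one {q : ℝ} (hq₀ : 0 < q) (hq₁ : q < 1) (i : ℕ) : q ^ (i + 1) ≠ 1 :=
  (pow_lt_one₀ hq₀.le hq₁ (Nat.succ_ne_zero i)).ne

theorem one_sub_inv_mul_pow_ne {q : ℝ} (hq₀ : 0 < q) (hq₁ : q < 1) {m i : ℕ} (h : i ≠ m) :
    1 - 1 / q ^ m * q ^ i ≠ 0 := by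
  have hx := pow_pos hq₀ m
  rw [div_mul_eq_mul_div, one_mul, one_sub_div hx.ne']
  exact div_ne_zero (pow_ne_pow hq₀ hq₁ h.symm) hx.ne'

/-! ### The two half-weights for `N = 2j+1`, each on `j + 1` points. -/

section Odd

variable {q Δ : ℝ} {j : ℕ}

theorem hahnParam_odd_left (hq₀ : 0 < q) (hq₁ : q < 1) (h₁ : ∀ i ≤ j, Δ ≠ q ^ i) :
    HahnParam Δ q 1 (1 / q ^ j) (Δ / q ^ j) (1 / ((q ^ j) ^ 2 * q)) j where
  q_ne := hq₀.ne'
  q_pow := pow_succ_ne_one hq₀ hq₁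
  p_ne := by positivity
  G_ne := one_ne_zero
  rel := by field_simp
  r₁_pow := one_div_mul_cancel (pow_pos hq₀ j).ne'
  r₂_pow := fun i hi => one_sub_div_pow_mul hq₀ hi.le (h₁ _ (by omega))
  p_pow := fun i hi => by
    rw [← pow_mul', ← pow_succ]
    exact one_sub_inv_mul_pow_ne hq₀ hq₁ (by omega)

/-- The `q`-Hahn weight equation required by `hahn_moment`, with `Y = Δ q`. -/
theorem krawWOddEven_succ (hq₀ : 0 < q) (hq₁ : q < 1) (α : ℝ) {s : ℕ}
    (h : 1 - Δ * q * q ^ s ≠ 0) :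
    krawWOddEven j q Δ α (s + 1) * ((1 - q ^ (s + 1)) * (1 - Δ * q * q ^ s))
      = q * (1 - 1 / q ^ j * q ^ s) * (1 - Δ / q ^ j * q ^ s) * krawWOddEven j q Δ α s := by
  have h1 : 1 - q * q ^ s ≠ 0 := by
    rw [← pow_succ']; exact sub_ne_zero.mpr (pow_succ_ne_one hq₀ hq₁ s).symm
  simp only [krawWOddEven, qPoch_succ _ _ s, zpow_neg, zpow_natCast, pow_succ' q s,
    ← one_div]
  rw [mul_one_div Δ]
  generalize (1 - 1 / q ^ j * q ^ s) = A
  generalize (1 - Δ / q ^ j * q ^ s) = B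
  generalize qPoch q q s = C
  generalize qPoch (Δ * q) q s = E
  rw [show C * (1 - q * q ^ s) * qPoch (1 / Δ) q (j + 1) * Δ ^ j * (E * (1 - Δ * q * q ^ s))
    = (C * qPoch (1 / Δ) q (j + 1) * Δ ^ j * E) * ((1 - q * q ^ s) * (1 - Δ * q * q ^ s)) by ring,
    mul_assoc (krawKOdd j q), div_mul_eq_mul_div, mul_div_mul_right _ _ (mul_ne_zero h1 h)]
  ring

/-- Setting `α = 0` removes the mixing factor `1 - α`. The total-mass formula reduces the sum to the
weight at `s = 0`; after reflection its `Δ`-dependence cancels and `K_N` supplies the rest. -/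
theorem sum_krawWOddEven (hq₀ : 0 < q) (hq₁ : q < 1) (hΔ : 0 < Δ) (h₁ : ∀ i ≤ j, Δ ≠ q ^ i)
    (h₂ : ∀ i ≤ j, Δ * q ^ i ≠ 1) :
    ∑ s ∈ Finset.range (j + 1), krawWOddEven j q Δ 0 s = 1 := by
  have hq : q ≠ 0 := hq₀.ne'
  have hY : ∀ i < j, 1 - Δ * q * q ^ i ≠ 0 := fun i hi => by
    rw [mul_assoc, ← pow_succ']
    exact sub_ne_zero.mpr (h₂ _ (by omega)).symm
  have hm := (hahnParam_odd_left hq₀ hq₁ h₁).total_mass (W := krawWOddEven j q Δ 0) (Y := Δ * q)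
    hΔ.ne' (by positivity) (by field_simp) (by ring)
    fun s hs => krawWOddEven_succ hq₀ hq₁ 0 (hY s hs)
  have e1 : qPoch (Δ * q ^ (-(j : ℤ))) q j
      = (∏ i ∈ Finset.range j, (-Δ / q ^ (i + 1))) * qPoch (q / Δ) q j :=
    qPoch_reflect hq hΔ.ne'
      (by rw [zpow_neg, zpow_natCast, inv_mul_cancel_right₀ (pow_ne_zero _ hq)])
  have e2 : qPoch (q ^ (-(j : ℤ)) / Δ) q j
      = (∏ i ∈ Finset.range j, (-(1 / Δ) / q ^ (i + 1))) * qPoch (q / (1 / Δ)) q j := by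
    refine qPoch_reflect hq (by positivity) ?_
    rw [zpow_neg, zpow_natCast]
    field_simp
  have e3 : qPoch (1 / Δ) q (j + 1) = (1 - 1 / Δ) * qPoch (q / Δ) q j := by
    rw [qPoch_succ', one_div_mul_eq_div]
  have n1 : 1 - 1 / Δ ≠ 0 := by
    have := h₁ 0 (Nat.zero_le _)
    rw [pow_zero] at this
    rw [one_sub_div hΔ.ne']
    exact div_ne_zero (sub_ne_zero.mpr this) hΔ.ne'
  have n2 : qPoch (q / Δ) q j ≠ 0 := qPoch_ne_zero fun i hi => by
    rw [div_mul_eq_mul_div, ← pow_succ', one_sub_div hΔ.ne']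
    exact div_ne_zero (sub_ne_zero.mpr (h₁ _ (by omega))) hΔ.ne'
  have hZ : qPoch (Δ * q) q j ≠ 0 := qPoch_ne_zero hY
  have e4 : krawWOddEven j q Δ 0 0 = krawKOdd j q * ((∏ i ∈ Finset.range j, (-Δ / q ^ (i + 1)))
      * (∏ i ∈ Finset.range j, (-(1 / Δ) / q ^ (i + 1))) * qPoch (Δ * q) q j / Δ ^ j) := by
    rw [krawWOddEven, e1, e2, e3, show q / (1 / Δ) = Δ * q by field_simp]
    simp only [qPoch_zero, pow_zero, sub_zero, mul_one, one_mul]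
    generalize qPoch (q / Δ) q j = Z at *
    generalize 1 - 1 / Δ = c at *
    field_simp
  have e5 : (∏ i ∈ Finset.range j, (-Δ / q ^ (i + 1)))
      * (∏ i ∈ Finset.range j, (-(1 / Δ) / q ^ (i + 1)))
      * ∏ i ∈ Finset.range j, (-(Δ * q) * q ^ i)
      = Δ ^ j * ((-1) ^ j * (∏ i ∈ Finset.range j, (1 / q ^ (i + 1)))) := by
    rw [← mul_assoc, ← mul_pow]
    conv_rhs => rw [← Finset.card_range j, ← Finset.prod_const, Finset.card_range]
    rw [← Finset.prod_mul_distrib, ← Finset.prod_mul_distrib, ← Finset.prod_mul_distrib]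
    refine Finset.prod_congr rfl fun i _ => ?_
    field_simp
    ring
  have e6 := krawKOdd_mul hq₀ hq₁ j
  rw [Finset.prod_mul_distrib, e4,
    prod_eq_invPoch (a := j + 1) hq (by field_simp; ring_nf), ← qPoch] at hm
  apply mul_right_cancel₀ hZ
  rw [hm]
  have hΔj : Δ ^ j ≠ 0 := pow_ne_zero _ hΔ.ne'
  generalize (∏ i ∈ Finset.range j, (-Δ / q ^ (i + 1))) = P1 at *
  generalize (∏ i ∈ Finset.range j, (-(1 / Δ) / q ^ (i + 1))) = P2 at *
  generalize (∏ i ∈ Finset.range j, (-(Δ * q) * q ^ i)) = P3 at *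
  generalize (∏ i ∈ Finset.range j, (1 / q ^ (i + 1))) = P4 at *
  field_simp
  linear_combination (krawKOdd j q * invPoch q (j + 1) j) * e5 + Δ ^ j * e6

/-- The two lattices have equally many points for `N = 2j+1`, and exchanging them means `Δ ↦ 1/Δ`,
`α ↦ 1 - α`. All facts about the second half-weight follow from the first. -/
theorem krawWOddOdd_eq (α : ℝ) (s : ℕ) :
    krawWOddOdd j q Δ α s = krawWOddEven j q (1 / Δ) (1 - α) s := by
  rw [krawWOddOdd, krawWOddEven, one_div_one_div, div_div_eq_mul_div, div_one, sub_sub_cancel,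
    one_div_mul_eq_div, one_div_mul_eq_div, one_div, inv_pow]
  congr 1
  rw [show qPoch q q s * qPoch Δ q (j + 1) * (Δ ^ j)⁻¹ * qPoch (q / Δ) q s
    = qPoch q q s * qPoch Δ q (j + 1) * qPoch (q / Δ) q s * (Δ ^ j)⁻¹ by ring,
    ← div_div _ _ (Δ ^ j)⁻¹, div_inv_eq_mul]
  ring_nf

theorem hahnParam_odd_right (hq₀ : 0 < q) (hq₁ : q < 1) (hΔ : 0 < Δ)
    (h₂ : ∀ i ≤ j, Δ * q ^ i ≠ 1) :
    HahnParam 1 q Δ (1 / q ^ j) (1 / (Δ * q ^ j)) (1 / ((q ^ j) ^ 2 * q)) j where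
  q_ne := hq₀.ne'
  q_pow := pow_succ_ne_one hq₀ hq₁
  p_ne := by positivity
  G_ne := hΔ.ne'
  rel := by field_simp
  r₁_pow := one_div_mul_cancel (pow_pos hq₀ j).ne'
  r₂_pow := fun i hi => by
    rw [← div_div]
    refine one_sub_div_pow_mul hq₀ hi.le fun e => h₂ (j - i) (by omega) ?_
    rw [← e, mul_one_div_cancel hΔ.ne']
  p_pow := fun i hi => by
    rw [← pow_mul', ← pow_succ]
    exact one_sub_inv_mul_pow_ne hq₀ hq₁ (by omega)

end Odd

/-! ### The two half-weights for `N = 2j`, on `j + 1` and on `j` points. -/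

section Even

variable {q Δ : ℝ} {j : ℕ}

theorem hahnParam_even_left (hq₀ : 0 < q) (hq₁ : q < 1) (h₁ : ∀ i ≤ j, Δ ≠ q ^ i) :
    HahnParam Δ q 1 (1 / q ^ j) (Δ * q / q ^ j) (1 / (q ^ j) ^ 2) j where
  q_ne := hq₀.ne'
  q_pow := pow_succ_ne_one hq₀ hq₁
  p_ne := by positivity
  G_ne := one_ne_zero
  rel := by field_simp
  r₁_pow := one_div_mul_cancel (pow_pos hq₀ j).ne'
  r₂_pow := fun i hi => by
    refine one_sub_div_pow_mul hq₀ hi.le fun e => h₁ (j - i - 1) (by omega) ?_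
    rw [show j - i = j - i - 1 + 1 by omega, pow_succ] at e
    exact mul_right_cancel₀ hq₀.ne' e
  p_pow := fun i hi => by
    rw [← pow_mul']
    exact one_sub_inv_mul_pow_ne hq₀ hq₁ (by omega)

theorem krawWEvenEven_succ (hq₀ : 0 < q) (hq₁ : q < 1) (α : ℝ) {s : ℕ}
    (h : 1 - Δ * q * q ^ s ≠ 0) :
    krawWEvenEven j q Δ α (s + 1) * ((1 - q ^ (s + 1)) * (1 - Δ * q * q ^ s))
      = q * (1 - 1 / q ^ j * q ^ s) * (1 - Δ * q / q ^ j * q ^ s) * krawWEvenEven j q Δ α s := by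
  have h1 : 1 - q * q ^ s ≠ 0 := by
    rw [← pow_succ']; exact sub_ne_zero.mpr (pow_succ_ne_one hq₀ hq₁ s).symm
  have e : Δ * q ^ (1 - (j : ℤ)) = Δ * q / q ^ j := by
    rw [zpow_sub₀ hq₀.ne', zpow_one, zpow_natCast, mul_div_assoc]
  simp only [krawWEvenEven, qPoch_succ _ _ s, e, zpow_neg, zpow_natCast, pow_succ' q s, ← one_div]
  generalize (1 - 1 / q ^ j * q ^ s) = A
  generalize (1 - Δ * q / q ^ j * q ^ s) = B
  generalize qPoch q q s = C
  generalize qPoch (Δ * q) q s = E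
  rw [show Δ ^ j * (C * (1 - q * q ^ s)) * qPoch (q / Δ) q j * (E * (1 - Δ * q * q ^ s))
    = (Δ ^ j * C * qPoch (q / Δ) q j * E) * ((1 - q * q ^ s) * (1 - Δ * q * q ^ s)) by ring,
    mul_assoc (krawKEven j q Δ), div_mul_eq_mul_div, mul_div_mul_right _ _ (mul_ne_zero h1 h)]
  ring

/-- As for odd `N`, the total mass formula with `Y = Δ q` leaves the weight at `s = 0`. The
hypothesis `h₂` reaches `j + 1` because of the factor `1 - Δ q^(j+1)` in the denominator of `K_N`.
-/
theorem sum_krawWEvenEven (hq₀ : 0 < q) (hq₁ : q < 1) (hΔ : 0 < Δ) (hj : 1 ≤ j)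
    (h₁ : ∀ i ≤ j, Δ ≠ q ^ i) (h₂ : ∀ i ≤ j + 1, Δ * q ^ i ≠ 1) :
    ∑ s ∈ Finset.range (j + 1), krawWEvenEven j q Δ 0 s = 1 := by
  have hq : q ≠ 0 := hq₀.ne'
  have hY : ∀ i < j, 1 - Δ * q * q ^ i ≠ 0 := fun i hi => by
    rw [mul_assoc, ← pow_succ']
    exact sub_ne_zero.mpr (h₂ _ (by omega)).symm
  have hm := (hahnParam_even_left hq₀ hq₁ h₁).total_mass (W := krawWEvenEven j q Δ 0)
    (Y := Δ * q) hΔ.ne' (by positivity) (by field_simp) (by ring)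
    fun s hs => krawWEvenEven_succ hq₀ hq₁ 0 (hY s hs)
  have n2 : qPoch (q / Δ) q j ≠ 0 := qPoch_ne_zero fun i hi => by
    rw [div_mul_eq_mul_div, ← pow_succ', one_sub_div hΔ.ne']
    exact div_ne_zero (sub_ne_zero.mpr (h₁ _ (by omega))) hΔ.ne'
  have hZ : qPoch (Δ * q) q j ≠ 0 := qPoch_ne_zero hY
  have e4 : krawWEvenEven j q Δ 0 0 = krawREven j q * (qPoch (Δ * q) q j / Δ ^ j) := by
    rw [krawWEvenEven, krawKEven_eq hq₀ hΔ.ne' (sub_ne_zero.mpr (h₂ _ le_rfl).symm)]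
    simp only [qPoch_zero, pow_zero, sub_zero, mul_one]
    generalize qPoch (q / Δ) q j = Z at *
    field_simp
  have e5 : ∏ i ∈ Finset.range j, (-(Δ * q) * q ^ i)
      = Δ ^ j * ∏ i ∈ Finset.range j, (-q ^ (i + 1)) := by
    conv_rhs => rw [← Finset.card_range j, ← Finset.prod_const, Finset.card_range]
    rw [← Finset.prod_mul_distrib]
    exact Finset.prod_congr rfl fun i _ => by ring
  have e6 := krawREven_mul hq₀ hq₁ hj
  rw [Finset.prod_mul_distrib, e4, e5,
    prod_eq_invPoch (a := j) hq (by field_simp; ring_nf), ← qPoch] at hm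
  apply mul_right_cancel₀ hZ
  rw [hm]
  have hΔj : Δ ^ j ≠ 0 := pow_ne_zero _ hΔ.ne'
  field_simp
  linear_combination e6

theorem hahnParam_even_right (hq₀ : 0 < q) (hq₁ : q < 1) (hΔ : 0 < Δ) (m : ℕ)
    (h₂ : ∀ i ≤ m + 2, Δ * q ^ i ≠ 1) :
    HahnParam 1 q Δ (q / q ^ (m + 1)) (1 / (Δ * q ^ (m + 1))) (1 / (q ^ (m + 1)) ^ 2) m where
  q_ne := hq₀.ne'
  q_pow := pow_succ_ne_one hq₀ hq₁
  p_ne := by positivity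
  G_ne := hΔ.ne'
  rel := by field_simp
  r₁_pow := by
    rw [pow_succ]
    field_simp
  r₂_pow := fun i hi => by
    rw [← div_div]
    refine one_sub_div_pow_mul hq₀ (by omega) fun e => h₂ (m + 1 - i) (by omega) ?_
    rw [← e, mul_one_div_cancel hΔ.ne']
  p_pow := fun i hi => by
    rw [← pow_mul']
    exact one_sub_inv_mul_pow_ne hq₀ hq₁ (by omega)

theorem krawWEvenOdd_succ (hq₀ : 0 < q) (hq₁ : q < 1) (hΔ : 0 < Δ) (α : ℝ) {s : ℕ}
    (h : 1 - q / Δ * q ^ s ≠ 0) :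
    krawWEvenOdd j q Δ α (s + 1) * ((1 - q ^ (s + 1)) * (1 - q / Δ * q ^ s))
      = q * (1 - q / q ^ j * q ^ s) * (1 - 1 / (Δ * q ^ j) * q ^ s)
        * krawWEvenOdd j q Δ α s := by
  have h1 : 1 - q * q ^ s ≠ 0 := by
    rw [← pow_succ']; exact sub_ne_zero.mpr (pow_succ_ne_one hq₀ hq₁ s).symm
  have e : q ^ (1 - (j : ℤ)) = q / q ^ j := by
    rw [zpow_sub₀ hq₀.ne', zpow_one, zpow_natCast]
  have e' : q ^ (-(j : ℤ)) / Δ = 1 / (Δ * q ^ j) := by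
    rw [zpow_neg, zpow_natCast]
    field_simp
  simp only [krawWEvenOdd, qPoch_succ _ _ s, e, e', pow_succ' q s]
  generalize (1 - q / q ^ j * q ^ s) = A
  generalize (1 - 1 / (Δ * q ^ j) * q ^ s) = B
  generalize qPoch q q s = C
  generalize qPoch (q / Δ) q s = E
  rw [show (1 - q ^ j / Δ) * (C * (1 - q * q ^ s)) * qPoch (Δ * q) q j
      * (E * (1 - q / Δ * q ^ s))
    = ((1 - q ^ j / Δ) * C * qPoch (Δ * q) q j * E)
      * ((1 - q * q ^ s) * (1 - q / Δ * q ^ s)) by ring,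
    mul_assoc (krawKEven j q Δ), div_mul_eq_mul_div, mul_div_mul_right _ _ (mul_ne_zero h1 h)]
  ring

/-- The halves have different sizes, so no exchange symmetry is available and the mass is computed
anew, with `Y = q / Δ`. The extra factors `1 - q^j` and `1 - q^j/Δ` of the weight compensate for the
missing point. -/
theorem sum_krawWEvenOdd (hq₀ : 0 < q) (hq₁ : q < 1) (hΔ : 0 < Δ) (m : ℕ)
    (h₁ : ∀ i ≤ m + 1, Δ ≠ q ^ i) (h₂ : ∀ i ≤ m + 2, Δ * q ^ i ≠ 1) :
    ∑ s ∈ Finset.range (m + 1), krawWEvenOdd (m + 1) q Δ 1 s = 1 := by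
  have hq : q ≠ 0 := hq₀.ne'
  have hY' : ∀ i ≤ m, 1 - q / Δ * q ^ i ≠ 0 := fun i hi => by
    rw [div_mul_eq_mul_div, ← pow_succ', one_sub_div hΔ.ne']
    exact div_ne_zero (sub_ne_zero.mpr (h₁ _ (by omega))) hΔ.ne'
  have hm := (hahnParam_even_right hq₀ hq₁ hΔ m h₂).total_mass (W := krawWEvenOdd (m + 1) q Δ 1)
    (Y := q / Δ) one_ne_zero (by positivity) (by field_simp) (by field_simp)
    fun s hs => krawWEvenOdd_succ hq₀ hq₁ hΔ 1 (hY' s hs.le)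
  have n2 : qPoch (Δ * q) q (m + 1) ≠ 0 := qPoch_ne_zero fun i hi => by
    rw [mul_assoc, ← pow_succ']
    exact sub_ne_zero.mpr (h₂ _ (by omega)).symm
  have hZ : qPoch (q / Δ) q m ≠ 0 := qPoch_ne_zero fun i hi => hY' i hi.le
  have e4 : krawWEvenOdd (m + 1) q Δ 1 0
      = krawREven (m + 1) q * (qPoch (q / Δ) q m * Δ ^ m * (1 - q ^ (m + 1))) := by
    rw [krawWEvenOdd, krawKEven_eq hq₀ hΔ.ne' (sub_ne_zero.mpr (h₂ _ le_rfl).symm),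
      qPoch_succ (q / Δ)]
    have n3 := hY' m le_rfl
    have n4 : 1 - q ^ (m + 1) / Δ = 1 - q / Δ * q ^ m := by rw [pow_succ']; ring
    have n5 : Δ ^ (((m + 1 : ℕ) : ℤ) - 1) = Δ ^ m := by
      rw [← zpow_natCast]
      congr 1
      push_cast
      ring
    rw [n4, n5]
    simp only [qPoch_zero, pow_zero, mul_one, one_mul]
    generalize 1 - q / Δ * q ^ m = c at *
    field_simp
  have e5 : ∏ i ∈ Finset.range m, (-(q / Δ) * q ^ i)
      = (1 / Δ) ^ m * ∏ i ∈ Finset.range m, (-q ^ (i + 1)) := by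
    conv_rhs => rw [← Finset.card_range m, ← Finset.prod_const, Finset.card_range]
    rw [← Finset.prod_mul_distrib]
    exact Finset.prod_congr rfl fun i _ => by ring
  have e6 := krawREven_mul hq₀ hq₁ (show 1 ≤ m + 1 by omega)
  have e7 : invPoch q (m + 1) (m + 1) = (1 - 1 / q ^ (m + 1)) * invPoch q (m + 2) m := by
    rw [invPoch_shift, invPoch_succ]
  have e8 : -q ^ (m + 1) * (1 - 1 / q ^ (m + 1)) = 1 - q ^ (m + 1) := by
    field_simp
    ring
  rw [Finset.prod_range_succ, e7] at e6
  rw [Finset.prod_mul_distrib, e4, e5,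
    prod_eq_invPoch (a := m + 2) hq (by field_simp; ring_nf), ← qPoch] at hm
  apply mul_right_cancel₀ hZ
  rw [hm, one_div, inv_pow]
  have hΔj : Δ ^ m ≠ 0 := pow_ne_zero _ hΔ.ne'
  generalize qPoch (q / Δ) q m = Z at *
  generalize (∏ i ∈ Finset.range m, (-q ^ (i + 1))) = P1 at *
  generalize invPoch q (m + 2) m = I at *
  field_simp
  linear_combination e6 - krawREven (m + 1) q * P1 * I * e8

end Even

/-! ### Orthogonality -/

theorem sum_range_two_mul (f : ℕ → ℝ) (m : ℕ) :
    ∑ i ∈ Finset.range (2 * m), f i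
      = ∑ s ∈ Finset.range m, f (2 * s) + ∑ s ∈ Finset.range m, f (2 * s + 1) := by
  induction m with
  | zero => simp
  | succ m ih =>
    rw [mul_add, mul_one, Finset.sum_range_succ, Finset.sum_range_succ, ih, Finset.sum_range_succ,
      Finset.sum_range_succ]
    ring

theorem HahnParam.sum_mul_monicOP {D q G r₁ r₂ p : ℝ} {M : ℕ} (h : HahnParam D q G r₁ r₂ p M)
    {W : ℕ → ℝ} {Y : ℝ} (hD : D ≠ 0) (hY : Y ≠ 0) (hp : p * Y = r₁ * r₂) (hG : G * Y = q * D)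
    (hW : ∀ s < M, W (s + 1) * ((1 - q ^ (s + 1)) * (1 - Y * q ^ s))
      = q * (1 - r₁ * q ^ s) * (1 - r₂ * q ^ s) * W s) (b u : ℕ → ℝ)
    (hb : ∀ n < M, b n = D - hahnA q G r₁ r₂ p n - hahnC q G r₁ r₂ p n)
    (hu : ∀ n, n + 1 < M → u (n + 1) = hahnA q G r₁ r₂ p n * hahnC q G r₁ r₂ p (n + 1))
    {n : ℕ} (hn : 1 ≤ n) (hnM : n ≤ M) :
    ∑ s ∈ Finset.range (M + 1), W s * (monicOP b u n).eval (D * q ^ s) = 0 := by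
  have h0 := h.sum_mul_hahnPoly (Finset.range (M + 1)) W (fun s => D * q ^ s)
    (fun k _ => hahn_moment h.q_ne hD hY h.r₁_pow hp hG hW k) hn hnM
  calc ∑ s ∈ Finset.range (M + 1), W s * (monicOP b u n).eval (D * q ^ s)
      = ∑ s ∈ Finset.range (M + 1), (∏ i ∈ Finset.range n, hahnA q G r₁ r₂ p i)
          * (W s * hahnPoly D q G r₁ r₂ p n (D * q ^ s)) := by
        refine Finset.sum_congr rfl fun s _ => ?_
        rw [h.eval_monicOP b u hb hu _ n hnM]
        ring
    _ = 0 := by rw [← Finset.mul_sum, h0, mul_zero]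

/-- Orthogonality for a functional that is glued from two parts, on each of which the polynomials
reflect with constants `κ₀`, `κ₁`. -/
theorem sum_monicOP_mul_of_glue (b u : ℕ → ℝ) (p r m₀ m₁ : ℕ) (hpr : r + 1 ≤ p)
    (w y W₀ W₁ y₀ y₁ : ℕ → ℝ) (α κ₀ κ₁ : ℝ) (hκ : (1 - α) * κ₀ + α * κ₁ = 0)
    (hb : ∀ i, 1 ≤ i → i ≤ r → b (p + i) = b (r - i))
    (hu : ∀ i, 1 ≤ i → i ≤ r → u (p + i) = u (r + 1 - i))
    (hsum : ∀ f : ℝ → ℝ, ∑ i ∈ Finset.range (p + r + 1), w i * f (y i)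
      = (1 - α) * ∑ s ∈ Finset.range m₀, W₀ s * f (y₀ s)
        + α * ∑ s ∈ Finset.range m₁, W₁ s * f (y₁ s))
    (hy : ∀ i ≤ p + r, (∃ s < m₀, y i = y₀ s) ∨ ∃ s < m₁, y i = y₁ s)
    (h₀ : ∀ s < m₀, (monicOP b u p).eval (y₀ s) = κ₀ * (monicOP b u r).eval (y₀ s))
    (h₀' : ∀ s < m₀, (monicOP b u (p + 1)).eval (y₀ s)
      = κ₀ * ((y₀ s - b r) * (monicOP b u r).eval (y₀ s) - (monicOP b u (r + 1)).eval (y₀ s)))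
    (h₁ : ∀ s < m₁, (monicOP b u p).eval (y₁ s) = κ₁ * (monicOP b u r).eval (y₁ s))
    (h₁' : ∀ s < m₁, (monicOP b u (p + 1)).eval (y₁ s)
      = κ₁ * ((y₁ s - b r) * (monicOP b u r).eval (y₁ s) - (monicOP b u (r + 1)).eval (y₁ s)))
    (hone₀ : ∑ s ∈ Finset.range m₀, W₀ s = 1) (hone₁ : ∑ s ∈ Finset.range m₁, W₁ s = 1)
    (hzero₀ : ∀ n, 1 ≤ n → n < p → ∑ s ∈ Finset.range m₀, W₀ s * (monicOP b u n).eval (y₀ s) = 0)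
    (hzero₁ : ∀ n, 1 ≤ n → n < p → ∑ s ∈ Finset.range m₁, W₁ s * (monicOP b u n).eval (y₁ s) = 0) :
    ∀ n ≤ p + r, ∀ m ≤ p + r,
      ∑ i ∈ Finset.range (p + r + 1), w i * (monicOP b u n).eval (y i) * (monicOP b u m).eval (y i)
        = if n = m then ∏ k ∈ Finset.Icc 1 n, u k else 0 := by
  have R₀ := fun s hs => eval_monicOP_reflect b u (y₀ s) κ₀ p r hb hu (h₀ s hs) (h₀' s hs)
  have R₁ := fun s hs => eval_monicOP_reflect b u (y₁ s) κ₁ p r hb hu (h₁ s hs) (h₁' s hs)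
  -- The two halves are indistinguishable on polynomials of degree less than `p`; this covers the
  -- reflected degrees `r - i`, since `r < p`.
  have hδ : ∀ n < p, ∑ s ∈ Finset.range m₀, W₀ s * (monicOP b u n).eval (y₀ s)
      = ∑ s ∈ Finset.range m₁, W₁ s * (monicOP b u n).eval (y₁ s) := by
    intro n hn
    rcases Nat.eq_zero_or_pos n with rfl | h
    · simp only [eval_monicOP_zero, mul_one, hone₀, hone₁]
    · rw [hzero₀ n h hn, hzero₁ n h hn]
  refine sum_monicOP_mul_eq b u (p + r) w y ?_ ?_ ?_
  · have := hsum fun _ => 1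
    simp only [mul_one, hone₀, hone₁] at this
    rw [this]
    ring
  · intro n hn hnN
    rw [hsum fun t => (monicOP b u n).eval t]
    rcases Nat.lt_or_ge n p with h | h
    · rw [hzero₀ n hn h, hzero₁ n hn h]
      ring
    · obtain ⟨i, rfl⟩ := Nat.exists_eq_add_of_le h
      have hi : i ≤ r := by omega
      set c := ∏ l ∈ Finset.range i, u (r - l) with hc
      have s₀ : ∑ s ∈ Finset.range m₀, W₀ s * (monicOP b u (p + i)).eval (y₀ s)
          = κ₀ * c * ∑ s ∈ Finset.range m₀, W₀ s * (monicOP b u (r - i)).eval (y₀ s) := by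
        rw [Finset.mul_sum]
        refine Finset.sum_congr rfl fun s hs => ?_
        rw [(R₀ s (Finset.mem_range.mp hs)).1 i hi]
        ring
      have s₁ : ∑ s ∈ Finset.range m₁, W₁ s * (monicOP b u (p + i)).eval (y₁ s)
          = κ₁ * c * ∑ s ∈ Finset.range m₁, W₁ s * (monicOP b u (r - i)).eval (y₁ s) := by
        rw [Finset.mul_sum]
        refine Finset.sum_congr rfl fun s hs => ?_
        rw [(R₁ s (Finset.mem_range.mp hs)).1 i hi]
        ring
      -- Both halves now carry the same sum, with total coefficient a multiple of `(1 - α) κ₀ + α κ₁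
      -- = 0`. This works for `i = r` as well, where the common sum is `1` rather than `0`.
      rw [s₀, s₁, hδ (r - i) (by omega)]
      linear_combination
        (c * ∑ s ∈ Finset.range m₁, W₁ s * (monicOP b u (r - i)).eval (y₁ s)) * hκ
  · intro i hi
    rcases hy i hi with ⟨s, hs, e⟩ | ⟨s, hs, e⟩
    · rw [e]; exact (R₀ s hs).2
    · rw [e]; exact (R₁ s hs).2

theorem krawBOdd_mid (q Δ α : ℝ) (j : ℕ) :
    krawBOdd j q Δ α j = krawBOdd j q Δ 0 j - α * ((Δ - 1) * (1 - q ^ (j + 1)) / (1 - q)) := by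
  simp only [krawBOdd, if_true]
  ring

theorem krawBOdd_mid' (q Δ α : ℝ) (j : ℕ) :
    krawBOdd j q Δ α (j + 1)
      = krawBOdd j q Δ 0 j - (1 - α) * ((Δ - 1) * (1 - q ^ (j + 1)) / (1 - q)) := by
  simp only [krawBOdd, if_true]
  rw [if_neg (by omega)]
  ring

theorem krawUOdd_mid (q Δ α : ℝ) (j : ℕ) :
    krawUOdd j q Δ α (j + 1) = α * (1 - α) * ((Δ - 1) * (1 - q ^ (j + 1)) / (1 - q)) ^ 2 := by
  simp only [krawUOdd, if_true]
  rw [div_pow, mul_pow]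
  ring

theorem hahnBasis_one_eq_zero (q : ℝ) {k s : ℕ} (h : s < k) : hahnBasis 1 q k (q ^ s) = 0 := by
  have := hahnBasis_eq_zero 1 q h
  rwa [one_mul] at this

/-- Up to degree `j` the polynomials are free of `α`, and `α` enters `P_{j+1}` only through `b_j`,
linearly. So `P_{j+1}` is `∏ (y - Δ q^s) + ακ P_j`, and also `∏ (y - q^s) - (1 - α)κ P_j`. These are
the reflection relations for `p = j + 1`, `r = j`, with constants `ακ` and `-(1-α)κ`. -/
theorem orthogonality_odd {q Δ : ℝ} (hq₀ : 0 < q) (hq₁ : q < 1) (hΔ : 0 < Δ) (α : ℝ) (j : ℕ)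
    (h₁ : ∀ i ≤ j, Δ ≠ q ^ i) (h₂ : ∀ i ≤ j, Δ * q ^ i ≠ 1) :
    ∀ n ≤ 2 * j + 1, ∀ m ≤ 2 * j + 1,
      ∑ i ∈ Finset.range (2 * j + 2),
          (if Even i then krawWOddEven j q Δ α (i / 2) else krawWOddOdd j q Δ α (i / 2))
            * (monicOP (krawBOdd j q Δ α) (krawUOdd j q Δ α) n).eval (yLattice q Δ i)
            * (monicOP (krawBOdd j q Δ α) (krawUOdd j q Δ α) m).eval (yLattice q Δ i)
        = if n = m then ∏ k ∈ Finset.Icc 1 n, krawUOdd j q Δ α k else 0 := by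
  have hN : 2 * j + 1 = j + 1 + j := by ring
  rw [hN, show 2 * j + 2 = j + 1 + j + 1 by ring]
  set κ : ℝ := (Δ - 1) * (1 - q ^ (j + 1)) / (1 - q) with hκ
  have P₀ := hahnParam_odd_left hq₀ hq₁ h₁
  have P₁ := hahnParam_odd_right hq₀ hq₁ hΔ h₂
  have b₀ : ∀ n < j, krawBOdd j q Δ α n = _ := fun n hn =>
    krawBOdd_eq_left hq₀ hq₁ (Δ := Δ) α (j := j) (n := n) (by omega) (by omega)
  have b₁ : ∀ n < j, krawBOdd j q Δ α n = _ := fun n hn =>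
    krawBOdd_eq_right hq₀ hq₁ hΔ α (j := j) (n := n) (by omega) (by omega)
  have u₀ : ∀ n, n + 1 < j → krawUOdd j q Δ α (n + 1) = _ := fun n hn =>
    krawUOdd_eq_left hq₀ hq₁ (Δ := Δ) α (j := j) (n := n) (by omega)
  have u₁ : ∀ n, n + 1 < j → krawUOdd j q Δ α (n + 1) = _ := fun n hn =>
    krawUOdd_eq_right hq₀ hq₁ hΔ α (j := j) (n := n) (by omega)
  set b := krawBOdd j q Δ α with hbdef
  set u := krawUOdd j q Δ α with hudef
  have last₀ := P₀.eval_monicOP_last b u b₀ u₀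
  have last₁ := P₁.eval_monicOP_last b u b₁ u₁
  have hβ₀ := krawBOdd_last_left hq₀ hq₁ (Δ := Δ) j
  have hβ₁ := krawBOdd_last_right hq₀ hq₁ hΔ j
  rw [krawBOdd_mid, ← hκ, one_mul] at hβ₁
  have hbj : b j = krawBOdd j q Δ 0 j - α * κ := krawBOdd_mid q Δ α j
  have hbj' : b (j + 1) = krawBOdd j q Δ 0 j - (1 - α) * κ := krawBOdd_mid' q Δ α j
  have huj : u (j + 1) = α * (1 - α) * κ ^ 2 := krawUOdd_mid q Δ α j
  have next₀ : ∀ t, (monicOP b u (j + 1)).eval t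
      = hahnBasis Δ q (j + 1) t + α * κ * (monicOP b u j).eval t := by
    intro t
    rcases Nat.eq_zero_or_pos j with h | h
    · subst h
      have l := last₀ t
      rw [hahnCLast_zero, eval_monicOP_zero] at l
      rw [hahnCLast_zero] at hβ₀
      rw [zero_add, eval_monicOP_one, eval_monicOP_zero, hbj, hβ₀]
      linear_combination l
    · obtain ⟨k, rfl⟩ := Nat.exists_eq_add_of_le' h
      have l := last₀ t
      have hu' : u (k + 1) = _ := krawUOdd_last_left hq₀ hq₁ (Δ := Δ) α (j := k + 1) (by omega)
      rw [Nat.add_sub_cancel] at l hu'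
      rw [eval_monicOP_add_two, hbj, hu', hβ₀]
      linear_combination l
  have next₁ : ∀ t, (monicOP b u (j + 1)).eval t
      = hahnBasis 1 q (j + 1) t - (1 - α) * κ * (monicOP b u j).eval t := by
    intro t
    rcases Nat.eq_zero_or_pos j with h | h
    · subst h
      have l := last₁ t
      rw [hahnCLast_zero, eval_monicOP_zero] at l
      rw [hahnCLast_zero] at hβ₁
      rw [zero_add, eval_monicOP_one, eval_monicOP_zero, hbj]
      linear_combination l - hβ₁
    · obtain ⟨k, rfl⟩ := Nat.exists_eq_add_of_le' h
      have l := last₁ t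
      have hu' : u (k + 1) = _ := krawUOdd_last_right hq₀ hq₁ hΔ α (j := k + 1) (by omega)
      rw [Nat.add_sub_cancel] at l hu'
      rw [eval_monicOP_add_two, hbj, hu']
      linear_combination l - (monicOP b u (k + 1)).eval t * hβ₁
  have hW₀ : ∀ s < j, krawWOddEven j q Δ 0 (s + 1) * ((1 - q ^ (s + 1)) * (1 - Δ * q * q ^ s))
      = q * (1 - 1 / q ^ j * q ^ s) * (1 - Δ / q ^ j * q ^ s) * krawWOddEven j q Δ 0 s :=
    fun s hs => krawWOddEven_succ hq₀ hq₁ 0 (by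
      rw [mul_assoc, ← pow_succ']
      exact sub_ne_zero.mpr (h₂ _ (by omega)).symm)
  have hW₁ : ∀ s < j, krawWOddOdd j q Δ 1 (s + 1) * ((1 - q ^ (s + 1)) * (1 - q / Δ * q ^ s))
      = q * (1 - 1 / q ^ j * q ^ s) * (1 - 1 / (Δ * q ^ j) * q ^ s) * krawWOddOdd j q Δ 1 s := by
    intro s hs
    have := krawWOddEven_succ (Δ := 1 / Δ) (j := j) hq₀ hq₁ 0 (s := s) (by
      rw [mul_assoc, ← pow_succ', one_div_mul_eq_div, one_sub_div hΔ.ne']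
      exact div_ne_zero (sub_ne_zero.mpr (h₁ _ (by omega))) hΔ.ne')
    rw [krawWOddOdd_eq, krawWOddOdd_eq, sub_self, ← div_div, ← one_div_mul_eq_div Δ q]
    exact this
  have h₁' : ∀ i ≤ j, 1 / Δ ≠ q ^ i := fun i hi e =>
    h₂ i hi (by rw [← e, mul_one_div_cancel hΔ.ne'])
  have h₂' : ∀ i ≤ j, 1 / Δ * q ^ i ≠ 1 := fun i hi e =>
    h₁ i hi (by rw [one_div_mul_eq_div, div_eq_one_iff_eq hΔ.ne'] at e; exact e.symm)
  refine sum_monicOP_mul_of_glue b u (j + 1) j (j + 1) (j + 1) le_rfl _ (yLattice q Δ)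
    (krawWOddEven j q Δ 0) (krawWOddOdd j q Δ 1) (fun s => Δ * q ^ s) (fun s => q ^ s) α
    (α * κ) (-((1 - α) * κ)) (by ring)
    (fun i hi hij => krawBOdd_reflect hq₀ Δ α hi hij)
    (fun i hi hij => krawUOdd_reflect hq₀ hq₁ Δ α hi hij) ?_ ?_ ?_ ?_ ?_ ?_
    (sum_krawWOddEven hq₀ hq₁ hΔ h₁ h₂) ?_ ?_ ?_
  · intro f
    rw [show j + 1 + j + 1 = 2 * (j + 1) by ring, sum_range_two_mul, Finset.mul_sum,
      Finset.mul_sum]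
    congr 1
    · refine Finset.sum_congr rfl fun s _ => ?_
      rw [yLattice, if_pos (even_two_mul s), if_pos (even_two_mul s),
        Nat.mul_div_cancel_left s two_pos, krawWOddEven, krawWOddEven]
      ring
    · refine Finset.sum_congr rfl fun s _ => ?_
      rw [yLattice, if_neg (by simp), if_neg (by simp), show (2 * s + 1) / 2 = s by omega,
        krawWOddOdd, krawWOddOdd]
      ring
  · intro i hi
    rw [yLattice]
    split_ifs with h
    · exact Or.inl ⟨i / 2, by omega, rfl⟩
    · exact Or.inr ⟨i / 2, by omega, rfl⟩
  · intro s hs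
    rw [next₀, hahnBasis_eq_zero Δ q hs, zero_add]
  -- The second reflection relation: the values of `b_{j+1}` and `u_{j+1}` are such that the
  -- recurrence sends `P_{j+1} = ακ P_j` to the mirrored expression. The same happens below on the
  -- other lattice.
  · intro s hs
    rw [eval_monicOP_add_two, next₀, hahnBasis_eq_zero Δ q hs, hbj', huj, hbj]
    ring
  · intro s hs
    rw [next₁, hahnBasis_one_eq_zero q hs]
    ring
  · intro s hs
    rw [eval_monicOP_add_two, next₁, hahnBasis_one_eq_zero q hs, hbj', huj, hbj]
    ring
  · exact (Finset.sum_congr rfl fun s _ => by rw [krawWOddOdd_eq, sub_self]).trans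
      (sum_krawWOddEven (Δ := 1 / Δ) (j := j) hq₀ hq₁ (by positivity) h₁' h₂')
  · intro n hn hnj
    exact P₀.sum_mul_monicOP hΔ.ne' (by positivity) (by field_simp) (by ring) hW₀ b u b₀ u₀ hn
      (by omega)
  · intro n hn hnj
    have := P₁.sum_mul_monicOP (Y := q / Δ) one_ne_zero (by positivity) (by field_simp)
      (by field_simp) hW₁ b u b₁ u₁ hn (by omega)
    simpa only [one_mul] using this

theorem krawUEven_mid (q Δ α : ℝ) (j : ℕ) :
    krawUEven j q Δ α j = (1 - α) * krawUEven j q Δ 0 j := by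
  simp only [krawUEven, if_true]
  ring

theorem krawUEven_mid' (q Δ α : ℝ) (j : ℕ) :
    krawUEven j q Δ α (j + 1) = α * krawUEven j q Δ 0 j := by
  simp only [krawUEven, if_true]
  rw [if_neg (by omega)]
  ring

/-- With `j = r + 1`, the polynomial `P_j` is `∏ (y - q^s)`, and `P_{j+1}` is `∏ (y - Δ q^s) + ακ
P_{j-1}`, where `κ` is `u_j` at `α = 0`. At the points `q^s`, where `P_j` vanishes, the recurrence
gives `P_{j+1} = -(1-α)κ P_{j-1}`. So the reflection joins `p = j + 1` to `r = j - 1`, with `P_j`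
its own mirror image. -/
theorem orthogonality_even {q Δ : ℝ} (hq₀ : 0 < q) (hq₁ : q < 1) (hΔ : 0 < Δ) (α : ℝ) (r : ℕ)
    (h₁ : ∀ i ≤ r + 1, Δ ≠ q ^ i) (h₂ : ∀ i ≤ r + 2, Δ * q ^ i ≠ 1) :
    ∀ n ≤ 2 * (r + 1), ∀ m ≤ 2 * (r + 1),
      ∑ i ∈ Finset.range (2 * (r + 1) + 1),
          (if Even i then krawWEvenEven (r + 1) q Δ α (i / 2)
            else krawWEvenOdd (r + 1) q Δ α (i / 2))
            * (monicOP (krawBEven (r + 1) q Δ) (krawUEven (r + 1) q Δ α) n).eval (yLattice q Δ i)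
            * (monicOP (krawBEven (r + 1) q Δ) (krawUEven (r + 1) q Δ α) m).eval (yLattice q Δ i)
        = if n = m then ∏ k ∈ Finset.Icc 1 n, krawUEven (r + 1) q Δ α k else 0 := by
  have hN : 2 * (r + 1) = r + 1 + 1 + r := by ring
  rw [hN]
  set κ : ℝ := krawUEven (r + 1) q Δ 0 (r + 1) with hκ
  have P₀ := hahnParam_even_left hq₀ hq₁ h₁
  have P₁ := hahnParam_even_right hq₀ hq₁ hΔ r h₂
  have b₀ : ∀ n < r + 1, krawBEven (r + 1) q Δ n = _ := fun n hn =>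
    krawBEven_eq_left hq₀ hq₁ (Δ := Δ) (j := r + 1) (n := n) (by omega)
  have b₁ : ∀ n < r, krawBEven (r + 1) q Δ n = _ := fun n hn =>
    krawBEven_eq_right hq₀ hq₁ hΔ (j := r + 1) (n := n) (by omega)
  have u₀ : ∀ n, n + 1 < r + 1 → krawUEven (r + 1) q Δ α (n + 1) = _ := fun n hn =>
    krawUEven_eq_left hq₀ hq₁ (Δ := Δ) α (j := r + 1) (n := n) (by omega) (by omega)
  have u₁ : ∀ n, n + 1 < r → krawUEven (r + 1) q Δ α (n + 1) = _ := fun n hn =>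
    krawUEven_eq_right hq₀ hq₁ hΔ α (j := r + 1) (n := n) (by omega) (by omega)
  set b := krawBEven (r + 1) q Δ with hbdef
  set u := krawUEven (r + 1) q Δ α with hudef
  have last₀ := P₀.eval_monicOP_last b u b₀ u₀
  have last₁ := P₁.eval_monicOP_last b u b₁ u₁
  have huj : u (r + 1) = (1 - α) * κ := krawUEven_mid q Δ α (r + 1)
  have huj' : u (r + 1 + 1) = α * κ := krawUEven_mid' q Δ α (r + 1)
  have hbj : b (r + 1 + 1) = b r := krawBEven_reflect hq₀ hq₁ Δ (j := r + 1) (i := 1) (by omega)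
  have mid : ∀ t, (monicOP b u (r + 1)).eval t = hahnBasis 1 q (r + 1) t := by
    intro t
    have hβ : b r = _ := krawBEven_last_right hq₀ hq₁ hΔ r
    have l := last₁ t
    rcases Nat.eq_zero_or_pos r with h | h
    · subst h
      rw [hahnCLast_zero, eval_monicOP_zero] at l
      rw [hahnCLast_zero] at hβ
      rw [zero_add, eval_monicOP_one, hβ]
      linear_combination l
    · obtain ⟨k, rfl⟩ := Nat.exists_eq_add_of_le' h
      have hu' : u (k + 1) = _ := krawUEven_last_right hq₀ hq₁ hΔ α (m := k + 1) (by omega)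
      rw [Nat.add_sub_cancel] at l hu'
      rw [eval_monicOP_add_two, hβ, hu']
      linear_combination l
  have next : ∀ t, (monicOP b u (r + 2)).eval t
      = hahnBasis Δ q (r + 2) t + α * κ * (monicOP b u r).eval t := by
    intro t
    have hβ : b (r + 1) = _ := krawBEven_last_left hq₀ hq₁ (Δ := Δ) (r + 1)
    have hu' : κ = _ := krawUEven_last_left hq₀ hq₁ (Δ := Δ) (j := r + 1) (by omega)
    have l := last₀ t
    rw [Nat.add_sub_cancel] at l hu'
    rw [← hu'] at l
    rw [eval_monicOP_add_two, huj, hβ]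
    linear_combination l
  have hW₀ : ∀ s < r + 1, krawWEvenEven (r + 1) q Δ 0 (s + 1)
        * ((1 - q ^ (s + 1)) * (1 - Δ * q * q ^ s))
      = q * (1 - 1 / q ^ (r + 1) * q ^ s) * (1 - Δ * q / q ^ (r + 1) * q ^ s)
        * krawWEvenEven (r + 1) q Δ 0 s :=
    fun s hs => krawWEvenEven_succ hq₀ hq₁ 0 (by
      rw [mul_assoc, ← pow_succ']
      exact sub_ne_zero.mpr (h₂ _ (by omega)).symm)
  have hW₁ : ∀ s < r, krawWEvenOdd (r + 1) q Δ 1 (s + 1)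
        * ((1 - q ^ (s + 1)) * (1 - q / Δ * q ^ s))
      = q * (1 - q / q ^ (r + 1) * q ^ s) * (1 - 1 / (Δ * q ^ (r + 1)) * q ^ s)
        * krawWEvenOdd (r + 1) q Δ 1 s :=
    fun s hs => krawWEvenOdd_succ hq₀ hq₁ hΔ 1 (by
      rw [div_mul_eq_mul_div, ← pow_succ', one_sub_div hΔ.ne']
      exact div_ne_zero (sub_ne_zero.mpr (h₁ _ (by omega))) hΔ.ne')
  refine sum_monicOP_mul_of_glue b u (r + 1 + 1) r (r + 2) (r + 1) (by omega) _ (yLattice q Δ)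
    (krawWEvenEven (r + 1) q Δ 0) (krawWEvenOdd (r + 1) q Δ 1) (fun s => Δ * q ^ s)
    (fun s => q ^ s) α (α * κ) (-((1 - α) * κ)) (by ring) ?_ ?_ ?_ ?_ ?_ ?_ ?_ ?_
    (sum_krawWEvenEven hq₀ hq₁ hΔ (by omega) h₁ h₂) (sum_krawWEvenOdd hq₀ hq₁ hΔ r h₁ h₂) ?_ ?_
  · intro i hi hij
    have := krawBEven_reflect hq₀ hq₁ Δ (j := r + 1) (i := 1 + i) (by omega)
    rw [← add_assoc, show r + 1 - (1 + i) = r - i by omega] at this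
    exact this
  · intro i hi hij
    exact krawUEven_reflect hq₀ hq₁ Δ α hi (by omega)
  · intro f
    rw [show r + 1 + 1 + r + 1 = 2 * (r + 1) + 1 by ring, Finset.sum_range_succ, sum_range_two_mul,
      add_right_comm, Finset.sum_range_succ _ (r + 1), mul_add (1 - α), Finset.mul_sum,
      Finset.mul_sum]
    congr 1
    · congr 1
      · refine Finset.sum_congr rfl fun s _ => ?_
        rw [yLattice, if_pos (even_two_mul s), if_pos (even_two_mul s),
          Nat.mul_div_cancel_left s two_pos, krawWEvenEven, krawWEvenEven]
        ring
      · rw [yLattice, if_pos (even_two_mul _), if_pos (even_two_mul _),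
          Nat.mul_div_cancel_left _ two_pos, krawWEvenEven, krawWEvenEven]
        ring
    · refine Finset.sum_congr rfl fun s _ => ?_
      rw [yLattice, if_neg (by simp), if_neg (by simp), show (2 * s + 1) / 2 = s by omega,
        krawWEvenOdd, krawWEvenOdd]
      ring
  · intro i hi
    rw [yLattice]
    split_ifs with h
    · exact Or.inl ⟨i / 2, by omega, rfl⟩
    · rw [Nat.not_even_iff] at h
      exact Or.inr ⟨i / 2, by omega, rfl⟩
  · intro s hs
    rw [next, hahnBasis_eq_zero Δ q hs, zero_add]
  · intro s hs
    rw [eval_monicOP_add_two, next, hahnBasis_eq_zero Δ q hs, hbj, huj']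
    ring
  · intro s hs
    rw [eval_monicOP_add_two, mid, hahnBasis_one_eq_zero q hs, huj]
    ring
  · intro s hs
    rw [eval_monicOP_add_two, eval_monicOP_add_two, mid, hahnBasis_one_eq_zero q hs, huj, hbj]
    ring
  · intro n hn hnj
    exact P₀.sum_mul_monicOP hΔ.ne' (by positivity) (by field_simp) (by ring) hW₀ b u b₀ u₀ hn
      (by omega)
  · intro n hn hnj
    -- Degree `j = r + 1` is beyond the `q`-Hahn family on the `j` points `q^s`, but the polynomial
    -- of that degree vanishes at all of them.
    rcases Nat.lt_or_ge r n with h | h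
    · obtain rfl : n = r + 1 := by omega
      refine Finset.sum_eq_zero fun s hs => ?_
      rw [mid, hahnBasis_one_eq_zero q (Finset.mem_range.mp hs), mul_zero]
    have := P₁.sum_mul_monicOP (Y := q / Δ) one_ne_zero (by positivity) (by field_simp)
      (by field_simp) hW₁ b u b₁ u₁ hn h
    simpa only [one_mul] using this

/-! ### The limit `t → 0` -/

theorem rpow_trunc {q : ℝ} (hq₀ : 0 < q) (j : ℕ) (x : ℝ) :
    q ^ (-(j : ℝ) + x) = 1 / q ^ j * q ^ x := by
  rw [Real.rpow_add hq₀, Real.rpow_neg hq₀.le, Real.rpow_natCast, one_div]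

/-- Isolates the dependence on `t`: with `ab = r E₁` and `cd = s E₂`, the denominators see `t` only
through `abcd = r s E₁ E₂`. -/
theorem awA_trunc {q a c : ℝ} (hq : q ≠ 0) (ha : a ≠ 0) (hc : c ≠ 0) (r s E₁ E₂ : ℝ) (n : ℕ) :
    awA a (a⁻¹ * (r * E₁)) c (c⁻¹ * (s * E₂)) q n
      = (1 - r * E₁ * q ^ n) * (1 - a * c * q ^ n) * (1 - a / c * s * E₂ * q ^ n)
          * (1 - r * s * (E₁ * E₂) * (q ^ n / q))
        / (a * (1 - r * s * (E₁ * E₂) * ((q ^ n) ^ 2 / q))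
          * (1 - r * s * (E₁ * E₂) * (q ^ n) ^ 2)) := by
  have z1 : q ^ ((n : ℤ) - 1) = q ^ n / q := by rw [zpow_sub₀ hq, zpow_natCast, zpow_one]
  have z2 : q ^ (2 * (n : ℤ)) = (q ^ n) ^ 2 := by
    rw [mul_comm, zpow_mul, zpow_natCast]; rfl
  have z3 : q ^ (2 * (n : ℤ) - 1) = (q ^ n) ^ 2 / q := by rw [zpow_sub₀ hq, z2, zpow_one]
  have h1 : a * (a⁻¹ * (r * E₁)) = r * E₁ := by field_simp
  have h2 : a * (c⁻¹ * (s * E₂)) = a / c * s * E₂ := by field_simp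
  have h3 : a * (a⁻¹ * (r * E₁)) * c * (c⁻¹ * (s * E₂)) = r * s * (E₁ * E₂) := by field_simp
  rw [awA, z1, z2, z3, h3, h1, h2, zpow_natCast]

theorem awC_trunc {q a c : ℝ} (hq : q ≠ 0) (ha : a ≠ 0) (hc : c ≠ 0) (r s E₁ E₂ : ℝ) (n : ℕ) :
    awC a (a⁻¹ * (r * E₁)) c (c⁻¹ * (s * E₂)) q n
      = a * (1 - q ^ n) * (1 - c / a * r * E₁ * (q ^ n / q))
          * (1 - r * s * (E₁ * E₂) / (a * c) * (q ^ n / q)) * (1 - s * E₂ * (q ^ n / q))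
        / ((1 - r * s * (E₁ * E₂) * ((q ^ n) ^ 2 / q ^ 2))
          * (1 - r * s * (E₁ * E₂) * ((q ^ n) ^ 2 / q))) := by
  have z1 : q ^ ((n : ℤ) - 1) = q ^ n / q := by rw [zpow_sub₀ hq, zpow_natCast, zpow_one]
  have z2 : q ^ (2 * (n : ℤ)) = (q ^ n) ^ 2 := by
    rw [mul_comm, zpow_mul, zpow_natCast]; rfl
  have z3 : q ^ (2 * (n : ℤ) - 1) = (q ^ n) ^ 2 / q := by rw [zpow_sub₀ hq, z2, zpow_one]
  have z4 : q ^ (2 * (n : ℤ) - 2) = (q ^ n) ^ 2 / q ^ 2 := by rw [zpow_sub₀ hq, z2]; rfl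
  have h1 : a⁻¹ * (r * E₁) * c = c / a * r * E₁ := by field_simp
  have h2 : a⁻¹ * (r * E₁) * (c⁻¹ * (s * E₂)) = r * s * (E₁ * E₂) / (a * c) := by field_simp
  have h3 : a * (a⁻¹ * (r * E₁)) * c * (c⁻¹ * (s * E₂)) = r * s * (E₁ * E₂) := by field_simp
  have h4 : c * (c⁻¹ * (s * E₂)) = s * E₂ := by field_simp
  rw [awC, z1, z3, z4, h3, h1, h2, h4, zpow_natCast]

/-- Numerator and denominator vanish to first order with slopes `-e log q` and `-f log q`. This
quotient is the source of `α`. -/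
theorem tendsto_one_sub_rpow_div {q : ℝ} (hq₀ : 0 < q) (hq₁ : q < 1) (e f : ℝ) (hf : f ≠ 0) :
    Tendsto (fun t : ℝ => (1 - q ^ (e * t)) / (1 - q ^ (f * t))) (𝓝[≠] 0) (𝓝 (e / f)) := by
  have hlog : Real.log q ≠ 0 := (Real.log_neg hq₀ hq₁).ne
  have key : ∀ g : ℝ, Tendsto (fun t : ℝ => (q ^ (g * t) - 1) / t) (𝓝[≠] 0)
      (𝓝 (g * Real.log q)) := by
    intro g
    have h1 : HasDerivAt (fun t : ℝ => q ^ (g * t)) (g * Real.log q) 0 := by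
      have h2 : HasDerivAt (fun t : ℝ => g * t) g 0 := by
        simpa using (hasDerivAt_id (0 : ℝ)).const_mul g
      have := h2.const_rpow hq₀
      simpa [mul_comm] using this
    have h3 := h1.tendsto_slope
    refine h3.congr fun t => ?_
    rw [slope_def_field]
    simp
  have h := (key e).div (key f) (mul_ne_zero hf hlog)
  rw [mul_div_mul_right _ _ hlog] at h
  refine h.congr' ?_
  filter_upwards [self_mem_nhdsWithin] with t ht
  rw [Pi.div_apply, div_div_div_cancel_right₀ ht, ← neg_sub, ← neg_sub 1, neg_div_neg_eq]

theorem tendsto_rpow_mul {q : ℝ} (hq₀ : 0 < q) (e : ℝ) :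
    Tendsto (fun t : ℝ => q ^ (e * t)) (𝓝[≠] 0) (𝓝 1) := by
  have h : ContinuousAt (fun t : ℝ => q ^ (e * t)) 0 :=
    continuousAt_const.rpow (by fun_prop) (Or.inl hq₀.ne')
  have h2 := h.tendsto
  simp only [mul_zero, Real.rpow_zero] at h2
  exact h2.mono_left nhdsWithin_le_nhds

/-! ### Limits of `A_n` and `C_n` at indices where no denominator vanishes. -/

section

variable {q a c r s : ℝ} {E₁ E₂ : ℝ → ℝ} {l : Filter ℝ}

theorem tendsto_awA (hq : q ≠ 0) (ha : a ≠ 0) (hc : c ≠ 0) (h₁ : Tendsto E₁ l (𝓝 1))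
    (h₂ : Tendsto E₂ l (𝓝 1)) {n : ℕ} (d₁ : 1 - r * s * ((q ^ n) ^ 2 / q) ≠ 0)
    (d₂ : 1 - r * s * (q ^ n) ^ 2 ≠ 0) :
    Tendsto (fun t => awA a (a⁻¹ * (r * E₁ t)) c (c⁻¹ * (s * E₂ t)) q n) l
      (𝓝 ((1 - r * q ^ n) * (1 - a * c * q ^ n) * (1 - a / c * s * q ^ n)
          * (1 - r * s * (q ^ n / q))
        / (a * (1 - r * s * ((q ^ n) ^ 2 / q)) * (1 - r * s * (q ^ n) ^ 2)))) := by
  simp only [awA_trunc hq ha hc]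
  have hF : ContinuousAt (fun E : ℝ × ℝ =>
      (1 - r * E.1 * q ^ n) * (1 - a * c * q ^ n) * (1 - a / c * s * E.2 * q ^ n)
          * (1 - r * s * (E.1 * E.2) * (q ^ n / q))
        / (a * (1 - r * s * (E.1 * E.2) * ((q ^ n) ^ 2 / q))
          * (1 - r * s * (E.1 * E.2) * (q ^ n) ^ 2))) (1, 1) := by
    refine ContinuousAt.div (by fun_prop) (by fun_prop) ?_
    simp only [mul_one]
    exact mul_ne_zero (mul_ne_zero ha d₁) d₂
  have := hF.tendsto.comp (h₁.prodMk_nhds h₂)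
  simpa only [mul_one, Function.comp_def] using this

theorem tendsto_awC (hq : q ≠ 0) (ha : a ≠ 0) (hc : c ≠ 0) (h₁ : Tendsto E₁ l (𝓝 1))
    (h₂ : Tendsto E₂ l (𝓝 1)) {n : ℕ} (d₁ : 1 - r * s * ((q ^ n) ^ 2 / q ^ 2) ≠ 0)
    (d₂ : 1 - r * s * ((q ^ n) ^ 2 / q) ≠ 0) :
    Tendsto (fun t => awC a (a⁻¹ * (r * E₁ t)) c (c⁻¹ * (s * E₂ t)) q n) l
      (𝓝 (a * (1 - q ^ n) * (1 - c / a * r * (q ^ n / q))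
          * (1 - r * s / (a * c) * (q ^ n / q)) * (1 - s * (q ^ n / q))
        / ((1 - r * s * ((q ^ n) ^ 2 / q ^ 2)) * (1 - r * s * ((q ^ n) ^ 2 / q))))) := by
  simp only [awC_trunc hq ha hc]
  have hF : ContinuousAt (fun E : ℝ × ℝ =>
      a * (1 - q ^ n) * (1 - c / a * r * E.1 * (q ^ n / q))
          * (1 - r * s * (E.1 * E.2) / (a * c) * (q ^ n / q)) * (1 - s * E.2 * (q ^ n / q))
        / ((1 - r * s * (E.1 * E.2) * ((q ^ n) ^ 2 / q ^ 2))
          * (1 - r * s * (E.1 * E.2) * ((q ^ n) ^ 2 / q)))) (1, 1) := by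
    refine ContinuousAt.div (by fun_prop) (by fun_prop) ?_
    simp only [mul_one]
    exact mul_ne_zero d₁ d₂
  have := hF.tendsto.comp (h₁.prodMk_nhds h₂)
  simpa only [mul_one, Function.comp_def] using this

end

/-! ### Limits of `A_n` and `C_n` at the singular indices. -/

section

variable {q a c r s α : ℝ} {E₁ E₂ : ℝ → ℝ} {l : Filter ℝ}

/-- The factor `1 - ab q^n` and the right-hand denominator factor `1 - abcd q^(2n)` become `1 - E₁`
and `1 - E₁E₂`; everything else is continuous. The suffixes `left` and `right` tell which
denominator factor degenerates. The parity of `N` decides: for `A_n` it is the right one when `N` is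
odd, for `C_n` the left one, and conversely when `N` is even. -/
theorem tendsto_awA_of_right (hq : q ≠ 0) (ha : a ≠ 0) (hc : c ≠ 0) (h₁ : Tendsto E₁ l (𝓝 1))
    (h₂ : Tendsto E₂ l (𝓝 1))
    (hα : Tendsto (fun t => (1 - E₁ t) / (1 - E₁ t * E₂ t)) l (𝓝 α)) {n : ℕ}
    (e₁ : r * q ^ n = 1) (e₂ : r * s * (q ^ n) ^ 2 = 1) (d : 1 - r * s * ((q ^ n) ^ 2 / q) ≠ 0) :
    Tendsto (fun t => awA a (a⁻¹ * (r * E₁ t)) c (c⁻¹ * (s * E₂ t)) q n) l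
      (𝓝 (α * ((1 - a * c * q ^ n) * (1 - a / c * s * q ^ n) * (1 - r * s * (q ^ n / q))
        / (a * (1 - r * s * ((q ^ n) ^ 2 / q)))))) := by
  simp only [awA_trunc hq ha hc]
  have hF : ContinuousAt (fun E : ℝ × ℝ => (1 - a * c * q ^ n) * (1 - a / c * s * E.2 * q ^ n) * (1 - r * s * (E.1 * E.2) * (q ^ n / q))
      / (a * (1 - r * s * (E.1 * E.2) * ((q ^ n) ^ 2 / q)))) (1, 1) := by
    refine ContinuousAt.div (by fun_prop) (by fun_prop) ?_
    simp only [mul_one]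
    exact mul_ne_zero ha d
  have h := hα.mul (hF.tendsto.comp (h₁.prodMk_nhds h₂))
  simp only [mul_one, Function.comp_def] at h
  refine h.congr fun t => ?_
  rw [show r * E₁ t * q ^ n = E₁ t by rw [mul_right_comm, e₁, one_mul],
    show r * s * (E₁ t * E₂ t) * (q ^ n) ^ 2 = E₁ t * E₂ t by rw [mul_right_comm, e₂, one_mul],
    div_mul_div_comm, mul_comm (1 - E₁ t * E₂ t)]
  simp only [← mul_assoc]

theorem tendsto_awA_of_left (hq : q ≠ 0) (ha : a ≠ 0) (hc : c ≠ 0) (h₁ : Tendsto E₁ l (𝓝 1))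
    (h₂ : Tendsto E₂ l (𝓝 1))
    (hα : Tendsto (fun t => (1 - E₁ t) / (1 - E₁ t * E₂ t)) l (𝓝 α)) {n : ℕ}
    (e₁ : r * q ^ n = 1) (e₂ : r * s * ((q ^ n) ^ 2 / q) = 1) (d : 1 - r * s * (q ^ n) ^ 2 ≠ 0) :
    Tendsto (fun t => awA a (a⁻¹ * (r * E₁ t)) c (c⁻¹ * (s * E₂ t)) q n) l
      (𝓝 (α * ((1 - a * c * q ^ n) * (1 - a / c * s * q ^ n) * (1 - r * s * (q ^ n / q))
        / (a * (1 - r * s * (q ^ n) ^ 2))))) := by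
  simp only [awA_trunc hq ha hc]
  have hF : ContinuousAt (fun E : ℝ × ℝ => (1 - a * c * q ^ n) * (1 - a / c * s * E.2 * q ^ n) * (1 - r * s * (E.1 * E.2) * (q ^ n / q))
      / (a * (1 - r * s * (E.1 * E.2) * (q ^ n) ^ 2))) (1, 1) := by
    refine ContinuousAt.div (by fun_prop) (by fun_prop) ?_
    simp only [mul_one]
    exact mul_ne_zero ha d
  have h := hα.mul (hF.tendsto.comp (h₁.prodMk_nhds h₂))
  simp only [mul_one, Function.comp_def] at h
  refine h.congr fun t => ?_
  rw [show r * E₁ t * q ^ n = E₁ t by rw [mul_right_comm, e₁, one_mul],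
    show r * s * (E₁ t * E₂ t) * ((q ^ n) ^ 2 / q) = E₁ t * E₂ t by
      rw [mul_right_comm, e₂, one_mul],
    div_mul_div_comm, mul_left_comm (1 - E₁ t * E₂ t)]
  simp only [← mul_assoc]

theorem tendsto_awC_of_left (hq : q ≠ 0) (ha : a ≠ 0) (hc : c ≠ 0) (h₁ : Tendsto E₁ l (𝓝 1))
    (h₂ : Tendsto E₂ l (𝓝 1))
    (hα : Tendsto (fun t => (1 - E₂ t) / (1 - E₁ t * E₂ t)) l (𝓝 α)) {n : ℕ}
    (e₁ : s * (q ^ n / q) = 1) (e₂ : r * s * ((q ^ n) ^ 2 / q ^ 2) = 1) (d : 1 - r * s * ((q ^ n) ^ 2 / q) ≠ 0) :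
    Tendsto (fun t => awC a (a⁻¹ * (r * E₁ t)) c (c⁻¹ * (s * E₂ t)) q n) l
      (𝓝 (α * (a * (1 - q ^ n) * (1 - c / a * r * (q ^ n / q))
          * (1 - r * s / (a * c) * (q ^ n / q))
        / (1 - r * s * ((q ^ n) ^ 2 / q))))) := by
  simp only [awC_trunc hq ha hc]
  have hF : ContinuousAt (fun E : ℝ × ℝ => a * (1 - q ^ n) * (1 - c / a * r * E.1 * (q ^ n / q))
          * (1 - r * s * (E.1 * E.2) / (a * c) * (q ^ n / q))
      / (1 - r * s * (E.1 * E.2) * ((q ^ n) ^ 2 / q))) (1, 1) := by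
    refine ContinuousAt.div (by fun_prop) (by fun_prop) ?_
    simp only [mul_one]
    exact d
  have h := hα.mul (hF.tendsto.comp (h₁.prodMk_nhds h₂))
  simp only [mul_one, Function.comp_def] at h
  refine h.congr fun t => ?_
  rw [show s * E₂ t * (q ^ n / q) = E₂ t by rw [mul_right_comm, e₁, one_mul],
    show r * s * (E₁ t * E₂ t) * ((q ^ n) ^ 2 / q ^ 2) = E₁ t * E₂ t by
      rw [mul_right_comm, e₂, one_mul],
    div_mul_div_comm, mul_comm (1 - E₂ t)]

theorem tendsto_awC_of_right (hq : q ≠ 0) (ha : a ≠ 0) (hc : c ≠ 0) (h₁ : Tendsto E₁ l (𝓝 1))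
    (h₂ : Tendsto E₂ l (𝓝 1))
    (hα : Tendsto (fun t => (1 - E₂ t) / (1 - E₁ t * E₂ t)) l (𝓝 α)) {n : ℕ}
    (e₁ : s * (q ^ n / q) = 1) (e₂ : r * s * ((q ^ n) ^ 2 / q) = 1) (d : 1 - r * s * ((q ^ n) ^ 2 / q ^ 2) ≠ 0) :
    Tendsto (fun t => awC a (a⁻¹ * (r * E₁ t)) c (c⁻¹ * (s * E₂ t)) q n) l
      (𝓝 (α * (a * (1 - q ^ n) * (1 - c / a * r * (q ^ n / q))
          * (1 - r * s / (a * c) * (q ^ n / q))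
        / (1 - r * s * ((q ^ n) ^ 2 / q ^ 2))))) := by
  simp only [awC_trunc hq ha hc]
  have hF : ContinuousAt (fun E : ℝ × ℝ => a * (1 - q ^ n) * (1 - c / a * r * E.1 * (q ^ n / q))
          * (1 - r * s * (E.1 * E.2) / (a * c) * (q ^ n / q))
      / (1 - r * s * (E.1 * E.2) * ((q ^ n) ^ 2 / q ^ 2))) (1, 1) := by
    refine ContinuousAt.div (by fun_prop) (by fun_prop) ?_
    simp only [mul_one]
    exact d
  have h := hα.mul (hF.tendsto.comp (h₁.prodMk_nhds h₂))
  simp only [mul_one, Function.comp_def] at h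
  refine h.congr fun t => ?_
  rw [show s * E₂ t * (q ^ n / q) = E₂ t by rw [mul_right_comm, e₁, one_mul],
    show r * s * (E₁ t * E₂ t) * ((q ^ n) ^ 2 / q) = E₁ t * E₂ t by
      rw [mul_right_comm, e₂, one_mul],
    div_mul_div_comm, mul_comm (1 - E₂ t), mul_comm (1 - E₁ t * E₂ t)]

end

/-- The rescaled limit of the Askey-Wilson coefficient `A_n`. -/
def krawLimA (N : ℕ) (q Δ α : ℝ) (n : ℕ) : ℝ :=
  if Odd N then
    if n = N / 2 then -(α * (1 - Δ) * (1 - q ^ (N / 2 + 1)) / (1 - q))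
    else hahnA q 1 (1 / q ^ (N / 2)) (Δ / q ^ (N / 2)) (1 / ((q ^ (N / 2)) ^ 2 * q)) n
  else
    if n = N / 2 then α * (1 - Δ * q) * (1 - q ^ (N / 2)) / (1 - q)
    else hahnA q 1 (1 / q ^ (N / 2)) (Δ * q / q ^ (N / 2)) (1 / (q ^ (N / 2)) ^ 2) n

/-- The rescaled limit of the Askey-Wilson coefficient `C_n`. -/
def krawLimC (N : ℕ) (q Δ α : ℝ) (n : ℕ) : ℝ :=
  if Odd N then
    if n = N / 2 + 1 then (1 - α) * (1 - q ^ (N / 2 + 1)) * (Δ - 1) / (1 - q)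
    else hahnC q 1 (1 / q ^ (N / 2)) (Δ / q ^ (N / 2)) (1 / ((q ^ (N / 2)) ^ 2 * q)) n
  else
    if n = N / 2 then -((1 - α) * (1 - q ^ (N / 2)) * (Δ * q - 1) / (1 - q))
    else hahnC q 1 (1 / q ^ (N / 2)) (Δ * q / q ^ (N / 2)) (1 / (q ^ (N / 2)) ^ 2) n

/-- Away from the singular indices this is the `q`-Hahn form of the coefficients. At a singular
index one of the two limits carries `α` or `1 - α` (for even `N` both do, and `α` cancels). -/
theorem krawB_eq {q : ℝ} (hq₀ : 0 < q) (hq₁ : q < 1) (N : ℕ) (Δ α : ℝ) (n : ℕ) :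
    krawB N q Δ α n = Δ - krawLimA N q Δ α n - krawLimC N q Δ α n := by
  have h1 : 1 - q ≠ 0 := by linarith
  have h2 : 1 + q ≠ 0 := by linarith
  have h3 : 1 - q ^ 2 = (1 - q) * (1 + q) := by ring
  rw [krawB, krawLimA, krawLimC]
  generalize N / 2 = j
  have hw : 0 < q ^ j := pow_pos hq₀ j
  split_ifs with hN h h' h' h
  · omega
  · subst h
    have e1 : 1 - 1 / ((q ^ n) ^ 2 * q) * (q ^ n) ^ 2 = -(1 - q) / q := by
      field_simp
      ring
    have e2 : q - 1 / ((q ^ n) ^ 2 * q) * (q ^ n) ^ 2 = -((1 - q) * (1 + q)) / q := by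
      field_simp
      ring
    simp only [krawBOdd, hahnC, if_true]
    rw [pow_mul' q 2 n, e1, e2, h3, pow_succ]
    generalize q ^ n = w at *
    field_simp
    ring
  · subst h'
    have h4 : 1 - q ^ 3 ≠ 0 := by
      have : q ^ 3 < 1 := pow_lt_one₀ hq₀.le hq₁ (by norm_num)
      linarith
    simp only [krawBOdd, hahnA, if_true]
    rw [if_neg (by omega), h3]
    simp only [pow_add, pow_mul', pow_one, mul_pow]
    have e1 : 1 - 1 / ((q ^ j) ^ 2 * q) * ((q ^ j) ^ 2 * q ^ 2) = 1 - q := by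
      field_simp
    have e2 : 1 - 1 / ((q ^ j) ^ 2 * q) * ((q ^ j) ^ 2 * q ^ 2 * q) = (1 - q) * (1 + q) := by
      field_simp
      ring
    rw [e1, e2]
    generalize q ^ j = w at *
    field_simp
    ring
  · exact krawBOdd_eq_left hq₀ hq₁ α h h'
  · subst h
    simp only [krawBEven]
    simp only [pow_add, pow_mul', pow_one]
    generalize q ^ n = w at *
    have e3 : w ^ 2 * q - w ^ 2 = -w ^ 2 * (1 - q) := by ring
    have e4 : w ^ 2 - w ^ 2 * q = w ^ 2 * (1 - q) := by ring
    have e5 : w + w = 2 * w := by ring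
    rw [e3, e4, e5]
    field_simp
    ring
  · exact krawBEven_eq_left hq₀ hq₁ h

theorem krawU_eq {q : ℝ} (hq₀ : 0 < q) (hq₁ : q < 1) (N : ℕ) (Δ α : ℝ) (n : ℕ) :
    krawU N q Δ α (n + 1) = krawLimA N q Δ α n * krawLimC N q Δ α (n + 1) := by
  have h1 : 1 - q ≠ 0 := by linarith
  have h2 : 1 + q ≠ 0 := by linarith
  rw [krawU, krawLimA, krawLimC]
  generalize N / 2 = j
  have hx : 0 < q ^ n := pow_pos hq₀ n
  split_ifs with hN h h' h' h h' h'
  · subst h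
    rw [krawUOdd, if_pos rfl]
    field_simp
    ring
  · omega
  · omega
  · exact krawUOdd_eq_left hq₀ hq₁ α h
  · omega
  · subst h
    simp only [krawUEven, hahnC]
    rw [if_neg (by omega), if_true]
    simp only [pow_add, pow_mul', pow_one, mul_pow]
    generalize q ^ n = w at *
    have e1 : q - 1 / w ^ 2 * (w ^ 2 * q ^ 2) = q * (1 - q) := by
      field_simp
    have e2 : 1 - 1 / w ^ 2 * (w ^ 2 * q ^ 2) = (1 - q) * (1 + q) := by
      field_simp
      ring
    rw [e1, e2]
    field_simp
  · subst h'
    simp only [krawUEven, hahnA]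
    rw [if_true]
    simp only [pow_add, pow_mul', pow_one, mul_pow]
    generalize q ^ n = w at *
    have e1 : 1 - 1 / (w ^ 2 * q ^ 2) * w ^ 2 = -((1 - q) * (1 + q)) / q ^ 2 := by
      field_simp
      ring
    have e2 : 1 - 1 / (w ^ 2 * q ^ 2) * (w ^ 2 * q) = -(1 - q) / q := by
      field_simp
      ring
    rw [e1, e2]
    field_simp
    ring
  · exact krawUEven_eq_left hq₀ hq₁ α h h'

/-- The factor `P` in `abcd → P` as `t → 0`. -/
def truncP (N : ℕ) (q : ℝ) : ℝ :=
  if Odd N then 1 / (q ^ (N / 2)) ^ 2 else q / (q ^ (N / 2)) ^ 2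

theorem one_sub_ne_of_sq_ne {q : ℝ} (hq₀ : 0 < q) (hq₁ : q < 1) {j n k l : ℕ}
    (h : 2 * j + k ≠ 2 * n + l) : 1 - q ^ l / ((q ^ j) ^ 2 * q ^ k) * (q ^ n) ^ 2 ≠ 0 := by
  have hw : (q ^ j) ^ 2 * q ^ k ≠ 0 := by positivity
  rw [div_mul_eq_mul_div, one_sub_div hw, mul_comm (q ^ l)]
  exact div_ne_zero (sq_pow_sub hq₀ hq₁ h) hw

theorem truncB_eq {q : ℝ} (hq₀ : 0 < q) (N : ℕ) (e₁ a t : ℝ) :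
    truncB N q e₁ a t = a⁻¹ * (1 / q ^ (N / 2) * q ^ (e₁ * t)) := by
  rw [truncB, rpow_trunc hq₀]

theorem truncD_eq_of_odd {q : ℝ} (hq₀ : 0 < q) {N : ℕ} (hN : Odd N) (e₂ c t : ℝ) :
    truncD N q e₂ c t = c⁻¹ * (1 / q ^ (N / 2) * q ^ (e₂ * t)) := by
  rw [truncD, if_pos hN, add_zero, rpow_trunc hq₀]

theorem truncD_eq_of_even {q : ℝ} (hq₀ : 0 < q) {N : ℕ} (hN : ¬Odd N) (e₂ c t : ℝ) :
    truncD N q e₂ c t = c⁻¹ * (q / q ^ (N / 2) * q ^ (e₂ * t)) := by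
  rw [truncD, if_neg hN, add_assoc, rpow_trunc hq₀, Real.rpow_add hq₀, Real.rpow_one]
  ring

/-- Only the factor `1 - ac q^n` depends on more than `q` and `a/c`. Writing it as `-ac q^n (1 -
1/(ac q^n))` exhibits the limit as `c` times a factor tending to `1` as `ac → ∞`, times a function
of `a/c`. -/
theorem tendsto_awA_trunc {q : ℝ} (hq₀ : 0 < q) (hq₁ : q < 1) (N : ℕ) {e₁ e₂ α a c : ℝ}
    (he : e₁ + e₂ ≠ 0) (hα : α = e₁ / (e₁ + e₂)) (ha : a ≠ 0) (hc : c ≠ 0) (n : ℕ) :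
    Tendsto (fun t => awA a (truncB N q e₁ a t) c (truncD N q e₂ c t) q n) (𝓝[≠] 0)
      (𝓝 (c * (1 - 1 / (a * c * q ^ n)) * krawLimA N q (a / c) α n)) := by
  have hq := hq₀.ne'
  have h1 : 1 - q ≠ 0 := by linarith
  have t₁ := tendsto_rpow_mul hq₀ e₁
  have t₂ := tendsto_rpow_mul hq₀ e₂
  have tα : Tendsto (fun t : ℝ => (1 - q ^ (e₁ * t)) / (1 - q ^ (e₁ * t) * q ^ (e₂ * t)))
      (𝓝[≠] 0) (𝓝 α) := by
    rw [hα]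
    refine (tendsto_one_sub_rpow_div hq₀ hq₁ e₁ (e₁ + e₂) he).congr fun t => ?_
    rw [add_mul, Real.rpow_add hq₀]
  have hx : 0 < q ^ n := pow_pos hq₀ n
  simp only [truncB_eq hq₀]
  rw [krawLimA]
  split_ifs with hN h h
  · simp only [truncD_eq_of_odd hq₀ hN]
    generalize N / 2 = j at *
    subst h
    have d : 1 - 1 / q ^ n * (1 / q ^ n) * ((q ^ n) ^ 2 / q) = -(1 - q) / q := by
      field_simp
      ring
    have L := tendsto_awA_of_right (r := 1 / q ^ n) (s := 1 / q ^ n) hq ha hc t₁ t₂ tα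
      (n := n) (by field_simp) (by field_simp)
      (by rw [d]; exact div_ne_zero (neg_ne_zero.mpr h1) hq)
    convert L using 2
    rw [d, pow_succ]
    field_simp
    ring
  · simp only [truncD_eq_of_odd hq₀ hN]
    generalize N / 2 = j at *
    have hw : 0 < q ^ j := pow_pos hq₀ j
    have d₁ := one_sub_ne_of_sq_ne hq₀ hq₁ (j := j) (n := n) (k := 1) (l := 0) (by omega)
    have d₂ := one_sub_ne_of_sq_ne hq₀ hq₁ (j := j) (n := n) (k := 0) (l := 0) (by omega)
    rw [pow_zero, pow_one] at d₁
    rw [pow_zero, mul_one] at d₂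
    have D₁ : 1 - 1 / q ^ j * (1 / q ^ j) * ((q ^ n) ^ 2 / q)
        = 1 - 1 / ((q ^ j) ^ 2 * q) * (q ^ n) ^ 2 := by field_simp
    have D₂ : 1 - 1 / q ^ j * (1 / q ^ j) * (q ^ n) ^ 2 = 1 - 1 / (q ^ j) ^ 2 * (q ^ n) ^ 2 := by
      field_simp
    have D₃ : 1 - 1 / ((q ^ j) ^ 2 * q) * ((q ^ n) ^ 2 * q) = 1 - 1 / (q ^ j) ^ 2 * (q ^ n) ^ 2 := by
      field_simp
    have L := tendsto_awA (r := 1 / q ^ j) (s := 1 / q ^ j) hq ha hc t₁ t₂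
      (n := n) (by rwa [D₁]) (by rwa [D₂])
    convert L using 2
    rw [D₁, D₂, hahnA, pow_succ q (2 * n), pow_mul' q 2 n, D₃]
    generalize 1 - 1 / ((q ^ j) ^ 2 * q) * (q ^ n) ^ 2 = X at *
    generalize 1 - 1 / (q ^ j) ^ 2 * (q ^ n) ^ 2 = Y at *
    field_simp
    ring
  · simp only [truncD_eq_of_even hq₀ hN]
    generalize N / 2 = j at *
    subst h
    have d : 1 - 1 / q ^ n * (q / q ^ n) * (q ^ n) ^ 2 = 1 - q := by
      field_simp
    have L := tendsto_awA_of_left (r := 1 / q ^ n) (s := q / q ^ n) hq ha hc t₁ t₂ tα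
      (n := n) (by field_simp) (by field_simp) (by rw [d]; exact h1)
    convert L using 2
    rw [d]
    field_simp
    ring
  · simp only [truncD_eq_of_even hq₀ hN]
    generalize N / 2 = j at *
    have hw : 0 < q ^ j := pow_pos hq₀ j
    have d₁ := one_sub_ne_of_sq_ne hq₀ hq₁ (j := j) (n := n) (k := 0) (l := 0) (by omega)
    have d₂ := one_sub_ne_of_sq_ne hq₀ hq₁ (j := j) (n := n) (k := 0) (l := 1) (by omega)
    rw [pow_zero, mul_one] at d₁
    rw [pow_zero, pow_one, mul_one] at d₂
    have D₁ : 1 - 1 / q ^ j * (q / q ^ j) * ((q ^ n) ^ 2 / q)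
        = 1 - 1 / (q ^ j) ^ 2 * (q ^ n) ^ 2 := by field_simp
    have D₂ : 1 - 1 / q ^ j * (q / q ^ j) * (q ^ n) ^ 2 = 1 - q / (q ^ j) ^ 2 * (q ^ n) ^ 2 := by
      field_simp
    have D₃ : 1 - 1 / (q ^ j) ^ 2 * ((q ^ n) ^ 2 * q) = 1 - q / (q ^ j) ^ 2 * (q ^ n) ^ 2 := by
      field_simp
    have L := tendsto_awA (r := 1 / q ^ j) (s := q / q ^ j) hq ha hc t₁ t₂
      (n := n) (by rwa [D₁]) (by rwa [D₂])
    convert L using 2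
    rw [D₁, D₂, hahnA, pow_succ q (2 * n), pow_mul' q 2 n, D₃]
    generalize 1 - 1 / (q ^ j) ^ 2 * (q ^ n) ^ 2 = X at *
    generalize 1 - q / (q ^ j) ^ 2 * (q ^ n) ^ 2 = Y at *
    field_simp
    ring

/-- Here `1 - bd q^(n-1)` is the factor tending to `1`, and `a (1 - bc q^(n-1))` is `c` times a
function of `a/c`. The singular quotient is `(1 - E₂)/(1 - E₁E₂) → 1 - α`. -/
theorem tendsto_awC_trunc {q : ℝ} (hq₀ : 0 < q) (hq₁ : q < 1) (N : ℕ) {e₁ e₂ α a c : ℝ}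
    (he : e₁ + e₂ ≠ 0) (hα : α = e₁ / (e₁ + e₂)) (ha : a ≠ 0) (hc : c ≠ 0) (n : ℕ) :
    Tendsto (fun t => awC a (truncB N q e₁ a t) c (truncD N q e₂ c t) q n) (𝓝[≠] 0)
      (𝓝 (c * (1 - truncP N q * (q ^ n / q) / (a * c)) * krawLimC N q (a / c) α n)) := by
  have hq := hq₀.ne'
  have h1 : 1 - q ≠ 0 := by linarith
  have t₁ := tendsto_rpow_mul hq₀ e₁
  have t₂ := tendsto_rpow_mul hq₀ e₂
  have tα : Tendsto (fun t : ℝ => (1 - q ^ (e₂ * t)) / (1 - q ^ (e₁ * t) * q ^ (e₂ * t)))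
      (𝓝[≠] 0) (𝓝 (1 - α)) := by
    rw [hα, show 1 - e₁ / (e₁ + e₂) = e₂ / (e₁ + e₂) by field_simp; ring]
    refine (tendsto_one_sub_rpow_div hq₀ hq₁ e₂ (e₁ + e₂) he).congr fun t => ?_
    rw [add_mul, Real.rpow_add hq₀]
  have hx : 0 < q ^ n := pow_pos hq₀ n
  simp only [truncB_eq hq₀]
  rw [krawLimC, truncP]
  split_ifs with hN h h
  · simp only [truncD_eq_of_odd hq₀ hN]
    generalize N / 2 = j at *
    subst h
    have hw : 0 < q ^ j := pow_pos hq₀ j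
    simp only [pow_succ q j] at *
    have d : 1 - 1 / q ^ j * (1 / q ^ j) * ((q ^ (j + 1)) ^ 2 / q) = 1 - q := by
      field_simp
      ring
    have L := tendsto_awC_of_left (r := 1 / q ^ j) (s := 1 / q ^ j) hq ha hc t₁ t₂ tα
      (n := j + 1) (by field_simp; ring) (by field_simp; ring) (by rw [d]; exact h1)
    convert L using 2
    rw [d]
    simp only [pow_succ q j]
    field_simp
  · simp only [truncD_eq_of_odd hq₀ hN]
    generalize N / 2 = j at *
    have hw : 0 < q ^ j := pow_pos hq₀ j
    have d₁ := one_sub_ne_of_sq_ne hq₀ hq₁ (j := j) (n := n) (k := 2) (l := 0) (by omega)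
    have d₂ := one_sub_ne_of_sq_ne hq₀ hq₁ (j := j) (n := n) (k := 1) (l := 0) (by omega)
    rw [pow_zero] at d₁
    rw [pow_zero, pow_one] at d₂
    have D₁ : 1 - 1 / q ^ j * (1 / q ^ j) * ((q ^ n) ^ 2 / q ^ 2)
        = 1 - 1 / ((q ^ j) ^ 2 * q ^ 2) * (q ^ n) ^ 2 := by field_simp
    have D₂ : 1 - 1 / q ^ j * (1 / q ^ j) * ((q ^ n) ^ 2 / q)
        = 1 - 1 / ((q ^ j) ^ 2 * q) * (q ^ n) ^ 2 := by
      field_simp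
    have D₃ : q - 1 / ((q ^ j) ^ 2 * q) * (q ^ n) ^ 2
        = q * (1 - 1 / ((q ^ j) ^ 2 * q ^ 2) * (q ^ n) ^ 2) := by
      field_simp
    have L := tendsto_awC (r := 1 / q ^ j) (s := 1 / q ^ j) hq ha hc t₁ t₂
      (n := n) (by rwa [D₁]) (by rwa [D₂])
    convert L using 2
    rw [D₁, D₂, hahnC, pow_mul' q 2 n, D₃]
    generalize 1 - 1 / ((q ^ j) ^ 2 * q ^ 2) * (q ^ n) ^ 2 = X at *
    generalize 1 - 1 / ((q ^ j) ^ 2 * q) * (q ^ n) ^ 2 = Y at *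
    field_simp
  · simp only [truncD_eq_of_even hq₀ hN]
    generalize N / 2 = j at *
    subst h
    have d : 1 - 1 / q ^ n * (q / q ^ n) * ((q ^ n) ^ 2 / q ^ 2) = -(1 - q) / q := by
      field_simp
      ring
    have L := tendsto_awC_of_right (r := 1 / q ^ n) (s := q / q ^ n) hq ha hc t₁ t₂ tα
      (n := n) (by field_simp) (by field_simp)
      (by rw [d]; exact div_ne_zero (neg_ne_zero.mpr h1) hq)
    convert L using 2
    rw [d]
    field_simp
  · simp only [truncD_eq_of_even hq₀ hN]
    generalize N / 2 = j at *
    have hw : 0 < q ^ j := pow_pos hq₀ j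
    have d₁ := one_sub_ne_of_sq_ne hq₀ hq₁ (j := j) (n := n) (k := 1) (l := 0) (by omega)
    have d₂ := one_sub_ne_of_sq_ne hq₀ hq₁ (j := j) (n := n) (k := 0) (l := 0) (by omega)
    rw [pow_zero, pow_one] at d₁
    rw [pow_zero, mul_one] at d₂
    have D₁ : 1 - 1 / q ^ j * (q / q ^ j) * ((q ^ n) ^ 2 / q ^ 2)
        = 1 - 1 / ((q ^ j) ^ 2 * q) * (q ^ n) ^ 2 := by field_simp
    have D₂ : 1 - 1 / q ^ j * (q / q ^ j) * ((q ^ n) ^ 2 / q)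
        = 1 - 1 / (q ^ j) ^ 2 * (q ^ n) ^ 2 := by
      field_simp
    have D₃ : q - 1 / (q ^ j) ^ 2 * (q ^ n) ^ 2
        = q * (1 - 1 / ((q ^ j) ^ 2 * q) * (q ^ n) ^ 2) := by
      field_simp
    have L := tendsto_awC (r := 1 / q ^ j) (s := q / q ^ j) hq ha hc t₁ t₂
      (n := n) (by rwa [D₁]) (by rwa [D₂])
    convert L using 2
    rw [D₁, D₂, hahnC, pow_mul' q 2 n, D₃]
    generalize 1 - 1 / ((q ^ j) ^ 2 * q) * (q ^ n) ^ 2 = X at *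
    generalize 1 - 1 / (q ^ j) ^ 2 * (q ^ n) ^ 2 = Y at *
    field_simp

theorem tendsto_truncDiag {q : ℝ} (hq₀ : 0 < q) (hq₁ : q < 1) (N : ℕ) {e₁ e₂ α a c : ℝ}
    (he : e₁ + e₂ ≠ 0) (hα : α = e₁ / (e₁ + e₂)) (ha : a ≠ 0) (hc : c ≠ 0) (n : ℕ) :
    Tendsto (truncDiag N q e₁ e₂ a c n) (𝓝[≠] 0)
      (𝓝 (1 / 2 * (a + a⁻¹ - c * (1 - 1 / (a * c * q ^ n)) * krawLimA N q (a / c) α n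
        - c * (1 - truncP N q * (q ^ n / q) / (a * c)) * krawLimC N q (a / c) α n))) :=
  ((tendsto_const_nhds.sub (tendsto_awA_trunc hq₀ hq₁ N he hα ha hc n)).sub
    (tendsto_awC_trunc hq₀ hq₁ N he hα ha hc n)).const_mul _

theorem tendsto_truncOff {q : ℝ} (hq₀ : 0 < q) (hq₁ : q < 1) (N : ℕ) {e₁ e₂ α a c : ℝ}
    (he : e₁ + e₂ ≠ 0) (hα : α = e₁ / (e₁ + e₂)) (ha : a ≠ 0) (hc : c ≠ 0) (n : ℕ) :
    Tendsto (truncOff N q e₁ e₂ a c (n + 1)) (𝓝[≠] 0)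
      (𝓝 (1 / 4 * (c * (1 - 1 / (a * c * q ^ n)) * krawLimA N q (a / c) α n
        * (c * (1 - truncP N q * (q ^ (n + 1) / q) / (a * c))
          * krawLimC N q (a / c) α (n + 1))))) := by
  have h := ((tendsto_awA_trunc hq₀ hq₁ N he hα ha hc n).mul
    (tendsto_awC_trunc hq₀ hq₁ N he hα ha hc (n + 1))).const_mul (1 / 4)
  refine h.congr fun t => ?_
  rw [truncOff, awOff, Nat.cast_succ, add_sub_cancel_right]

/-! ### The limit `θ → ∞` -/

theorem eventually_scaling {a c : ℝ → ℝ} {Δ : ℝ}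
    (h : ∀ᶠ θ in atTop, a θ * c θ = θ ∧ a θ / c θ = Δ) :
    ∀ᶠ θ in atTop, a θ ≠ 0 ∧ c θ ≠ 0 ∧ a θ * c θ = θ ∧ a θ / c θ = Δ := by
  filter_upwards [h, eventually_gt_atTop 0] with θ hθ hpos
  refine ⟨fun h0 => ?_, fun h0 => ?_, hθ⟩
  · rw [h0, zero_mul] at hθ; exact hpos.ne hθ.1
  · rw [h0, mul_zero] at hθ; exact hpos.ne hθ.1

theorem tendsto_xLattice {q Δ : ℝ} {a c : ℝ → ℝ}
    (h : ∀ᶠ θ in atTop, a θ * c θ = θ ∧ a θ / c θ = Δ) (i : ℕ) :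
    Tendsto (fun θ => 2 * a θ / θ * xLattice q (a θ) (c θ) i) atTop (𝓝 (yLattice q Δ i)) := by
  have hinv : Tendsto (fun θ : ℝ => θ⁻¹) atTop (𝓝 0) := tendsto_inv_atTop_zero
  simp only [yLattice, xLattice]
  split_ifs with hi
  · have L : Tendsto (fun θ : ℝ => θ⁻¹ * q ^ (-((i / 2 : ℕ) : ℤ)) + Δ * q ^ (i / 2)) atTop
        (𝓝 (0 * q ^ (-((i / 2 : ℕ) : ℤ)) + Δ * q ^ (i / 2))) :=
      (hinv.mul_const _).add_const _
    rw [zero_mul, zero_add] at L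
    refine L.congr' ?_
    filter_upwards [eventually_scaling h] with θ ⟨ha, hc, h1, h2⟩
    generalize a θ = A at *
    generalize c θ = C at *
    rw [← h2, ← h1]
    field_simp
  · have L : Tendsto (fun θ : ℝ => Δ * θ⁻¹ * q ^ (-((i / 2 : ℕ) : ℤ)) + q ^ (i / 2)) atTop
        (𝓝 (Δ * 0 * q ^ (-((i / 2 : ℕ) : ℤ)) + q ^ (i / 2))) :=
      ((hinv.const_mul _).mul_const _).add_const _
    rw [mul_zero, zero_mul, zero_add] at L
    refine L.congr' ?_
    filter_upwards [eventually_scaling h] with θ ⟨ha, hc, h1, h2⟩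
    generalize a θ = A at *
    generalize c θ = C at *
    rw [← h2, ← h1]
    field_simp

theorem tendsto_racahB {q : ℝ} (hq₀ : 0 < q) (hq₁ : q < 1) (N : ℕ) {e₁ e₂ α Δ : ℝ}
    (he : e₁ + e₂ ≠ 0) (hα : α = e₁ / (e₁ + e₂)) {a c : ℝ → ℝ}
    (h : ∀ᶠ θ in atTop, a θ * c θ = θ ∧ a θ / c θ = Δ) (n : ℕ) :
    Tendsto (fun θ => 2 * a θ / θ * racahB N q e₁ e₂ (a θ) (c θ) n) atTop
      (𝓝 (krawB N q Δ α n)) := by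
  have hinv : Tendsto (fun θ : ℝ => θ⁻¹) atTop (𝓝 0) := tendsto_inv_atTop_zero
  -- For large `θ` the rescaled coefficient equals this expression exactly: the prefactor `2a/θ`
  -- turns `a/2`, `a⁻¹/2` and `c/2` into `Δ`, `θ⁻¹` and `1`.
  have L : Tendsto (fun θ : ℝ => Δ + θ⁻¹ - (1 - θ⁻¹ * (1 / q ^ n)) * krawLimA N q Δ α n
      - (1 - θ⁻¹ * (truncP N q * (q ^ n / q))) * krawLimC N q Δ α n) atTop
      (𝓝 (Δ + 0 - (1 - 0 * (1 / q ^ n)) * krawLimA N q Δ α n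
      - (1 - 0 * (truncP N q * (q ^ n / q))) * krawLimC N q Δ α n)) :=
    ((hinv.const_add _).sub (((hinv.mul_const _).const_sub 1).mul_const _)).sub
      (((hinv.mul_const _).const_sub 1).mul_const _)
  simp only [zero_mul, sub_zero, add_zero, one_mul] at L
  rw [krawB_eq hq₀ hq₁]
  refine L.congr' ?_
  filter_upwards [eventually_scaling h] with θ ⟨ha, hc, h1, h2⟩
  rw [racahB, (tendsto_truncDiag hq₀ hq₁ N he hα ha hc n).limUnder_eq, h2]
  have hx : q ^ n ≠ 0 := (pow_pos hq₀ n).ne'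
  generalize a θ = A at *
  generalize c θ = C at *
  rw [← h1]
  nth_rewrite 1 [← h2]
  have hq := hq₀.ne'
  field_simp

theorem tendsto_racahU {q : ℝ} (hq₀ : 0 < q) (hq₁ : q < 1) (N : ℕ) {e₁ e₂ α Δ : ℝ}
    (he : e₁ + e₂ ≠ 0) (hα : α = e₁ / (e₁ + e₂)) {a c : ℝ → ℝ}
    (h : ∀ᶠ θ in atTop, a θ * c θ = θ ∧ a θ / c θ = Δ) (n : ℕ) :
    Tendsto (fun θ => 4 * a θ ^ 2 / θ ^ 2 * racahU N q e₁ e₂ (a θ) (c θ) (n + 1)) atTop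
      (𝓝 (krawU N q Δ α (n + 1))) := by
  have hinv : Tendsto (fun θ : ℝ => θ⁻¹) atTop (𝓝 0) := tendsto_inv_atTop_zero
  have L : Tendsto (fun θ : ℝ => (1 - θ⁻¹ * (1 / q ^ n)) * krawLimA N q Δ α n
      * ((1 - θ⁻¹ * (truncP N q * (q ^ (n + 1) / q))) * krawLimC N q Δ α (n + 1))) atTop
      (𝓝 ((1 - 0 * (1 / q ^ n)) * krawLimA N q Δ α n
      * ((1 - 0 * (truncP N q * (q ^ (n + 1) / q))) * krawLimC N q Δ α (n + 1)))) :=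
    (((hinv.mul_const _).const_sub 1).mul_const _).mul
      (((hinv.mul_const _).const_sub 1).mul_const _)
  simp only [zero_mul, sub_zero, one_mul] at L
  rw [krawU_eq hq₀ hq₁]
  refine L.congr' ?_
  filter_upwards [eventually_scaling h] with θ ⟨ha, hc, h1, h2⟩
  rw [racahU, (tendsto_truncOff hq₀ hq₁ N he hα ha hc n).limUnder_eq, h2]
  have hx : q ^ n ≠ 0 := (pow_pos hq₀ n).ne'
  generalize a θ = A at *
  generalize c θ = C at *
  rw [← h1]
  have hq := hq₀.ne'
  field_simp

/-! ### Rescaling and continuity of monic families; the final assembly. -/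

theorem eval_monicOP_scale (b u : ℕ → ℝ) {l : ℝ} (hl : l ≠ 0) (y : ℝ) (n : ℕ) :
    l ^ (-(n : ℤ)) * (monicOP b u n).eval (l * y)
      = (monicOP (fun n => l⁻¹ * b n) (fun n => (l ^ 2)⁻¹ * u n) n).eval y := by
  rw [zpow_neg, zpow_natCast]
  induction n using Nat.strong_induction_on with
  | _ n ih =>
    match n, ih with
    | 0, _ => simp [eval_monicOP_zero]
    | 1, _ =>
      rw [eval_monicOP_one, eval_monicOP_one]
      field_simp
    | n + 2, ih =>
      rw [eval_monicOP_add_two, eval_monicOP_add_two, ← ih n (by omega), ← ih (n + 1) (by omega)]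
      field_simp
      ring

theorem tendsto_eval_monicOP {ι : Type*} {F : Filter ι} (b u : ι → ℕ → ℝ) (b' u' : ℕ → ℝ) (N : ℕ)
    (hb : ∀ n ≤ N, Tendsto (fun i => b i n) F (𝓝 (b' n)))
    (hu : ∀ n, 1 ≤ n → n ≤ N → Tendsto (fun i => u i n) F (𝓝 (u' n))) (y : ℝ) :
    ∀ n ≤ N + 1, Tendsto (fun i => (monicOP (b i) (u i) n).eval y) F
      (𝓝 ((monicOP b' u' n).eval y)) := by
  intro n
  induction n using Nat.strong_induction_on with
  | _ n ih =>
    intro hn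
    match n, ih, hn with
    | 0, _, _ =>
      simp only [eval_monicOP_zero]
      exact tendsto_const_nhds
    | 1, _, _ =>
      simp only [eval_monicOP_one]
      exact (hb 0 (Nat.zero_le _)).const_sub y
    | n + 2, ih, hn =>
      simp only [eval_monicOP_add_two]
      exact (((hb (n + 1) (by omega)).const_sub y).mul (ih (n + 1) (by omega) (by omega))).sub
        ((hu (n + 1) (by omega) (by omega)).mul (ih n (by omega) (by omega)))

theorem tendsto_racah {q : ℝ} (hq₀ : 0 < q) (hq₁ : q < 1) (N : ℕ) {e₁ e₂ α Δ : ℝ}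
    (he : e₁ + e₂ ≠ 0) (hα : α = e₁ / (e₁ + e₂)) {a c : ℝ → ℝ}
    (h : ∀ᶠ θ in atTop, a θ * c θ = θ ∧ a θ / c θ = Δ) {n : ℕ} (hn : n ≤ N + 1) (y : ℝ) :
    Tendsto (fun θ => (θ / (2 * a θ)) ^ (-(n : ℤ)) *
        (racah N q e₁ e₂ (a θ) (c θ) n).eval (θ / (2 * a θ) * y)) atTop
      (𝓝 ((monicOP (krawB N q Δ α) (krawU N q Δ α) n).eval y)) := by
  have L := tendsto_eval_monicOP (F := atTop)
    (fun θ k => 2 * a θ / θ * racahB N q e₁ e₂ (a θ) (c θ) k)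
    (fun θ k => 4 * a θ ^ 2 / θ ^ 2 * racahU N q e₁ e₂ (a θ) (c θ) k)
    (krawB N q Δ α) (krawU N q Δ α) N
    (fun k _ => tendsto_racahB hq₀ hq₁ N he hα h k)
    (fun k hk _ => by
      obtain ⟨k, rfl⟩ := Nat.exists_eq_add_of_le' hk
      exact tendsto_racahU hq₀ hq₁ N he hα h k) y n hn
  refine L.congr' ?_
  filter_upwards [eventually_scaling h] with θ ⟨ha, hc, h1, _⟩
  have hθ : θ ≠ 0 := by rw [← h1]; exact mul_ne_zero ha hc
  rw [racah, eval_monicOP_scale _ _ (div_ne_zero hθ (mul_ne_zero two_ne_zero ha)), inv_div,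
    ← inv_pow, inv_div]
  congr 3
  funext k
  rw [div_pow, mul_pow]
  norm_num

theorem monicOP_recurrence (b u : ℕ → ℝ) {n : ℕ} (hn : 1 ≤ n) :
    X * monicOP b u n = monicOP b u (n + 1) + C (b n) * monicOP b u n
      + C (u n) * monicOP b u (n - 1) := by
  obtain ⟨n, rfl⟩ := Nat.exists_eq_add_of_le' hn
  rw [Nat.add_sub_cancel, show n + 1 + 1 = n + 2 from rfl, monicOP]
  ring

theorem orthogonality {q Δ : ℝ} (hq₀ : 0 < q) (hq₁ : q < 1) (hΔ : 0 < Δ) (α : ℝ) {N : ℕ}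
    (hN : 1 ≤ N)
    (h : ∀ k : ℤ, -(((N / 2 : ℕ) : ℤ) + if Odd N then 0 else 1) ≤ k → k ≤ ((N / 2 : ℕ) : ℤ) →
      Δ ≠ q ^ k) :
    ∀ n ≤ N, ∀ m ≤ N,
      ∑ i ∈ Finset.range (N + 1), krawW N q Δ α i
          * (monicOP (krawB N q Δ α) (krawU N q Δ α) n).eval (yLattice q Δ i)
          * (monicOP (krawB N q Δ α) (krawU N q Δ α) m).eval (yLattice q Δ i)
        = if n = m then ∏ k ∈ Finset.Icc 1 n, krawU N q Δ α k else 0 := by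
  -- The excluded exponents split by sign: `k = i` gives the conditions on `Δ = q^i`, and `k = -i`
  -- those on `Δ q^i = 1`, which extend one step further when `N` is even.
  have h₁ : ∀ i ≤ N / 2, Δ ≠ q ^ i := fun i hi => by
    have := h i (by split_ifs <;> omega) (by exact_mod_cast hi)
    rwa [zpow_natCast] at this
  have h₂ : ∀ i : ℕ, (i : ℤ) ≤ ((N / 2 : ℕ) : ℤ) + (if Odd N then 0 else 1) → Δ * q ^ i ≠ 1 :=
    fun i hi e => by
      refine h (-i) (by omega) (by omega) ?_
      rw [zpow_neg, zpow_natCast]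
      exact eq_inv_of_mul_eq_one_left e
  by_cases hodd : Odd N
  · have eB : krawB N q Δ α = krawBOdd (N / 2) q Δ α := by
      funext k
      rw [krawB, if_pos hodd]
    have eU : krawU N q Δ α = krawUOdd (N / 2) q Δ α := by
      funext k
      rw [krawU, if_pos hodd]
    simp only [krawW, if_pos hodd, eB, eU]
    rw [if_pos hodd] at h₂
    have key := orthogonality_odd hq₀ hq₁ hΔ α (N / 2) h₁ fun i hi => h₂ i (by omega)
    have e : 2 * (N / 2) + 1 = N := Nat.two_mul_div_two_add_one_of_odd hodd
    rw [show 2 * (N / 2) + 2 = N + 1 by omega] at key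
    rw [e] at key
    exact key
  · have eB : krawB N q Δ α = krawBEven (N / 2) q Δ := by
      funext k
      rw [krawB, if_neg hodd]
    have eU : krawU N q Δ α = krawUEven (N / 2) q Δ α := by
      funext k
      rw [krawU, if_neg hodd]
    simp only [krawW, if_neg hodd, eB, eU]
    rw [if_neg hodd] at h₂
    have e : 2 * (N / 2) = N := Nat.two_mul_div_two_of_even (Nat.not_odd_iff_even.mp hodd)
    obtain ⟨r, hr⟩ : ∃ r, N / 2 = r + 1 := ⟨N / 2 - 1, by omega⟩
    rw [hr] at h₁ h₂ e ⊢
    have key := orthogonality_even hq₀ hq₁ hΔ α r h₁ fun i hi => h₂ i (by push_cast; omega)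
    rw [e] at key
    exact key

end QPara

end

theorem mainTheorem7 (N : ℕ) (hN : 1 ≤ N) (q Δ e₁ e₂ α : ℝ) (hq₀ : 0 < q) (hq₁ : q < 1)
    (hΔ : 0 < Δ) (he : e₁ + e₂ ≠ 0) (hα : α = e₁ / (e₁ + e₂)) :
    -- the limits `t → 0` defining the recurrence coefficients of the `R_n` exist
    (∀ a c : ℝ, a ≠ 0 → c ≠ 0 →
      (∀ n ≤ N, Tendsto (QPara.truncDiag N q e₁ e₂ a c n) (𝓝[≠] 0)
        (𝓝 (QPara.racahB N q e₁ e₂ a c n))) ∧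
      (∀ n, 1 ≤ n → n ≤ N → Tendsto (QPara.truncOff N q e₁ e₂ a c n) (𝓝[≠] 0)
        (𝓝 (QPara.racahU N q e₁ e₂ a c n)))) ∧
    -- the rescaled lattice and recurrence coefficients converge as `θ = a c → ∞`, `a / c = Δ`
    (∀ a c : ℝ → ℝ, (∀ᶠ θ in atTop, a θ * c θ = θ ∧ a θ / c θ = Δ) →
      (∀ i ≤ N, Tendsto (fun θ => 2 * a θ / θ * QPara.xLattice q (a θ) (c θ) i) atTop
        (𝓝 (QPara.yLattice q Δ i))) ∧
      (∀ n ≤ N, Tendsto (fun θ => 2 * a θ / θ * QPara.racahB N q e₁ e₂ (a θ) (c θ) n) atTop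
        (𝓝 (QPara.krawB N q Δ α n))) ∧
      (∀ n, 1 ≤ n → n ≤ N →
        Tendsto (fun θ => 4 * a θ ^ 2 / θ ^ 2 * QPara.racahU N q e₁ e₂ (a θ) (c θ) n) atTop
          (𝓝 (QPara.krawU N q Δ α n)))) ∧
    ∃ Q : ℕ → ℝ[X],
      -- the `Q_n` are the limits of the rescaled `R_n`
      (∀ a c : ℝ → ℝ, (∀ᶠ θ in atTop, a θ * c θ = θ ∧ a θ / c θ = Δ) →
        ∀ n ≤ N + 1, ∀ y : ℝ,
          Tendsto (fun θ => (θ / (2 * a θ)) ^ (-(n : ℤ)) *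
              (QPara.racah N q e₁ e₂ (a θ) (c θ) n).eval (θ / (2 * a θ) * y)) atTop
            (𝓝 ((Q n).eval y))) ∧
      -- three-term recurrence relation
      Q 0 = 1 ∧
      X * Q 0 = Q 1 + C (QPara.krawB N q Δ α 0) * Q 0 ∧
      (∀ n, 1 ≤ n → n ≤ N →
        X * Q n = Q (n + 1) + C (QPara.krawB N q Δ α n) * Q n
          + C (QPara.krawU N q Δ α n) * Q (n - 1)) ∧
      -- orthogonality; the condition on `Δ` says that the lattice points are distinct and that no
      -- denominator in `K_N` and in the weights vanishes
      ((∀ k : ℤ, -(((N / 2 : ℕ) : ℤ) + if Odd N then 0 else 1) ≤ k → k ≤ ((N / 2 : ℕ) : ℤ) →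
          Δ ≠ q ^ k) →
        ∀ n ≤ N, ∀ m ≤ N,
          ∑ i ∈ Finset.range (N + 1), QPara.krawW N q Δ α i
              * (Q n).eval (QPara.yLattice q Δ i) * (Q m).eval (QPara.yLattice q Δ i)
            = if n = m then ∏ k ∈ Finset.Icc 1 n, QPara.krawU N q Δ α k else 0) := by
  -- The witness for `Q` is built from the limiting coefficients alone, so its recurrence is
  -- immediate and it is visibly independent of `a` and `c`.
  refine ⟨fun a c ha hc => ⟨fun n _ => ?_, fun n hn _ => ?_⟩, fun a c h => ⟨fun i _ => ?_,
    fun n _ => ?_, fun n hn _ => ?_⟩,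
    QPara.monicOP (QPara.krawB N q Δ α) (QPara.krawU N q Δ α), fun a c h n hn y => ?_, rfl, ?_,
    fun n hn _ => QPara.monicOP_recurrence _ _ hn, fun h => ?_⟩
  · have L := QPara.tendsto_truncDiag hq₀ hq₁ N he hα ha hc n
    rw [QPara.racahB, L.limUnder_eq]
    exact L
  · obtain ⟨n, rfl⟩ := Nat.exists_eq_add_of_le' hn
    have L := QPara.tendsto_truncOff hq₀ hq₁ N he hα ha hc n
    rw [QPara.racahU, L.limUnder_eq]
    exact L
  · exact QPara.tendsto_xLattice h i
  · exact QPara.tendsto_racahB hq₀ hq₁ N he hα h n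
  · obtain ⟨n, rfl⟩ := Nat.exists_eq_add_of_le' hn
    exact QPara.tendsto_racahU hq₀ hq₁ N he hα h n
  · exact QPara.tendsto_racah hq₀ hq₁ N he hα h hn y
  · simp [QPara.monicOP]
  · exact QPara.orthogonality hq₀ hq₁ hΔ α hN h
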